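/- Let $(M,g)$ be a smooth $n$-dimensional pseudo-Riemannian manifold and let $\widetilde M=\mathbb R_{>0}\times M$, with $\hat g=dr^2+r^2g$, be the metric cone over it, a manifold of dimension $n+1$. Assume that $\widetilde M$ is connected and simply connected, that $\hat g$ is not flat (its curvature tensor does not vanish identically), and that $\hat g$ has signature $(0,n+1)$, $(1,n)$ or $(n-1,2)$, where the first entry is the number of negative squares and the second the number of positive squares. Fix $p\in\widetilde M$ and let $$T_p\widetilde M=V_0\oplus V_1\oplus\dots\oplus V_\ell$$ be a maximal decomposition into mutually orthogonal, $\hat g$-nondegenerate subspaces invariant under the holonomy group of $\hat g$ at $p$. That is, the holonomy group acts trivially on $V_0$ (where $V_0=0$ is allowed), and each $V_i$ with $i\ge 1$ has dimension at least $2$ and contains no proper nonzero $\hat g$-nondegenerate holonomy-invariant subspace. Let $k$ be the dimension of the space of $1$-forms on $T_p\widetilde M$ that are invariant under the holonomy group (equivalently, the number of linearly independent parallel vector fields on $\widetilde M$). Then $$k\le n-2\qquad\text{and}\qquad 1\le \ell\le \left\lfloor\frac{n-k+1}{3}\right\rfloor .$$ Moreover, for every $i\ge 1$, if $r_i$ denotes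 the dimension of the space of vectors in $V_i$ fixed by the holonomy group, then $\dim V_i\ge r_i+3$. -/

import Mathlib

open Set
open scoped Manifold ContDiff

noncomputable section

/-! ### Local formulas: Christoffel symbols and curvature of a metric on a domain of `E` -/

section Local

variable {E : Type*} [NormedAddCommGroup E] [NormedSpace ℝ E]

/-- The pullback of a bilinear form `B` under a linear map `A`: `(u, v) ↦ B (A u) (A v)`. -/
def pullbackForm {V W : Type*} [AddCommGroup V] [Module ℝ V] [TopologicalSpace V]
    [IsTopologicalAddGroup V] [ContinuousSMul ℝ V] [AddCommGroup W] [Module ℝ W]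
    [TopologicalSpace W] [IsTopologicalAddGroup W] [ContinuousSMul ℝ W]
    (B : W →L[ℝ] W →L[ℝ] ℝ) (A : V →L[ℝ] W) : V →L[ℝ] V →L[ℝ] ℝ :=
  (A.precomp ℝ) ∘L B ∘L A

theorem pullbackForm_apply {V W : Type*} [AddCommGroup V] [Module ℝ V] [TopologicalSpace V]
    [IsTopologicalAddGroup V] [ContinuousSMul ℝ V] [AddCommGroup W] [Module ℝ W]
    [TopologicalSpace W] [IsTopologicalAddGroup W] [ContinuousSMul ℝ W]
    (B : W →L[ℝ] W →L[ℝ] ℝ) (A : V →L[ℝ] W) (u v : V) :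
    pullbackForm B A u v = B (A u) (A v) := rfl

/-- The Christoffel symbols of the first kind of the metric `b` at `y`, as a linear form in the
last argument: `z ↦ (∂_u b(v, z) + ∂_v b(u, z) - ∂_z b(u, v)) / 2`. -/
def christoffelFirst (b : E → E →L[ℝ] E →L[ℝ] ℝ) (y u v : E) : E →L[ℝ] ℝ :=
  (1 / 2 : ℝ) • (fderiv ℝ b y u v + fderiv ℝ b y v u - ((fderiv ℝ b y).flip u).flip v)

/-- The Christoffel symbols `Γ(u, v)` of the metric `b` at `y`: the vector such that
`b(Γ(u, v), z)` is the Christoffel symbol of the first kind, for all `z`. -/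
def christoffel (b : E → E →L[ℝ] E →L[ℝ] ℝ) (y u v : E) : E :=
  (b y).inverse (christoffelFirst b y u v)

/-- The Riemann curvature `R(u, v) w` of the metric `b` at `y`:
`∂_u Γ(v, w) - ∂_v Γ(u, w) + Γ(u, Γ(v, w)) - Γ(v, Γ(u, w))`. -/
def localCurvature (b : E → E →L[ℝ] E →L[ℝ] ℝ) (y u v w : E) : E :=
  fderiv ℝ (fun y' => christoffel b y' v w) y u - fderiv ℝ (fun y' => christoffel b y' u w) y v
    + christoffel b y u (christoffel b y v w) - christoffel b y v (christoffel b y u w)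

theorem christoffel_zero (b : E → E →L[ℝ] E →L[ℝ] ℝ) (y v : E) : christoffel b y 0 v = 0 := by
  have h : christoffelFirst b y 0 v = 0 := by
    ext z
    simp [christoffelFirst]
  simp [christoffel, h]

theorem christoffel_neg (b : E → E →L[ℝ] E →L[ℝ] ℝ) (y u v : E) :
    christoffel b y (-u) v = -christoffel b y u v := by
  have h : christoffelFirst b y (-u) v = -christoffelFirst b y u v := by
    ext z
    simp [christoffelFirst]
    ring
  simp [christoffel, h]

end Local

/-! ### Pseudo-Riemannian metrics, curvature, parallel transport, holonomy -/

section Manifold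

variable {E : Type*} [NormedAddCommGroup E] [NormedSpace ℝ E]
  {H : Type*} [TopologicalSpace H] {I : ModelWithCorners ℝ E H}
  {N : Type*} [TopologicalSpace N] [ChartedSpace H N]

/-- A field of bilinear forms on the tangent spaces of `N`. -/
abbrev FormField (I : ModelWithCorners ℝ E H) (N : Type*) [TopologicalSpace N]
    [ChartedSpace H N] : Type _ :=
  ∀ x : N, TangentSpace I x →L[ℝ] TangentSpace I x →L[ℝ] ℝ

/-- A smooth pseudo-Riemannian metric, of arbitrary signature. -/
structure PseudoRiemannianMetric (I : ModelWithCorners ℝ E H) (N : Type*) [TopologicalSpace N]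
    [ChartedSpace H N] [IsManifold I ∞ N] where
  /-- The bilinear form on each tangent space. -/
  form : FormField I N
  symm : ∀ (x : N) (u v : TangentSpace I x), form x u v = form x v u
  nondegenerate : ∀ (x : N) (u : TangentSpace I x), (∀ v, form x u v = 0) → u = 0
  smooth : ContMDiff I (I.prod 𝓘(ℝ, E →L[ℝ] E →L[ℝ] ℝ)) ∞
    (fun x => Bundle.TotalSpace.mk' (E →L[ℝ] E →L[ℝ] ℝ)
      (E := fun x : N => TangentSpace I x →L[ℝ] TangentSpace I x →L[ℝ] ℝ) x (form x))

/-- `G` has signature `(a, b)`: on every tangent space it has `a` negative and `b` positive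
squares. -/
def HasSignature (G : FormField I N) (a b : ℕ) : Prop :=
  ∀ x : N,
    sigNeg (LinearMap.BilinMap.toQuadraticMap (G x).toLinearMap₁₂) = a ∧
    sigPos (LinearMap.BilinMap.toQuadraticMap (G x).toLinearMap₁₂) = b

/-- The expression of `G` in the chart around `c`, as a function of the coordinates `y`. -/
def metricInChart (G : FormField I N) (c : N) (y : E) : E →L[ℝ] E →L[ℝ] ℝ :=
  pullbackForm (G ((extChartAt I c).symm y)) (mfderiv 𝓘(ℝ, E) I (extChartAt I c).symm y)

/-- `G` is flat: its curvature tensor vanishes identically. -/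
def IsFlat (G : FormField I N) : Prop :=
  ∀ c : N, ∀ y ∈ (extChartAt I c).target, ∀ u v w : E,
    localCurvature (metricInChart G c) y u v w = 0

/-- The coordinates, in the chart around `c`, of a tangent vector. -/
def vectorInChart (c : N) (X : TangentBundle I N) : E :=
  mfderiv I 𝓘(ℝ, E) (extChartAt I c) X.proj X.2

/-- The vector field `X` along the curve `γ : [0, 1] → N` is parallel for the Levi-Civita
connection of `G`: in every chart `dX/dt + Γ(dγ/dt, X) = 0` wherever `γ` is in the chart. -/
def IsParallelAlong (G : FormField I N) (γ : ℝ → N) (X : ℝ → TangentBundle I N) : Prop :=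
  (∀ t ∈ Icc (0 : ℝ) 1, (X t).proj = γ t) ∧
  ∀ c : N, ∀ t ∈ Icc (0 : ℝ) 1, γ t ∈ (extChartAt I c).source →
    HasDerivWithinAt (fun s => vectorInChart c (X s))
      (-christoffel (metricInChart G c) (extChartAt I c (γ t))
        (derivWithin (fun s => extChartAt I c (γ s)) (Icc 0 1) t) (vectorInChart c (X t)))
      (Icc 0 1) t

/-- `IsParallelTransport G p q P`: the isomorphism `P` from the tangent space at `p` to the one at
`q` is the parallel transport along a piecewise `C¹` curve, that is, along a concatenation of
finitely many `C¹` curves. -/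
inductive IsParallelTransport (G : FormField I N) :
    ∀ p q : N, (TangentSpace I p ≃ₗ[ℝ] TangentSpace I q) → Prop
  | segment (p q : N) (P : TangentSpace I p ≃ₗ[ℝ] TangentSpace I q) (γ : ℝ → N)
      (smooth : ContMDiffOn 𝓘(ℝ, ℝ) I 1 γ (Icc 0 1)) (source : γ 0 = p) (target : γ 1 = q)
      (parallel : ∀ v : TangentSpace I p, ∃ X : ℝ → TangentBundle I N,
        IsParallelAlong G γ X ∧ X 0 = ⟨p, v⟩ ∧ X 1 = ⟨q, P v⟩) :
      IsParallelTransport G p q P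
  | concat (p q r : N) (P : TangentSpace I p ≃ₗ[ℝ] TangentSpace I q)
      (Q : TangentSpace I q ≃ₗ[ℝ] TangentSpace I r) :
      IsParallelTransport G p q P → IsParallelTransport G q r Q →
      IsParallelTransport G p r (P.trans Q)

theorem IsParallelAlong.const (G : FormField I N) (p : N) (v : TangentSpace I p) :
    IsParallelAlong G (fun _ => p) (fun _ => (⟨p, v⟩ : TangentBundle I N)) := by
  refine ⟨fun _ _ => rfl, fun c t _ _ => ?_⟩
  simp only [derivWithin_fun_const, Pi.zero_apply, christoffel_zero, neg_zero]
  exact hasDerivWithinAt_const _ _ _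

theorem IsParallelAlong.reverse {G : FormField I N} {γ : ℝ → N} {X : ℝ → TangentBundle I N}
    (h : IsParallelAlong G γ X) :
    IsParallelAlong G (fun t => γ (1 - t)) (fun t => X (1 - t)) := by
  have hm : MapsTo (fun t : ℝ => 1 - t) (Icc 0 1) (Icc 0 1) := fun t ht =>
    ⟨by linarith [ht.2], by linarith [ht.1]⟩
  refine ⟨fun t ht => h.1 _ (hm ht), fun c t ht hc => ?_⟩
  have h1 : HasDerivWithinAt (fun s : ℝ => 1 - s) (-1) (Icc 0 1) t :=
    ((hasDerivAt_id t).const_sub 1).hasDerivWithinAt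
  have h2 := HasDerivWithinAt.scomp t (h.2 c (1 - t) (hm ht) hc) h1 hm
  have hd : derivWithin (fun s => extChartAt I c (γ (1 - s))) (Icc 0 1) t
      = -derivWithin (fun s => extChartAt I c (γ s)) (Icc 0 1) (1 - t) := by
    have h3 := derivWithin_comp_const_sub (f := fun s => extChartAt I c (γ s)) (s := Icc (0 : ℝ) 1)
      (x := t) 1
    simpa using h3
  rw [hd, christoffel_neg]
  simpa [Function.comp_def] using h2

theorem IsParallelTransport.refl (G : FormField I N) (p : N) :
    IsParallelTransport G p p (LinearEquiv.refl ℝ (TangentSpace I p)) :=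
  .segment p p _ (fun _ => p) contMDiffOn_const rfl rfl
    (fun v => ⟨_, IsParallelAlong.const G p v, rfl, rfl⟩)

theorem IsParallelTransport.symm {G : FormField I N} {p q : N}
    {P : TangentSpace I p ≃ₗ[ℝ] TangentSpace I q} (h : IsParallelTransport G p q P) :
    IsParallelTransport G q p P.symm := by
  induction h with
  | segment p q P γ hγ h0 h1 hP =>
    refine .segment q p _ (fun t => γ (1 - t)) ?_ (by simpa using h1) (by simpa using h0) ?_
    · refine hγ.comp (t := Icc (0 : ℝ) 1) ?_ (fun t ht => ⟨by linarith [ht.2], by linarith [ht.1]⟩)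
      exact (contMDiff_iff_contDiff.2 (contDiff_const.sub contDiff_id)).contMDiffOn
    · intro v
      obtain ⟨X, hX, hX0, hX1⟩ := hP (P.symm v)
      exact ⟨_, hX.reverse, by simpa using hX1, by simpa using hX0⟩
  | concat p q r P Q _ _ hP hQ => exact .concat r q p _ _ hQ hP

/-- The holonomy group at `p` of the Levi-Civita connection of `G`. -/
def holonomyGroup (G : FormField I N) (p : N) :
    Subgroup (TangentSpace I p ≃ₗ[ℝ] TangentSpace I p) where
  carrier := {P | IsParallelTransport G p p P}
  mul_mem' := fun {P Q} hP hQ => IsParallelTransport.concat p p p Q P hQ hP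
  one_mem' := IsParallelTransport.refl G p
  inv_mem' := fun {_} hP => IsParallelTransport.symm hP

/-- The `1`-forms on the tangent space at `p` that are invariant under the holonomy group. -/
def invariantForms (G : FormField I N) (p : N) : Submodule ℝ (Module.Dual ℝ (TangentSpace I p)) where
  carrier := {τ | ∀ A ∈ holonomyGroup G p, ∀ v, τ (A v) = τ v}
  add_mem' := fun {a b} ha hb A hA v => by simp [ha A hA v, hb A hA v]
  zero_mem' := fun _ _ _ => rfl
  smul_mem' := fun c a ha A hA v => by simp [ha A hA v]

/-- The vectors at `p` that are fixed by the holonomy group. -/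
def invariantVectors (G : FormField I N) (p : N) : Submodule ℝ (TangentSpace I p) where
  carrier := {v | ∀ A ∈ holonomyGroup G p, A v = v}
  add_mem' := fun {a b} ha hb A hA => by rw [map_add, ha A hA, hb A hA]
  zero_mem' := fun A _ => map_zero A
  smul_mem' := fun c a ha A hA => by rw [map_smul, ha A hA]

/-- The subspace `W` of the tangent space at `p` is invariant under the holonomy group. -/
def IsHolonomyInvariant (G : FormField I N) (p : N) (W : Submodule ℝ (TangentSpace I p)) : Prop :=
  ∀ A ∈ holonomyGroup G p, ∀ v ∈ W, A v ∈ W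

/-- The restriction of `G` to the subspace `W` of the tangent space at `p` is nondegenerate. -/
def IsNondegenerateOn (G : FormField I N) (p : N) (W : Submodule ℝ (TangentSpace I p)) : Prop :=
  ∀ u ∈ W, (∀ v ∈ W, G p u v = 0) → u = 0

/-- A maximal decomposition `V 0 ⊕ V 1 ⊕ ⋯ ⊕ V ℓ` of the tangent space at `p` into mutually
orthogonal, nondegenerate, holonomy-invariant subspaces: the holonomy group acts trivially on
`V 0` (which may be zero), and the other blocks have dimension at least `2` and are indecomposable,
that is, contain no proper nonzero nondegenerate holonomy-invariant subspace (for a nondegenerate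
invariant subspace of a block, its orthogonal complement in the block is one too). -/
structure IsMaximalDecomposition (G : FormField I N) (p : N) (ℓ : ℕ)
    (V : Fin (ℓ + 1) → Submodule ℝ (TangentSpace I p)) : Prop where
  isInternal : DirectSum.IsInternal V
  orthogonal : ∀ i j, i ≠ j → ∀ u ∈ V i, ∀ v ∈ V j, G p u v = 0
  nondegenerate : ∀ i, IsNondegenerateOn G p (V i)
  invariant : ∀ i, IsHolonomyInvariant G p (V i)
  trivial_zero : ∀ A ∈ holonomyGroup G p, ∀ v ∈ V 0, A v = v
  two_le_finrank : ∀ i, i ≠ 0 → 2 ≤ Module.finrank ℝ (V i)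
  indecomposable : ∀ i, i ≠ 0 → ∀ W ≤ V i,
    IsNondegenerateOn G p W → IsHolonomyInvariant G p W → W = ⊥ ∨ W = V i

end Manifold

/-! ### The metric cone -/

/-- The open half-line of positive reals. -/
def positiveReals : TopologicalSpace.Opens ℝ := ⟨Ioi 0, isOpen_Ioi⟩

/-- The cone manifold over `M`: the product of the positive reals and `M`. -/
abbrev Cone (M : Type*) : Type _ := positiveReals × M

/-- The model with corners of the cone over an `n`-dimensional manifold. -/
abbrev coneModel (n : ℕ) :
    ModelWithCorners ℝ (ℝ × EuclideanSpace ℝ (Fin n)) (ModelProd ℝ (EuclideanSpace ℝ (Fin n))) :=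
  𝓘(ℝ, ℝ).prod (𝓡 n)

/-- The cone metric `dr² + r² g`. -/
def coneMetric {n : ℕ} {M : Type*} [TopologicalSpace M] [ChartedSpace (EuclideanSpace ℝ (Fin n)) M]
    (g : FormField (𝓡 n) M) : FormField (coneModel n) (Cone M) := fun p =>
  pullbackForm (ContinuousLinearMap.mul ℝ ℝ)
      (mfderiv (coneModel n) 𝓘(ℝ, ℝ) (fun q : Cone M => (q.1 : ℝ)) p)
    + (p.1 : ℝ) ^ 2 •
      pullbackForm (g p.2) (mfderiv (coneModel n) (𝓡 n) (fun q : Cone M => q.2) p)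

end

set_option maxSynthPendingDepth 3
set_option linter.unusedSectionVars false

noncomputable section

/-! ### Linear differential equations on the unit interval, and differentiability from segments. -/

section Analysis

open Metric

variable {E : Type*} [NormedAddCommGroup E] [NormedSpace ℝ E]
  {F : Type*} [NormedAddCommGroup F] [NormedSpace ℝ F]

/-! On a cone the Euler field ξ = r ∂/∂r satisfies ∇ξ = id. Let V_i be an indecomposable block. The
projection onto V_i at p commutes with the holonomy group, so it spreads to a parallel field A of
selfadjoint projections. Then η = Aξ satisfies ∇η = A, and because A is parallel and the torsion
vanishes, R(u,v)η = 0. Parallel fields are killed by the curvature too. Suppose dim V_i ≤ r_i + 2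
and R(u,v) ≠ 0 on the range of A at some point, hence also near it. If η lies in the span S of the
parallel fields of the block on a whole neighbourhood, differentiating η shows that the range of A
is contained in S, where R vanishes. Otherwise η is outside S at some nearby point; there R(u,v)
kills S + ℝη, of codimension at most one in the block, and a skew endomorphism of a nondegenerate
space that kills a hyperplane is zero. Either way there is a contradiction, so the curvature
vanishes on the block (`isFlatOnRange_endField`). Over a simply connected manifold, every vector of
a parallel subbundle killed by the curvature extends to a parallel field
(`exists_isInvariantField_of_isFlatOnRange`). The holonomy group then fixes V_i pointwise, and a
non-null vector spans a nondegenerate invariant line, against indecomposability. Hence dim V_i ≥ r_i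
+ 3 (`IsMaximalDecomposition.finrank_inf_add_three_le`). Non-flatness forces ℓ ≥ 1. The metric turns
invariant forms into fixed vectors, and these split along the blocks, so k ≤ dim V_0 + Σ (dim V_i -
3) = n + 1 - 3ℓ, which contains both remaining inequalities. Holonomy is given by transport along
curves, curvature by derivatives in charts. Most of the analysis passes between the two:
`hasFDerivAt_of_forall_segment` turns transport invariance into ∇s = 0, `hasFDerivAt_radial` builds
local parallel fields from flatness, and `exists_locallyConstant_section` globalizes them. -/

theorem exists_hasDerivWithinAt_linear [CompleteSpace F] {L : ℝ → F →L[ℝ] F}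
    (hL : ContinuousOn L (Icc 0 1)) (hb : ∀ t ∈ Icc (0 : ℝ) 1, ‖L t‖ ≤ 1 / 2) (x₀ : F) :
    ∃ X : ℝ → F, X 0 = x₀ ∧ ∀ t ∈ Icc (0 : ℝ) 1, HasDerivWithinAt X (L t (X t)) (Icc 0 1) t := by
  -- On the ball of radius ‖x₀‖ about x₀ one has ‖x‖ ≤ 2‖x₀‖, so the speed is at most ‖x₀‖ and the
  -- solution stays in the ball for unit time. The bound 1/2 on `L` is chosen for this.
  have h : IsPicardLindelof (fun t x => L t x) (⟨0, by simp⟩ : Icc (0 : ℝ) 1) x₀ ‖x₀‖₊ 0 ‖x₀‖₊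
      (1 / 2) := by
    refine ⟨fun t ht => ?_, fun x _ => ?_, fun t ht x hx => ?_, ?_⟩
    · refine ((L t).lipschitz.weaken ?_).lipschitzOnWith
      exact_mod_cast hb t ht
    · exact hL.clm_apply continuousOn_const
    · have h1 : ‖x‖ ≤ ‖x₀‖ + ‖x₀‖ := by
        have := norm_le_norm_add_norm_sub' x x₀
        rw [mem_closedBall, dist_eq_norm] at hx
        simp only [coe_nnnorm] at hx
        linarith
      calc ‖L t x‖ ≤ ‖L t‖ * ‖x‖ := (L t).le_opNorm x
        _ ≤ 1 / 2 * (‖x₀‖ + ‖x₀‖) := by gcongr; exact hb t ht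
        _ = ‖x₀‖₊ := by simp; ring
    · simp
  obtain ⟨X, h0, hX⟩ := h.exists_eq_forall_mem_Icc_hasDerivWithinAt₀
  exact ⟨X, h0, hX⟩

/-- Grönwall's inequality with rate K + 1 in place of K, so that the closed form, which divides by
the rate, holds also for K = 0. -/
theorem norm_le_of_norm_deriv_le_mul_add {f f' : ℝ → F} {K ε : ℝ} (hK : 0 ≤ K) (hε : 0 ≤ ε)
    (hf : ∀ t ∈ Icc (0 : ℝ) 1, HasDerivWithinAt f (f' t) (Icc 0 1) t) (h0 : ‖f 0‖ ≤ ε)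
    (hb : ∀ t ∈ Icc (0 : ℝ) 1, ‖f' t‖ ≤ K * ‖f t‖ + ε) :
    ∀ t ∈ Icc (0 : ℝ) 1, ‖f t‖ ≤ 2 * Real.exp (K + 1) * ε := by
  intro t ht
  have h := norm_le_gronwallBound_of_norm_deriv_right_le (f := f) (f' := f') (δ := ε) (K := K + 1)
    (ε := ε) (a := 0) (b := 1) (fun t ht => (hf t ht).continuousWithinAt)
    (fun t ht => ((hf t (Ico_subset_Icc_self ht)).mono_of_mem_nhdsWithin
      (Icc_mem_nhdsGE_of_mem ht))) h0
    (fun t ht => (hb t (Ico_subset_Icc_self ht)).trans (by nlinarith [norm_nonneg (f t)])) t ht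
  rw [gronwallBound_of_K_ne_0 (by positivity), sub_zero] at h
  have h1 : Real.exp ((K + 1) * t) ≤ Real.exp (K + 1) := by
    apply Real.exp_le_exp.2
    nlinarith [ht.2]
  have h2 : ε / (K + 1) ≤ ε := div_le_self hε (by linarith)
  have h3 : 1 ≤ Real.exp ((K + 1) * t) := Real.one_le_exp (by have := ht.1; positivity)
  have h4 : ε / (K + 1) * (Real.exp ((K + 1) * t) - 1) ≤ ε * (Real.exp (K + 1)) := by
    apply mul_le_mul h2 _ (by linarith) hε
    linarith
  nlinarith [Real.exp_pos (K + 1)]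

/-- Uniqueness for linear equations: the Grönwall estimate with ε = 0. -/
theorem HasDerivWithinAt.eq_zero_of_linear {f : ℝ → F} {L : ℝ → F →L[ℝ] F} {C : ℝ}
    (hC : ∀ t ∈ Icc (0 : ℝ) 1, ‖L t‖ ≤ C) (h0 : f 0 = 0)
    (hf : ∀ t ∈ Icc (0 : ℝ) 1, HasDerivWithinAt f (L t (f t)) (Icc 0 1) t) :
    ∀ t ∈ Icc (0 : ℝ) 1, f t = 0 := by
  intro t ht
  have hC0 : 0 ≤ C := (norm_nonneg _).trans (hC 0 (by simp))
  have := norm_le_of_norm_deriv_le_mul_add hC0 le_rfl hf (by simp [h0])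
    (fun t ht => by simpa using (L t).le_of_opNorm_le (hC t ht) _) t ht
  simpa using this

theorem segment_mem_ball {y₀ y h : E} {ρ : ℝ} (hy : y ∈ ball y₀ ρ) (hyh : y + h ∈ ball y₀ ρ)
    {t : ℝ} (ht : t ∈ Icc (0 : ℝ) 1) : y + t • h ∈ ball y₀ ρ :=
  (convex_ball y₀ ρ).add_smul_mem hy hyh ht

/-- A map on a ball which along every segment solves the linear equation `df = a f` is
differentiable, with derivative `a f`. -/
theorem hasFDerivAt_of_forall_segment {f : E → F} {a : E → E →L[ℝ] F →L[ℝ] F} {y₀ : E} {ρ C : ℝ}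
    (ha : ContinuousOn a (ball y₀ ρ)) (hC : ∀ y ∈ ball y₀ ρ, ‖a y‖ ≤ C)
    (hf : ∀ y h, y ∈ ball y₀ ρ → y + h ∈ ball y₀ ρ → ∀ t ∈ Icc (0 : ℝ) 1,
      HasDerivWithinAt (fun t : ℝ => f (y + t • h)) (a (y + t • h) h (f (y + t • h))) (Icc 0 1) t)
    {y : E} (hy : y ∈ ball y₀ ρ) : HasFDerivAt f ((a y).flip (f y)) y := by
  have hρ : 0 < ρ := pos_of_mem_ball hy
  have hy₀ : y₀ ∈ ball y₀ ρ := mem_ball_self hρ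
  have hC0 : 0 ≤ C := (norm_nonneg (a y)).trans (hC y hy)
  -- `f` is controlled only along segments, so even its boundedness has to be proved: Grönwall along
  -- the rays from `y₀`.
  obtain ⟨Q, hQ⟩ : ∃ Q, ∀ z ∈ ball y₀ ρ, ‖f z‖ ≤ Q := by
    refine ⟨2 * Real.exp (C * ρ + 1) * ‖f y₀‖, fun z hz => ?_⟩
    have h1 := norm_le_of_norm_deriv_le_mul_add (K := C * ρ) (ε := ‖f y₀‖) (by positivity)
      (norm_nonneg _) (hf y₀ (z - y₀) hy₀ (by simpa using hz)) (by simp) (fun t ht => ?_) 1 (by simp)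
    · simpa using h1
    · have hz' := segment_mem_ball hy₀ (by simpa using hz : y₀ + (z - y₀) ∈ ball y₀ ρ) ht
      have h2 : ‖z - y₀‖ ≤ ρ := by rw [mem_ball, dist_eq_norm] at hz; exact hz.le
      have h3 : ‖a (y₀ + t • (z - y₀)) (z - y₀)‖ ≤ C * ρ :=
        ((a _).le_opNorm _).trans (by gcongr; exact hC _ hz')
      have := ((a (y₀ + t • (z - y₀)) (z - y₀)).le_opNorm (f (y₀ + t • (z - y₀)))).trans
        (mul_le_mul_of_nonneg_right h3 (norm_nonneg _))
      linarith [norm_nonneg (f y₀)]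
  have hQ0 : 0 ≤ Q := (norm_nonneg _).trans (hQ _ hy)
  -- Bounded derivatives along the segments from `y` give continuity at `y`, hence continuity of the
  -- candidate derivative z ↦ a(z)(·)f(z).
  have hlip : ∀ z ∈ ball y₀ ρ, ‖f z - f y‖ ≤ C * Q * ‖z - y‖ := by
    intro z hz
    have hz' : y + (z - y) ∈ ball y₀ ρ := by simpa using hz
    have := norm_image_sub_le_of_norm_deriv_le_segment_01' (C := C * Q * ‖z - y‖) (hf y (z - y) hy hz')
      (fun t ht => ?_)
    · simpa using this
    · have hm := segment_mem_ball hy hz' (Ico_subset_Icc_self ht)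
      calc _ ≤ ‖a (y + t • (z - y)) (z - y)‖ * ‖f (y + t • (z - y))‖ := ContinuousLinearMap.le_opNorm _ _
        _ ≤ (C * ‖z - y‖) * Q := by
          gcongr
          · exact (a _).le_of_opNorm_le (hC _ hm) _
          · exact hQ _ hm
        _ = _ := by ring
  have hcont : ContinuousAt f y := by
    rw [ContinuousAt, tendsto_iff_norm_sub_tendsto_zero]
    refine squeeze_zero' (Filter.Eventually.of_forall fun _ => norm_nonneg _)
      (Filter.eventually_of_mem (isOpen_ball.mem_nhds hy) hlip) ?_
    have : Filter.Tendsto (fun z => C * Q * ‖z - y‖) (nhds y) (nhds (C * Q * ‖y - y‖)) := by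
      apply Continuous.tendsto
      fun_prop
    simpa using this
  have hcontL : ContinuousAt (fun z => (a z).flip (f z)) y := by
    have h1 : ContinuousAt a y := ha.continuousAt (isOpen_ball.mem_nhds hy)
    have h2 : ContinuousAt (fun z => (a z).flip) y :=
      (ContinuousLinearMap.flipₗᵢ ℝ E F F).continuous.continuousAt.comp h1
    exact h2.clm_apply hcont
  rw [hasFDerivAt_iff_isLittleO_nhds_zero, Asymptotics.isLittleO_iff]
  intro c hc
  have h1 : ∀ᶠ z in nhds y, z ∈ ball y₀ ρ ∧ ‖(a z).flip (f z) - (a y).flip (f y)‖ ≤ c := by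
    refine (isOpen_ball.eventually_mem hy).and ?_
    have := hcontL.eventually (closedBall_mem_nhds _ hc)
    filter_upwards [this] with z hz
    simpa [dist_eq_norm] using hz
  obtain ⟨δ, hδ, hδ'⟩ := Metric.eventually_nhds_iff_ball.1 h1
  filter_upwards [ball_mem_nhds (0 : E) hδ] with h hh
  have hyδ : y ∈ ball y δ := mem_ball_self hδ
  have hhδ : y + h ∈ ball y δ := by simpa using hh
  -- Mean value inequality for t ↦ f(y + th) - t a(y)(h)f(y), whose derivative is at most c‖h‖ near
  -- `y`.
  have h2 := norm_image_sub_le_of_norm_deriv_le_segment_01' (C := c * ‖h‖)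
    (fun t ht => (hf y h hy (hδ' _ hhδ).1 t ht).sub
      ((hasDerivAt_id t).smul_const ((a y).flip (f y) h)).hasDerivWithinAt) (fun t ht => ?_)
  · simpa [sub_sub, add_comm] using h2
  · have hm := hδ' _ (segment_mem_ball hyδ hhδ (Ico_subset_Icc_self ht))
    have := ((a (y + t • h)).flip (f (y + t • h)) - (a y).flip (f y)).le_of_opNorm_le hm.2 h
    simpa using this

end Analysis

/-! ### Solving a flat linear system df = a f by integrating along rays. -/

section Frobenius

open Metric

variable {E : Type*} [NormedAddCommGroup E] [NormedSpace ℝ E]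
  {F : Type*} [NormedAddCommGroup F] [NormedSpace ℝ F]

theorem norm_sub_sub_le_of_lipschitz_deriv {f : E → F} {f' : E → E →L[ℝ] F} {y₀ : E} {ρ K : ℝ}
    (hf : ∀ y ∈ ball y₀ ρ, HasFDerivAt f (f' y) y)
    (hK : ∀ y ∈ ball y₀ ρ, ∀ z ∈ ball y₀ ρ, ‖f' y - f' z‖ ≤ K * ‖y - z‖)
    {z k : E} (hz : z ∈ ball y₀ ρ) (hzk : z + k ∈ ball y₀ ρ) :
    ‖f (z + k) - f z - f' z k‖ ≤ |K| * ‖k‖ ^ 2 := by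
  have := (convex_segment (𝕜 := ℝ) z (z + k)).norm_image_sub_le_of_norm_hasFDerivWithin_le' (f := f)
    (f' := f') (φ := f' z) (C := |K| * ‖k‖) (x := z) (y := z + k) ?_ ?_ (left_mem_segment ..)
    (right_mem_segment ..)
  · simpa [pow_two, mul_assoc] using this
  · intro x hx
    exact (hf x ((convex_ball y₀ ρ).segment_subset hz hzk hx)).hasFDerivWithinAt
  · intro x hx
    have h1 := hK x ((convex_ball y₀ ρ).segment_subset hz hzk hx) z hz
    refine h1.trans (mul_le_mul (le_abs_self K) ?_ (norm_nonneg _) (abs_nonneg _))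
    obtain ⟨t, ht, rfl⟩ := (segment_eq_image_lineMap ℝ z (z + k)).subset hx
    simp only [AffineMap.lineMap_apply, vsub_eq_sub, add_sub_cancel_left, vadd_eq_add,
      add_sub_cancel_right, norm_smul, Real.norm_eq_abs, abs_of_nonneg ht.1]
    exact mul_le_of_le_one_left (norm_nonneg _) ht.2

theorem ContinuousLinearMap.norm_apply₂_le {a : E →L[ℝ] F →L[ℝ] F} {C : ℝ} (ha : ‖a‖ ≤ C) (u : E)
    (x : F) : ‖a u x‖ ≤ C * ‖u‖ * ‖x‖ :=
  (a.le_opNorm₂ u x).trans (by gcongr)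

theorem ContinuousLinearMap.norm_apply₃_le {a : E →L[ℝ] E →L[ℝ] F →L[ℝ] F} {C : ℝ} (ha : ‖a‖ ≤ C)
    (u v : E) (x : F) : ‖a u v x‖ ≤ C * ‖u‖ * ‖v‖ * ‖x‖ :=
  ((a u v).le_of_opNorm_le ((a u).le_of_opNorm_le (a.le_of_opNorm_le ha u) v) x)

/-- The solutions of `df = a f` along the rays from `y₀` fit together to a solution on the ball, if
`a` is flat along them. -/
theorem hasFDerivAt_radial {a : E → E →L[ℝ] F →L[ℝ] F} {a' : E → E →L[ℝ] E →L[ℝ] F →L[ℝ] F}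
    {y₀ : E} {ρ C K : ℝ} {X : E → ℝ → F} {x₀ : F}
    (ha : ∀ y ∈ ball y₀ ρ, HasFDerivAt a (a' y) y)
    (hC : ∀ y ∈ ball y₀ ρ, ‖a y‖ ≤ C) (hC' : ∀ y ∈ ball y₀ ρ, ‖a' y‖ ≤ C)
    (hK : ∀ y ∈ ball y₀ ρ, ∀ z ∈ ball y₀ ρ, ‖a' y - a' z‖ ≤ K * ‖y - z‖)
    (hX0 : ∀ y ∈ ball y₀ ρ, X y 0 = x₀)
    (hX : ∀ y ∈ ball y₀ ρ, ∀ t ∈ Icc (0 : ℝ) 1,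
      HasDerivWithinAt (X y) (a (y₀ + t • (y - y₀)) (y - y₀) (X y t)) (Icc 0 1) t)
    (hflat : ∀ y ∈ ball y₀ ρ, ∀ t ∈ Icc (0 : ℝ) 1, ∀ u v,
      a' (y₀ + t • (y - y₀)) u v (X y t)
          + a (y₀ + t • (y - y₀)) v (a (y₀ + t • (y - y₀)) u (X y t))
        = a' (y₀ + t • (y - y₀)) v u (X y t)
          + a (y₀ + t • (y - y₀)) u (a (y₀ + t • (y - y₀)) v (X y t)))
    {y : E} (hy : y ∈ ball y₀ ρ) : HasFDerivAt (fun y => X y 1) ((a y).flip (X y 1)) y := by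
  have hρ : 0 < ρ := pos_of_mem_ball hy
  have hC0 : 0 ≤ C := (norm_nonneg (a y)).trans (hC y hy)
  have hw : ∀ z ∈ ball y₀ ρ, ‖z - y₀‖ ≤ ρ := fun z hz => by
    rw [mem_ball, dist_eq_norm] at hz; exact hz.le
  have hseg : ∀ z ∈ ball y₀ ρ, ∀ t ∈ Icc (0 : ℝ) 1, y₀ + t • (z - y₀) ∈ ball y₀ ρ := fun z hz t ht =>
    segment_mem_ball (mem_ball_self hρ) (by simpa using hz) ht
  obtain ⟨Q, hQ0, hQ⟩ : ∃ Q, 0 ≤ Q ∧ ∀ z ∈ ball y₀ ρ, ∀ t ∈ Icc (0 : ℝ) 1, ‖X z t‖ ≤ Q := by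
    refine ⟨2 * Real.exp (C * ρ + 1) * ‖x₀‖, by positivity, fun z hz => ?_⟩
    refine norm_le_of_norm_deriv_le_mul_add (K := C * ρ) (by positivity) (norm_nonneg _) (hX z hz)
      (by rw [hX0 z hz]) fun t ht => ?_
    have h1 := ContinuousLinearMap.norm_apply₂_le (hC _ (hseg z hz t ht)) (z - y₀) (X z t)
    have h2 : C * ‖z - y₀‖ * ‖X z t‖ ≤ C * ρ * ‖X z t‖ := by gcongr; exact hw z hz
    linarith [norm_nonneg x₀]
  set e := 2 * Real.exp (C * ρ + 1) with he
  have he0 : 0 < e := by positivity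
  set D₁ := e * ((C * ρ + C) * Q) with hD₁
  have hD₁0 : 0 ≤ D₁ := by positivity
  set D₂ := e * (C * D₁ + C * ρ * D₁ + C * Q + |K| * ρ * Q) with hD₂
  -- A quadratic bound on the first-order remainder suffices for differentiability.
  suffices h : ∀ h, y + h ∈ ball y₀ ρ → ‖X (y + h) 1 - X y 1 - a y h (X y 1)‖ ≤ D₂ * ‖h‖ ^ 2 by
    rw [hasFDerivAt_iff_isLittleO_nhds_zero]
    have h1 : (fun h => X (y + h) 1 - X y 1 - (a y).flip (X y 1) h) =O[nhds 0] fun h => ‖h‖ ^ 2 := by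
      refine Asymptotics.IsBigO.of_bound D₂ ?_
      have : ∀ᶠ h in nhds (0 : E), y + h ∈ ball y₀ ρ := by
        apply (continuous_const.add continuous_id).continuousAt.eventually_mem
        simpa using isOpen_ball.mem_nhds hy
      filter_upwards [this] with k hk
      simpa using h k hk
    exact h1.trans_isLittleO (Asymptotics.isLittleO_norm_pow_id one_lt_two)
  intro h hyh
  set w := y - y₀ with hwdef
  have hw' : y + h - y₀ = w + h := by rw [hwdef]; abel
  have hwρ : ‖w‖ ≤ ρ := hw y hy
  have hwhρ : ‖w + h‖ ≤ ρ := hw' ▸ hw _ hyh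
  have hz : ∀ t ∈ Icc (0 : ℝ) 1, y₀ + t • w ∈ ball y₀ ρ := hseg y hy
  have hz' : ∀ t ∈ Icc (0 : ℝ) 1, y₀ + t • w + t • h ∈ ball y₀ ρ := fun t ht => by
    have := hseg _ hyh t ht
    rwa [hw', smul_add, ← add_assoc] at this
  have hX' : ∀ t ∈ Icc (0 : ℝ) 1, HasDerivWithinAt (X (y + h))
      (a (y₀ + t • w + t • h) (w + h) (X (y + h) t)) (Icc 0 1) t := fun t ht => by
    have := hX _ hyh t ht
    rwa [hw', smul_add, ← add_assoc] at this
  have hth : ∀ t ∈ Icc (0 : ℝ) 1, ‖t • h‖ ≤ ‖h‖ := fun t ht => by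
    rw [norm_smul, Real.norm_eq_abs, abs_of_nonneg ht.1]
    exact mul_le_of_le_one_left (norm_nonneg _) ht.2
  have htx : ∀ t ∈ Icc (0 : ℝ) 1, ∀ x : F, ‖t • x‖ ≤ ‖x‖ := fun t ht x => by
    rw [norm_smul, Real.norm_eq_abs, abs_of_nonneg ht.1]
    exact mul_le_of_le_one_left (norm_nonneg _) ht.2
  have hlip : ∀ t ∈ Icc (0 : ℝ) 1, ‖a (y₀ + t • w + t • h) - a (y₀ + t • w)‖ ≤ C * ‖h‖ := by
    intro t ht
    have := (convex_ball y₀ ρ).norm_image_sub_le_of_norm_hasFDerivWithin_le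
      (fun x hx => (ha x hx).hasFDerivWithinAt) hC' (hz t ht) (hz' t ht)
    refine this.trans ?_
    rw [add_sub_cancel_left]
    gcongr
    exact hth t ht
  -- Solutions along the rays to `y` and to y + h differ by O(‖h‖): Grönwall for their difference.
  have hD : ∀ t ∈ Icc (0 : ℝ) 1, ‖X (y + h) t - X y t‖ ≤ D₁ * ‖h‖ := by
    have h1 := norm_le_of_norm_deriv_le_mul_add (f := fun t => X (y + h) t - X y t) (K := C * ρ)
      (ε := (C * ρ + C) * Q * ‖h‖)
      (by positivity) (by positivity) (fun t ht => (hX' t ht).sub (hX y hy t ht))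
      (by simp [hX0 y hy, hX0 _ hyh]; positivity) (fun t ht => ?_)
    · intro t ht
      have := h1 t ht
      rw [hD₁]
      linarith
    · have h2 : a (y₀ + t • w + t • h) (w + h) (X (y + h) t) - a (y₀ + t • w) w (X y t)
          = a (y₀ + t • w + t • h) (w + h) (X (y + h) t - X y t)
            + (a (y₀ + t • w + t • h) - a (y₀ + t • w)) (w + h) (X y t)
            + a (y₀ + t • w) h (X y t) := by
        simp only [map_add, map_sub, add_apply, sub_apply]
        abel
      rw [h2]
      have b1 : ‖a (y₀ + t • w + t • h) (w + h) (X (y + h) t - X y t)‖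
          ≤ C * ρ * ‖X (y + h) t - X y t‖ :=
        (ContinuousLinearMap.norm_apply₂_le (hC _ (hz' t ht)) _ _).trans (by gcongr)
      have b2 : ‖(a (y₀ + t • w + t • h) - a (y₀ + t • w)) (w + h) (X y t)‖
          ≤ (C * ‖h‖) * ρ * Q :=
        (ContinuousLinearMap.norm_apply₂_le (hlip t ht) _ _).trans
          (by gcongr; exact hQ y hy t ht)
      have b3 : ‖a (y₀ + t • w) h (X y t)‖ ≤ C * ‖h‖ * Q :=
        (ContinuousLinearMap.norm_apply₂_le (hC _ (hz t ht)) _ _).trans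
          (by gcongr; exact hQ y hy t ht)
      refine (norm_add₃_le).trans ?_
      linarith
  have haw : ∀ t ∈ Icc (0 : ℝ) 1, HasDerivWithinAt (fun t : ℝ => a (y₀ + t • w))
      (a' (y₀ + t • w) w) (Icc 0 1) t := by
    intro t ht
    have h1 : HasDerivAt (fun t : ℝ => y₀ + t • w) w t := by
      simpa using ((hasDerivAt_id t).smul_const w).const_add y₀
    exact ((ha _ (hz t ht)).comp_hasDerivAt t h1).hasDerivWithinAt
  -- At t = 1 this function is the first-order remainder, and it vanishes at t = 0. Flatness
  -- exchanges the two arguments of a' in the term a'(w,h); the derivative then becomes a(w) applied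
  -- to the function itself plus terms of order ‖h‖², so Grönwall gives the quadratic bound.
  have hZ' : ∀ t ∈ Icc (0 : ℝ) 1, HasDerivWithinAt
      (fun t : ℝ => X (y + h) t - X y t - t • a (y₀ + t • w) h (X y t))
      (a (y₀ + t • w) w (X (y + h) t - X y t - t • a (y₀ + t • w) h (X y t))
        + (a (y₀ + t • w) h (X (y + h) t - X y t)
          + t • a' (y₀ + t • w) h w (X (y + h) t - X y t)
          + t • a' (y₀ + t • w) h h (X (y + h) t)
          + (a (y₀ + t • w + t • h) - a (y₀ + t • w) - a' (y₀ + t • w) (t • h)) (w + h)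
              (X (y + h) t))) (Icc 0 1) t := by
    intro t ht
    have h1 := ((haw t ht).clm_apply (hasDerivWithinAt_const t (Icc 0 1) h)).clm_apply (hX y hy t ht)
    have h2 := ((hX' t ht).sub (hX y hy t ht)).sub
      ((hasDerivWithinAt_id t (Icc 0 1)).smul h1)
    refine h2.congr_deriv ?_
    have hfl := hflat y hy t ht w h
    rw [← hwdef] at hfl ⊢
    have h3 : a' (y₀ + t • w) w h (X y t) = a' (y₀ + t • w) h w (X y t)
          + a (y₀ + t • w) w (a (y₀ + t • w) h (X y t))
          - a (y₀ + t • w) h (a (y₀ + t • w) w (X y t)) := by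
      rw [← hfl]; abel
    simp only [id, one_smul, map_add, map_sub, map_smul, map_zero, add_zero, smul_sub, smul_add,
      add_apply, sub_apply, smul_apply,
      h3]
    abel
  have h1 := norm_le_of_norm_deriv_le_mul_add (K := C * ρ)
      (ε := (C * D₁ + C * ρ * D₁ + C * Q + |K| * ρ * Q) * ‖h‖ ^ 2)
      (by positivity) (by positivity) hZ'
      (by simp [hX0 y hy, hX0 _ hyh]; positivity) (fun t ht => ?_) 1 (by simp)
  · simp only [one_smul, hwdef, add_sub_cancel] at h1
    rw [hD₂]
    linarith
  · refine (norm_add_le _ _).trans (add_le_add ?_ ?_)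
    · exact (ContinuousLinearMap.norm_apply₂_le (hC _ (hz t ht)) _ _).trans (by gcongr)
    · have b1 : ‖a (y₀ + t • w) h (X (y + h) t - X y t)‖ ≤ C * ‖h‖ * (D₁ * ‖h‖) :=
        (ContinuousLinearMap.norm_apply₂_le (hC _ (hz t ht)) _ _).trans
          (by gcongr; exact hD t ht)
      have b2 : ‖t • a' (y₀ + t • w) h w (X (y + h) t - X y t)‖ ≤ C * ‖h‖ * ρ * (D₁ * ‖h‖) :=
        (htx t ht _).trans ((ContinuousLinearMap.norm_apply₃_le (hC' _ (hz t ht)) _ _ _).trans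
          (by gcongr; exact hD t ht))
      have b3 : ‖t • a' (y₀ + t • w) h h (X (y + h) t)‖ ≤ C * ‖h‖ * ‖h‖ * Q :=
        (htx t ht _).trans ((ContinuousLinearMap.norm_apply₃_le (hC' _ (hz t ht)) _ _ _).trans
          (by gcongr; exact hQ _ hyh t ht))
      have b4 : ‖(a (y₀ + t • w + t • h) - a (y₀ + t • w) - a' (y₀ + t • w) (t • h)) (w + h)
          (X (y + h) t)‖ ≤ (|K| * ‖h‖ ^ 2) * ρ * Q := by
        refine (ContinuousLinearMap.norm_apply₂_le
          ((norm_sub_sub_le_of_lipschitz_deriv ha hK (hz t ht) (hz' t ht)).trans ?_) _ _).trans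
          (by gcongr; exact hQ _ hyh t ht)
        gcongr
        exact hth t ht
      refine (norm_add₄_le).trans ?_
      linarith
end Frobenius

/-! ### Globalization over a simply connected base. -/

section Monodromy

open Filter Topology

/-- Over a simply connected space, a family of sets with locally constant transition maps has
global locally constant sections through every point. -/
theorem exists_locallyConstant_section {B F : Type*} {T : B → Type*} [TopologicalSpace B]
    [SimplyConnectedSpace B] [LocallyPathConnectedSpace B] {O : B → Set B}
    (hO : ∀ b, IsOpen (O b)) (hmem : ∀ b, b ∈ O b) (e : ∀ b x, F ≃ T x)
    (hloc : ∀ b c x, x ∈ O b → x ∈ O c →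
      ∀ᶠ y in 𝓝 x, ∀ v, (e c y).symm (e b y v) = (e c x).symm (e b x v))
    (x₀ : B) (v : T x₀) :
    ∃ σ : ∀ x, T x, σ x₀ = v ∧
      ∀ b, ∀ x ∈ O b, ∀ᶠ y in 𝓝 x, σ y = e b y ((e b x).symm (σ x)) := by
  -- With discrete fibre, locally constant transition maps are continuous and the associated bundle
  -- is a covering. A global section is a lift of the identity map, which exists because the base is
  -- simply connected.
  let _ : TopologicalSpace F := ⊥
  have : DiscreteTopology F := ⟨rfl⟩
  let Z : FiberBundleCore B B F :=
    { baseSet := O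
      isOpen_baseSet := hO
      indexAt := id
      mem_baseSet_at := hmem
      coordChange := fun i j x v => (e j x).symm (e i x v)
      coordChange_self := fun i x _ v => by simp
      continuousOn_coordChange := by
        rintro i j ⟨x, v⟩ ⟨⟨hi, hj⟩, -⟩
        apply ContinuousAt.continuousWithinAt
        apply ContinuousAt.congr (f := fun _ => (e j x).symm (e i x v)) continuousAt_const
        rw [nhds_prod_eq, nhds_discrete F, EventuallyEq, eventually_prod_iff]
        refine ⟨_, hloc i j x hi hj, (· = v), rfl, ?_⟩
        rintro y hy _ rfl
        exact (hy _).symm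
      coordChange_comp := fun i j k x _ v => by simp }
  have cov : IsCoveringMap (Bundle.TotalSpace.proj : Bundle.TotalSpace F Z.Fiber → B) :=
    FiberBundle.isCoveringMap
  obtain ⟨s, ⟨hs0, hs⟩, -⟩ := cov.existsUnique_continuousMap_lifts (ContinuousMap.id B) x₀
    (⟨x₀, (e x₀ x₀).symm v⟩ : Bundle.TotalSpace F Z.Fiber) rfl
  have hs' : ∀ x, (s x).proj = x := fun x => congrFun hs x
  let c : B → F := fun x => (s x).2
  have hc0 : c x₀ = (e x₀ x₀).symm v := by
    change ((s x₀).2 : F) = _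
    rw [hs0]
  refine ⟨fun x => e x x (c x), by simp [hc0], fun b x hx => ?_⟩
  have hcont : ContinuousAt (fun y => (Z.localTriv b (s y)).2) x := by
    refine continuous_snd.continuousAt.comp (ContinuousAt.comp (f := s) ?_ s.continuous.continuousAt)
    refine (Z.localTriv b).continuousOn.continuousAt ((Z.localTriv b).open_source.mem_nhds ?_)
    rw [Z.mem_localTriv_source]
    rw [hs']
    exact hx
  have hval : ∀ y, (Z.localTriv b (s y)).2 = (e b y).symm (e y y (c y)) := by
    intro y
    rw [Z.localTriv_apply]
    change (e b (s y).proj).symm (e (s y).proj (s y).proj (c y)) = _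
    rw [hs' y]
  -- A continuous map to a discrete space is locally constant, so the fibre coordinate of the lift
  -- is.
  rw [ContinuousAt, nhds_discrete F, tendsto_pure] at hcont
  filter_upwards [hcont] with y hy
  rw [hval, hval] at hy
  rw [← hy, Equiv.apply_symm_apply]

end Monodromy

/-! ### Christoffel symbols, curvature and integrability conditions on a domain of a vector space.
-/

section Christoffel

open Filter Topology ContinuousLinearMap

variable {E : Type*} [NormedAddCommGroup E] [NormedSpace ℝ E]

/-- A smooth pseudo-Riemannian metric on an open subset of a vector space. -/
structure IsLocalMetric (b : E → E →L[ℝ] E →L[ℝ] ℝ) (T : Set E) : Prop where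
  isOpen : IsOpen T
  contDiffOn : ContDiffOn ℝ ∞ b T
  symm : ∀ y ∈ T, ∀ u v, b y u v = b y v u
  isInvertible : ∀ y ∈ T, (b y).IsInvertible

/-- The Christoffel symbols as a continuous bilinear map. -/
def christoffelMap (b : E → E →L[ℝ] E →L[ℝ] ℝ) (y : E) : E →L[ℝ] E →L[ℝ] E :=
  compL ℝ E (E →L[ℝ] ℝ) E (b y).inverse ∘L ((1 / 2 : ℝ) • (fderiv ℝ b y + (fderiv ℝ b y).flip
    - (flipₗᵢ ℝ E E ℝ : (E →L[ℝ] E →L[ℝ] ℝ) →L[ℝ] E →L[ℝ] E →L[ℝ] ℝ) ∘L (fderiv ℝ b y).flip))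

theorem christoffelMap_apply (b : E → E →L[ℝ] E →L[ℝ] ℝ) (y u v : E) :
    christoffelMap b y u v = christoffel b y u v := rfl

namespace IsLocalMetric

variable {b b' : E → E →L[ℝ] E →L[ℝ] ℝ} {T T' : Set E} {y : E}

theorem differentiableAt (hb : IsLocalMetric b T) (hy : y ∈ T) : DifferentiableAt ℝ b y :=
  (hb.contDiffOn.contDiffAt (hb.isOpen.mem_nhds hy)).differentiableAt (by simp)

theorem apply_christoffel (hb : IsLocalMetric b T) (hy : y ∈ T) (u v z : E) :
    b y (christoffel b y u v) z = (1 / 2 : ℝ) * (fderiv ℝ b y u v z + fderiv ℝ b y v u z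
      - fderiv ℝ b y z u v) := by
  have h := (hb.isInvertible y hy).self_apply_inverse (christoffelFirst b y u v)
  rw [christoffel, h]
  simp [christoffelFirst]

theorem ext (hb : IsLocalMetric b T) (hy : y ∈ T) {u v : E} (h : ∀ z, b y u z = b y v z) :
    u = v :=
  (hb.isInvertible y hy).injective (ContinuousLinearMap.ext h)

theorem hasFDerivAt_apply (hb : IsLocalMetric b T) (hy : y ∈ T) (u v : E) :
    HasFDerivAt (fun z => b z u v) (((fderiv ℝ b y).flip u).flip v) y := by
  have := ((hb.differentiableAt hy).hasFDerivAt.clm_apply (hasFDerivAt_const u y)).clm_apply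
    (hasFDerivAt_const v y)
  refine this.congr_fderiv ?_
  ext w
  simp

theorem fderiv_symm (hb : IsLocalMetric b T) (hy : y ∈ T) (w u v : E) :
    fderiv ℝ b y w u v = fderiv ℝ b y w v u := by
  have h1 : HasFDerivAt (fun z => b z v u) (((fderiv ℝ b y).flip u).flip v) y :=
    (hb.hasFDerivAt_apply hy u v).congr_of_eventuallyEq (by
      filter_upwards [hb.isOpen.mem_nhds hy] with z hz using hb.symm z hz v u)
  exact congrArg (· w) (h1.unique (hb.hasFDerivAt_apply hy v u))

theorem christoffel_symm (hb : IsLocalMetric b T) (hy : y ∈ T) (u v : E) :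
    christoffel b y u v = christoffel b y v u := by
  apply hb.ext hy
  intro z
  rw [hb.apply_christoffel hy, hb.apply_christoffel hy, hb.fderiv_symm hy z u v]
  ring

/-- The metric is parallel: adding two Koszul formulas leaves only the derivative of `b` along `w`.
-/
theorem fderiv_eq (hb : IsLocalMetric b T) (hy : y ∈ T) (w u v : E) :
    fderiv ℝ b y w u v = b y (christoffel b y w u) v + b y u (christoffel b y w v) := by
  rw [hb.symm y hy u, hb.apply_christoffel hy, hb.apply_christoffel hy, hb.fderiv_symm hy w v u]
  ring

theorem contDiffOn_christoffelMap [CompleteSpace E] (hb : IsLocalMetric b T) :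
    ContDiffOn ℝ ∞ (christoffelMap b) T := by
  have h1 : ContDiffOn ℝ ∞ (fderiv ℝ b) T :=
    hb.contDiffOn.fderiv_of_isOpen hb.isOpen (by simp)
  have h2 : ContDiffOn ℝ ∞ (fun y => (b y).inverse) T := fun y hy =>
    ((hb.isInvertible y hy).contDiffAt_map_inverse.comp_contDiffWithinAt y (hb.contDiffOn y hy))
  have h3 : ContDiffOn ℝ ∞ (fun y => (fderiv ℝ b y).flip) T :=
    (flipₗᵢ ℝ E E (E →L[ℝ] ℝ)).toContinuousLinearEquiv.contDiff.comp_contDiffOn h1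
  have h4 : ContDiffOn ℝ ∞ (fun y => compL ℝ E (E →L[ℝ] ℝ) E (b y).inverse) T :=
    (compL ℝ E (E →L[ℝ] ℝ) E).contDiff.comp_contDiffOn h2
  exact h4.clm_comp (((h1.add h3).sub (contDiffOn_const.clm_comp h3)).const_smul _)

theorem hasFDerivAt_christoffelMap [CompleteSpace E] (hb : IsLocalMetric b T) (hy : y ∈ T) :
    HasFDerivAt (christoffelMap b) (fderiv ℝ (christoffelMap b) y) y :=
  ((hb.contDiffOn_christoffelMap.contDiffAt (hb.isOpen.mem_nhds hy)).differentiableAt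
    (by simp)).hasFDerivAt

theorem hasFDerivAt_christoffelMap_apply [CompleteSpace E] (hb : IsLocalMetric b T) (hy : y ∈ T)
    (v : E) : HasFDerivAt (fun z => christoffelMap b z v)
      ((fderiv ℝ (christoffelMap b) y).flip v) y := by
  refine ((hb.hasFDerivAt_christoffelMap hy).clm_apply (hasFDerivAt_const v y)).congr_fderiv ?_
  ext w
  simp

theorem localCurvature_eq [CompleteSpace E] (hb : IsLocalMetric b T) (hy : y ∈ T) (u v w : E) :
    localCurvature b y u v w = fderiv ℝ (christoffelMap b) y u v w
      - fderiv ℝ (christoffelMap b) y v u w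
      + christoffelMap b y u (christoffelMap b y v w)
      - christoffelMap b y v (christoffelMap b y u w) := by
  have h1 : ∀ u v : E, fderiv ℝ (fun y' => christoffel b y' v w) y u
      = fderiv ℝ (christoffelMap b) y u v w := by
    intro u v
    have := ((hb.hasFDerivAt_christoffelMap_apply hy v).clm_apply (hasFDerivAt_const w y)).fderiv
    change fderiv ℝ (fun y' => christoffel b y' v w) y = _ at this
    rw [this]
    simp
  simp only [localCurvature, h1]
  rfl

/-- The transformation law of the Christoffel symbols. -/
theorem fderiv_christoffel_eq (hb : IsLocalMetric b T) (hb' : IsLocalMetric b' T') {f : E → E}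
    (hf : ContDiffAt ℝ ∞ f y) (hy : y ∈ T') (hfy : f y ∈ T)
    (hbb' : ∀ᶠ z in 𝓝 y, b' z = pullbackForm (b (f z)) (fderiv ℝ f z))
    (hsurj : Function.Surjective (fderiv ℝ f y)) (u v : E) :
    fderiv ℝ f y (christoffel b' y u v) = christoffel b (f y) (fderiv ℝ f y u) (fderiv ℝ f y v)
      + fderiv ℝ (fderiv ℝ f) y u v := by
  have hsymm : ∀ u v, fderiv ℝ (fderiv ℝ f) y u v = fderiv ℝ (fderiv ℝ f) y v u :=
    fun u v => (hf.isSymmSndFDerivAt (by simpa using WithTop.coe_le_coe.2 (le_top : (2 : ℕ∞) ≤ ⊤))).eq u v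
  have hf1 : HasFDerivAt f (fderiv ℝ f y) y := (hf.differentiableAt (by simp)).hasFDerivAt
  have hf2 : HasFDerivAt (fderiv ℝ f) (fderiv ℝ (fderiv ℝ f) y) y :=
    ((hf.fderiv_right (m := 1) (by norm_cast)).differentiableAt (by simp)).hasFDerivAt
  -- Differentiating the pullback relation gives one first-derivative term and two terms with second
  -- derivatives of `f`. In the Koszul combination the latter cancel by symmetry, except the pair
  -- that forms the inhomogeneous term of the law.
  have hD : ∀ w u v, fderiv ℝ b' y w u v
      = fderiv ℝ b (f y) (fderiv ℝ f y w) (fderiv ℝ f y u) (fderiv ℝ f y v)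
        + b (f y) (fderiv ℝ (fderiv ℝ f) y w u) (fderiv ℝ f y v)
        + b (f y) (fderiv ℝ f y u) (fderiv ℝ (fderiv ℝ f) y w v) := by
    intro w u v
    have h1 : HasFDerivAt (fun z => b (f z) (fderiv ℝ f z u) (fderiv ℝ f z v))
        (((fderiv ℝ b' y).flip u).flip v) y := by
      refine (hb'.hasFDerivAt_apply hy u v).congr_of_eventuallyEq ?_
      filter_upwards [hbb'] with z hz
      rw [hz, pullbackForm_apply]
    have h2 := (((hb.differentiableAt hfy).hasFDerivAt.comp y hf1).clm_apply
      (hf2.clm_apply (hasFDerivAt_const u y))).clm_apply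
      (hf2.clm_apply (hasFDerivAt_const v y))
    have h3 := congrArg (· w) (h1.unique h2)
    simp at h3
    rw [h3]
    ring
  have hb0 := hbb'.self_of_nhds
  apply hb.ext hfy
  intro z'
  obtain ⟨z, rfl⟩ := hsurj z'
  have h1 : b (f y) (fderiv ℝ f y (christoffel b' y u v)) (fderiv ℝ f y z)
      = b' y (christoffel b' y u v) z := by
    rw [hb0, pullbackForm_apply]
  rw [h1, hb'.apply_christoffel hy, map_add, add_apply, hb.apply_christoffel hfy, hD, hD, hD,
    hsymm v u, hsymm z u, hsymm z v, hb.symm (f y) hfy (fderiv ℝ f y v),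
    hb.symm (f y) hfy (fderiv ℝ f y u)]
  ring

end IsLocalMetric

/-! ### Integrability conditions -/

/-- Symmetry of second derivatives, stated for a first derivative given by a formula `f'`. Applied
to the equations ∇b = 0, ∇X = A and ∇A = 0 it produces all the curvature identities below. -/
theorem HasFDerivAt.fderiv_apply_comm {F : Type*} [NormedAddCommGroup F] [NormedSpace ℝ F]
    {f : E → F} {f' : E → E →L[ℝ] F} {x : E} (hf : ∀ᶠ y in 𝓝 x, HasFDerivAt f (f' y) y)
    (hf' : DifferentiableAt ℝ f' x) {u v : E} {A B : E →L[ℝ] F}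
    (hu : HasFDerivAt (fun y => f' y u) A x) (hv : HasFDerivAt (fun y => f' y v) B x) :
    B u = A v := by
  have h := second_derivative_symmetric_of_eventually_of_real hf hf'.hasFDerivAt u v
  have hu' := hu.unique (hf'.hasFDerivAt.clm_apply (hasFDerivAt_const u x))
  have hv' := hv.unique (hf'.hasFDerivAt.clm_apply (hasFDerivAt_const v x))
  rw [hu', hv']
  simpa using h

/-- The commutator action of the endomorphisms of `E` on themselves. -/
def commutatorAction (E : Type*) [NormedAddCommGroup E] [NormedSpace ℝ E] :
    (E →L[ℝ] E) →L[ℝ] (E →L[ℝ] E) →L[ℝ] E →L[ℝ] E :=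
  compL ℝ E E E - (compL ℝ E E E).flip

theorem commutatorAction_apply (A B : E →L[ℝ] E) (x : E) :
    commutatorAction E A B x = A (B x) - B (A x) := rfl

/-- The vector field `s` is parallel at `y`. -/
def IsParallelVectorAt (b : E → E →L[ℝ] E →L[ℝ] ℝ) (s : E → E) (y : E) : Prop :=
  HasFDerivAt s ((-christoffelMap b y).flip (s y)) y

/-- The field of endomorphisms `A` is parallel at `y`. -/
def IsParallelEndAt (b : E → E →L[ℝ] E →L[ℝ] ℝ) (A : E → E →L[ℝ] E) (y : E) : Prop :=
  HasFDerivAt A ((-(commutatorAction E ∘L christoffelMap b y)).flip (A y)) y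

/-- The vector field `X` satisfies `∇ X = A` at `y`. -/
def HasCovariantDerivAt (b : E → E →L[ℝ] E →L[ℝ] ℝ) (X : E → E) (A : E →L[ℝ] E) (y : E) : Prop :=
  HasFDerivAt X (A - (christoffelMap b y).flip (X y)) y

namespace IsLocalMetric

variable {b : E → E →L[ℝ] E →L[ℝ] ℝ} {T : Set E} {y : E}

/-- Leibniz rule: ∇(AX) = A ∇X because ∇A = 0. Applied to the Euler field it gives ∇η = A. -/
theorem hasCovariantDerivAt_apply {A : E → E →L[ℝ] E} {X : E → E} {B : E →L[ℝ] E}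
    (hA : IsParallelEndAt b A y) (hX : HasCovariantDerivAt b X B y) :
    HasCovariantDerivAt b (fun z => A z (X z)) (A y ∘L B) y := by
  refine (HasFDerivAt.clm_apply hA hX).congr_fderiv ?_
  ext w
  simp [commutatorAction_apply]

variable [CompleteSpace E]

/-- The function b(x,z) with constant x, z has symmetric second derivative. Expanding it twice by
`fderiv_eq`, the part antisymmetric in u, v is the asserted sum. -/
theorem curvature_skew (hb : IsLocalMetric b T) (hy : y ∈ T) (u v x z : E) :
    b y (localCurvature b y u v x) z + b y x (localCurvature b y u v z) = 0 := by
  have hΓ : ∀ z ∈ T, ∀ w, HasFDerivAt (fun z => christoffelMap b z w)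
      ((fderiv ℝ (christoffelMap b) z).flip w) z := fun z hz w =>
    hb.hasFDerivAt_christoffelMap_apply hz w
  have hder : ∀ w, HasFDerivAt (fun p => ((fderiv ℝ b p).flip x).flip z w)
      ((b y).flip z ∘L ((fderiv ℝ (christoffelMap b) y).flip w).flip x
        + ((fderiv ℝ b y).flip (christoffelMap b y w x)).flip z
        + b y x ∘L ((fderiv ℝ (christoffelMap b) y).flip w).flip z
        + ((fderiv ℝ b y).flip x).flip (christoffelMap b y w z)) y := by
    intro w
    have hb1 := (hb.differentiableAt hy).hasFDerivAt
    have h1 := (hΓ y hy w).clm_apply (hasFDerivAt_const x y)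
    have h2 := (hΓ y hy w).clm_apply (hasFDerivAt_const z y)
    have h3 := (((hb1.clm_apply h1).clm_apply (hasFDerivAt_const z y)).add
      ((hb1.clm_apply (hasFDerivAt_const x y)).clm_apply h2)).congr_of_eventuallyEq
        (f₁ := fun p => ((fderiv ℝ b p).flip x).flip z w) ?_
    · refine h3.congr_fderiv ?_
      ext w
      simp
      ring
    · filter_upwards [hb.isOpen.mem_nhds hy] with p hp
      exact hb.fderiv_eq hp w x z
  have h := HasFDerivAt.fderiv_apply_comm (f := fun p => b p x z)
    (by filter_upwards [hb.isOpen.mem_nhds hy] with p hp using hb.hasFDerivAt_apply hp x z)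
    (by
      have h1 : DifferentiableAt ℝ (fderiv ℝ b) y :=
        (((hb.contDiffOn.contDiffAt (hb.isOpen.mem_nhds hy)).fderiv_right (m := 1)
          (by norm_cast)).differentiableAt (by simp))
      have h2 : DifferentiableAt ℝ (fun p => (fderiv ℝ b p).flip) y :=
        (flipₗᵢ ℝ E E (E →L[ℝ] ℝ)).toContinuousLinearEquiv.differentiableAt.comp y h1
      have h3 : DifferentiableAt ℝ (fun p => (fderiv ℝ b p).flip x) y :=
        h2.clm_apply (differentiableAt_const x)
      have h4 : DifferentiableAt ℝ (fun p => ((fderiv ℝ b p).flip x).flip) y :=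
        (flipₗᵢ ℝ E E ℝ).toContinuousLinearEquiv.differentiableAt.comp y h3
      exact h4.clm_apply (differentiableAt_const z))
    (hder u) (hder v)
  simp only [add_apply, comp_apply, flip_apply, hb.fderiv_eq hy, ← christoffelMap_apply] at h
  rw [hb.localCurvature_eq hy, hb.localCurvature_eq hy]
  simp only [map_add, map_sub, add_apply, sub_apply]
  linarith

theorem differentiableAt_flip_apply (hb : IsLocalMetric b T) (hy : y ∈ T) {X : E → E}
    (hX : DifferentiableAt ℝ X y) :
    DifferentiableAt ℝ (fun z => (christoffelMap b z).flip (X z)) y :=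
  ((flipₗᵢ ℝ E E E).toContinuousLinearEquiv.differentiableAt.comp y
    (hb.hasFDerivAt_christoffelMap hy).differentiableAt).clm_apply hX

/-- A vector field whose covariant derivative is a parallel endomorphism is annihilated by the
curvature. -/
theorem curvature_eq_zero_of_hasCovariantDerivAt (hb : IsLocalMetric b T) (hy : y ∈ T)
    {A : E → E →L[ℝ] E} {X : E → E} (hA : IsParallelEndAt b A y)
    (hX : ∀ᶠ z in 𝓝 y, HasCovariantDerivAt b X (A z) z) (u v : E) :
    localCurvature b y u v (X y) = 0 := by
  have hX0 : HasCovariantDerivAt b X (A y) y := hX.self_of_nhds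
  have hder : ∀ w, HasFDerivAt (fun z => (A z - (christoffelMap b z).flip (X z)) w) _ y :=
    fun w => (HasFDerivAt.clm_apply hA (hasFDerivAt_const w y)).sub
      ((hb.hasFDerivAt_christoffelMap_apply hy w).clm_apply hX0)
  have h := HasFDerivAt.fderiv_apply_comm hX
    (HasFDerivAt.differentiableAt hA |>.sub
      (hb.differentiableAt_flip_apply hy (HasFDerivAt.differentiableAt hX0))) (hder u) (hder v)
  simp [commutatorAction_apply] at h
  rw [hb.localCurvature_eq hy]
  -- Vanishing torsion makes the terms AΓ(u,v) and AΓ(v,u) cancel. The mixed terms Γ(u)Av and Γ(v)Au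
  -- enter symmetrically, so only the curvature remains.
  have hs : christoffelMap b y u v = christoffelMap b y v u := hb.christoffel_symm hy u v
  rw [hs] at h
  rw [← sub_eq_zero] at h
  rw [← neg_eq_zero, ← h]
  abel

theorem curvature_eq_zero_of_isParallelVectorAt (hb : IsLocalMetric b T) (hy : y ∈ T)
    {X : E → E} (hX : ∀ᶠ z in 𝓝 y, IsParallelVectorAt b X z) (u v : E) :
    localCurvature b y u v (X y) = 0 := by
  refine hb.curvature_eq_zero_of_hasCovariantDerivAt hy (A := fun _ => 0) ?_ ?_ u v
  · refine (hasFDerivAt_const 0 y).congr_fderiv ?_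
    ext w
    simp
  · filter_upwards [hX] with z hz
    refine HasFDerivAt.congr_fderiv hz ?_
    ext w
    simp

/-- The integrability condition of ∇A = 0 is [R(u,v), A] = 0. -/
theorem curvature_comm_of_isParallelEndAt (hb : IsLocalMetric b T) (hy : y ∈ T)
    {A : E → E →L[ℝ] E} (hA : ∀ᶠ z in 𝓝 y, IsParallelEndAt b A z) (u v x : E) :
    localCurvature b y u v (A y x) = A y (localCurvature b y u v x) := by
  have hA0 : IsParallelEndAt b A y := hA.self_of_nhds
  have hder : ∀ w, HasFDerivAt
      (fun z => (-(commutatorAction E ∘L christoffelMap b z)).flip (A z) w) _ y :=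
    fun w => (((commutatorAction E).hasFDerivAt.comp y
      (hb.hasFDerivAt_christoffelMap_apply hy w)).clm_apply hA0).neg
  have hd : DifferentiableAt ℝ
      (fun z => (-(commutatorAction E ∘L christoffelMap b z)).flip (A z)) y := by
    have h1 : DifferentiableAt ℝ (fun z => -(commutatorAction E ∘L christoffelMap b z)) y :=
      ((differentiableAt_const _).clm_comp (hb.hasFDerivAt_christoffelMap hy).differentiableAt).neg
    have h2 := (flipₗᵢ ℝ E (E →L[ℝ] E) (E →L[ℝ] E)).toContinuousLinearEquiv.differentiableAt.comp
      y h1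
    exact h2.clm_apply (HasFDerivAt.differentiableAt hA0)
  have h := congrArg (· x) (HasFDerivAt.fderiv_apply_comm hA hd (hder u) (hder v))
  simp [commutatorAction_apply] at h
  rw [hb.localCurvature_eq hy, hb.localCurvature_eq hy]
  simp only [map_add, map_sub]
  rw [← sub_eq_zero] at h ⊢
  rw [← neg_eq_zero, ← h]
  abel

end IsLocalMetric

end Christoffel

/-! ### The equation of parallel transport under a change of coordinates. -/

section LocalTransition

variable {E : Type*} [NormedAddCommGroup E] [NormedSpace ℝ E]

/-- The derivative of df along the curve contributes exactly the second-derivative term of the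
transformation law of the Christoffel symbols, with the opposite sign. -/
theorem IsLocalMetric.hasDerivWithinAt_of_pullback {b b' : E → E →L[ℝ] E →L[ℝ] ℝ} {T T' : Set E}
    (hb : IsLocalMetric b T) (hb' : IsLocalMetric b' T') {f : E → E} {γ w : ℝ → E} {γ' : E} {t : ℝ}
    {S : Set ℝ}
    (hf : ContDiffAt ℝ ∞ f (γ t)) (hy : γ t ∈ T') (hfy : f (γ t) ∈ T)
    (hbb' : ∀ᶠ z in nhds (γ t), b' z = pullbackForm (b (f z)) (fderiv ℝ f z))
    (hsurj : Function.Surjective (fderiv ℝ f (γ t)))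
    (hγ : HasDerivWithinAt γ γ' S t)
    (hw : HasDerivWithinAt w (-christoffel b' (γ t) γ' (w t)) S t) :
    HasDerivWithinAt (fun s => f (γ s)) (fderiv ℝ f (γ t) γ') S t ∧
    HasDerivWithinAt (fun s => fderiv ℝ f (γ s) (w s))
      (-christoffel b (f (γ t)) (fderiv ℝ f (γ t) γ') (fderiv ℝ f (γ t) (w t))) S t := by
  have hf1 : HasFDerivAt f (fderiv ℝ f (γ t)) (γ t) :=
    (hf.differentiableAt (by simp)).hasFDerivAt
  have hf2 : HasFDerivAt (fderiv ℝ f) (fderiv ℝ (fderiv ℝ f) (γ t)) (γ t) :=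
    ((hf.fderiv_right (m := 1) (by norm_cast)).differentiableAt (by simp)).hasFDerivAt
  refine ⟨hf1.comp_hasDerivWithinAt t hγ, ?_⟩
  refine ((hf2.comp_hasDerivWithinAt t hγ).clm_apply hw).congr_deriv ?_
  have hΓ := hb.fderiv_christoffel_eq hb' hf hy hfy hbb' hsurj γ' (w t)
  simp only [Function.comp, map_neg, hΓ]
  abel

end LocalTransition

/-! ### Tangent vectors, metrics and parallel fields in the charts of a manifold. -/

section Charts

open Filter Topology

variable {E : Type*} [NormedAddCommGroup E] [NormedSpace ℝ E]
  {H : Type*} [TopologicalSpace H] {I : ModelWithCorners ℝ E H}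
  {N : Type*} [TopologicalSpace N] [ChartedSpace H N] [IsManifold I ∞ N]

open Classical in
/-- The coordinates of tangent vectors at `x`, in the chart around `c`; a junk value if `x` is
outside the chart. -/
def tangentCoord (I : ModelWithCorners ℝ E H) {N : Type*} [TopologicalSpace N] [ChartedSpace H N]
    [IsManifold I ∞ N] (c x : N) : TangentSpace I x ≃L[ℝ] E :=
  if h : x ∈ (extChartAt I c).source then (isInvertible_mfderiv_extChartAt h).choose
  else ContinuousLinearEquiv.refl ℝ E

theorem tangentCoord_eq {c x : N} (hx : x ∈ (extChartAt I c).source) :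
    (tangentCoord I c x : TangentSpace I x →L[ℝ] E) = mfderiv I 𝓘(ℝ, E) (extChartAt I c) x := by
  have h : tangentCoord I c x = (isInvertible_mfderiv_extChartAt hx).choose := dif_pos hx
  rw [h]
  exact (isInvertible_mfderiv_extChartAt hx).choose_spec

theorem tangentCoord_apply {c x : N} (hx : x ∈ (extChartAt I c).source) (v : TangentSpace I x) :
    tangentCoord I c x v = mfderiv I 𝓘(ℝ, E) (extChartAt I c) x v :=
  congrArg (fun A : TangentSpace I x →L[ℝ] E => A v) (tangentCoord_eq hx)

theorem vectorInChart_eq {c : N} (X : TangentBundle I N) (hX : X.proj ∈ (extChartAt I c).source) :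
    vectorInChart c X = tangentCoord I c X.proj X.2 :=
  (tangentCoord_apply hX X.2).symm

theorem vectorInChart_mk {c x : N} (hx : x ∈ (extChartAt I c).source) (v : TangentSpace I x) :
    vectorInChart c (⟨x, v⟩ : TangentBundle I N) = tangentCoord I c x v :=
  (tangentCoord_apply hx v).symm

variable [I.Boundaryless]

theorem tangentCoord_mfderiv_symm {c : N} {y : E} (hy : y ∈ (extChartAt I c).target) (u : E) :
    tangentCoord I c ((extChartAt I c).symm y)
      (mfderiv 𝓘(ℝ, E) I (extChartAt I c).symm y u) = u := by
  rw [tangentCoord_apply ((extChartAt I c).map_target hy)]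
  have h := mfderiv_extChartAt_comp_mfderivWithin_extChartAt_symm hy
  rw [I.range_eq_univ, mfderivWithin_univ] at h
  exact congrArg (fun A : E →L[ℝ] E => A u) h

theorem tangentCoord_symm_apply {c : N} {y : E} (hy : y ∈ (extChartAt I c).target) (u : E) :
    (tangentCoord I c ((extChartAt I c).symm y)).symm u
      = mfderiv 𝓘(ℝ, E) I (extChartAt I c).symm y u := by
  rw [ContinuousLinearEquiv.symm_apply_eq, tangentCoord_mfderiv_symm hy]

theorem metricInChart_apply (G : FormField I N) {c x : N} (hx : x ∈ (extChartAt I c).source)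
    (u v : E) : metricInChart G c (extChartAt I c x) u v
      = G x ((tangentCoord I c x).symm u) ((tangentCoord I c x).symm v) := by
  obtain ⟨y, hy, rfl⟩ : ∃ y ∈ (extChartAt I c).target, (extChartAt I c).symm y = x :=
    ⟨_, (extChartAt I c).map_source hx, (extChartAt I c).left_inv hx⟩
  rw [(extChartAt I c).right_inv hy, tangentCoord_symm_apply hy, tangentCoord_symm_apply hy]
  rfl

theorem metricInChart_tangentCoord (G : FormField I N) {c x : N}
    (hx : x ∈ (extChartAt I c).source) (u v : TangentSpace I x) :
    metricInChart G c (extChartAt I c x) (tangentCoord I c x u) (tangentCoord I c x v)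
      = G x u v := by
  rw [metricInChart_apply G hx, ContinuousLinearEquiv.symm_apply_apply,
    ContinuousLinearEquiv.symm_apply_apply]

/-- The coordinate change from the chart around `c` to the chart around `c'`. -/
def chartTransition (I : ModelWithCorners ℝ E H) {N : Type*} [TopologicalSpace N]
    [ChartedSpace H N] (c c' : N) : E → E :=
  fun y => extChartAt I c' ((extChartAt I c).symm y)

variable {c c' x : N}

theorem chartTransition_apply (hx : x ∈ (extChartAt I c).source) :
    chartTransition I c c' (extChartAt I c x) = extChartAt I c' x := by
  rw [chartTransition, (extChartAt I c).left_inv hx]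

theorem contDiffAt_chartTransition (hx : x ∈ (extChartAt I c).source)
    (hx' : x ∈ (extChartAt I c').source) :
    ContDiffAt ℝ ∞ (chartTransition I c c') (extChartAt I c x) := by
  rw [← contMDiffAt_iff_contDiffAt]
  have h1 : ContMDiffAt 𝓘(ℝ, E) I ∞ (extChartAt I c).symm (extChartAt I c x) :=
    (contMDiffOn_extChartAt_symm c).contMDiffAt ((isOpen_extChartAt_target c).mem_nhds ((extChartAt I c).map_source hx))
  have h2 : ContMDiffAt I 𝓘(ℝ, E) ∞ (extChartAt I c') ((extChartAt I c).symm (extChartAt I c x)) := by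
    rw [(extChartAt I c).left_inv hx]
    exact contMDiffAt_extChartAt' (by rwa [extChartAt_source] at hx')
  exact h2.comp _ h1

theorem fderiv_chartTransition (hx : x ∈ (extChartAt I c).source)
    (hx' : x ∈ (extChartAt I c').source) (u : TangentSpace I x) :
    fderiv ℝ (chartTransition I c c') (extChartAt I c x) (tangentCoord I c x u)
      = tangentCoord I c' x u := by
  obtain ⟨y, hy, rfl⟩ : ∃ y ∈ (extChartAt I c).target, (extChartAt I c).symm y = x :=
    ⟨_, (extChartAt I c).map_source hx, (extChartAt I c).left_inv hx⟩
  rw [(extChartAt I c).right_inv hy, ← mfderiv_eq_fderiv]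
  have h1 : MDifferentiableAt 𝓘(ℝ, E) I (extChartAt I c).symm y :=
    ((contMDiffOn_extChartAt_symm (n := ∞) c).contMDiffAt
      ((isOpen_extChartAt_target c).mem_nhds hy)).mdifferentiableAt (by simp)
  have h2 : MDifferentiableAt I 𝓘(ℝ, E) (extChartAt I c') ((extChartAt I c).symm y) :=
    mdifferentiableAt_extChartAt (by rwa [extChartAt_source] at hx')
  have h3 := mfderiv_comp y h2 h1
  obtain ⟨v, rfl⟩ := (tangentCoord I c ((extChartAt I c).symm y)).symm.surjective u
  rw [ContinuousLinearEquiv.apply_symm_apply, tangentCoord_symm_apply hy, tangentCoord_apply hx']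
  exact congrArg (fun A : E →L[ℝ] E => A v) h3

theorem surjective_fderiv_chartTransition (hx : x ∈ (extChartAt I c).source)
    (hx' : x ∈ (extChartAt I c').source) :
    Function.Surjective (fderiv ℝ (chartTransition I c c') (extChartAt I c x)) := fun v =>
  ⟨tangentCoord I c x ((tangentCoord I c' x).symm v), by
    rw [fderiv_chartTransition hx hx', ContinuousLinearEquiv.apply_symm_apply]⟩

theorem eventually_exists_extChartAt_eq (hx : x ∈ (extChartAt I c).source) {S : Set N}
    (hS : S ∈ 𝓝 x) : ∀ᶠ z in 𝓝 (extChartAt I c x), ∃ x' ∈ S, x' ∈ (extChartAt I c).source ∧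
      extChartAt I c x' = z := by
  have h1 := (continuousAt_extChartAt_symm' (I := I) hx).preimage_mem_nhds
    ((extChartAt I c).left_inv hx ▸ hS)
  filter_upwards [h1, (isOpen_extChartAt_target c).mem_nhds ((extChartAt I c).map_source hx)] with z hz hz'
  exact ⟨_, hz, (extChartAt I c).map_target hz', (extChartAt I c).right_inv hz'⟩

theorem eventually_metricInChart_eq (G : FormField I N) (hx : x ∈ (extChartAt I c).source)
    (hx' : x ∈ (extChartAt I c').source) :
    ∀ᶠ z in 𝓝 (extChartAt I c x), metricInChart G c z
      = pullbackForm (metricInChart G c' (chartTransition I c c' z))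
          (fderiv ℝ (chartTransition I c c') z) := by
  filter_upwards [eventually_exists_extChartAt_eq hx (extChartAt_source_mem_nhds' hx')] with z hz
  obtain ⟨q, hq', hq, rfl⟩ := hz
  ext u v
  obtain ⟨u, rfl⟩ := (tangentCoord I c q).surjective u
  obtain ⟨v, rfl⟩ := (tangentCoord I c q).surjective v
  rw [pullbackForm_apply, fderiv_chartTransition hq hq', fderiv_chartTransition hq hq',
    chartTransition_apply hq, metricInChart_tangentCoord G hq, metricInChart_tangentCoord G hq']

/-- A field of bilinear forms is a smooth metric: so are its expressions in charts. -/
def IsSmoothMetric (G : FormField I N) : Prop :=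
  ∀ c : N, IsLocalMetric (metricInChart G c) (extChartAt I c).target

/-- The equation of parallel transport at `t`, in the chart around `c`. -/
def IsParallelInChartAt (G : FormField I N) (γ : ℝ → N) (X : ℝ → TangentBundle I N) (c : N)
    (t : ℝ) : Prop :=
  HasDerivWithinAt (fun s => vectorInChart c (X s))
    (-christoffel (metricInChart G c) (extChartAt I c (γ t))
      (derivWithin (fun s => extChartAt I c (γ s)) (Icc 0 1) t) (vectorInChart c (X t)))
    (Icc 0 1) t

omit [I.Boundaryless] in
theorem differentiableWithinAt_extChartAt_comp {γ : ℝ → N}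
    (hγ : ContMDiffOn 𝓘(ℝ, ℝ) I 1 γ (Icc 0 1)) {t : ℝ} (ht : t ∈ Icc (0 : ℝ) 1)
    (hc : γ t ∈ (extChartAt I c).source) :
    DifferentiableWithinAt ℝ (fun s => extChartAt I c (γ s)) (Icc 0 1) t := by
  rw [← mdifferentiableWithinAt_iff_differentiableWithinAt]
  have h1 : MDifferentiableAt I 𝓘(ℝ, E) (extChartAt I c) (γ t) :=
    mdifferentiableAt_extChartAt (by rwa [extChartAt_source] at hc)
  exact h1.comp_mdifferentiableWithinAt t ((hγ t ht).mdifferentiableWithinAt (by simp))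

theorem IsParallelInChartAt.change_chart {G : FormField I N} (hG : IsSmoothMetric G) {γ : ℝ → N}
    {X : ℝ → TangentBundle I N} (hγ : ContMDiffOn 𝓘(ℝ, ℝ) I 1 γ (Icc 0 1))
    (hX : ∀ t ∈ Icc (0 : ℝ) 1, (X t).proj = γ t) {t : ℝ} (ht : t ∈ Icc (0 : ℝ) 1)
    (hc : γ t ∈ (extChartAt I c).source) (hc' : γ t ∈ (extChartAt I c').source)
    (h : IsParallelInChartAt G γ X c t) : IsParallelInChartAt G γ X c' t := by
  have hγc := (differentiableWithinAt_extChartAt_comp hγ ht hc).hasDerivWithinAt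
  have hsource : ∀ᶠ s in 𝓝[Icc 0 1] t, γ s ∈ (extChartAt I c).source ∧
      γ s ∈ (extChartAt I c').source := by
    have h1 := (hγ t ht).continuousWithinAt
    exact (h1.eventually_mem (extChartAt_source_mem_nhds' hc)).and
      (h1.eventually_mem (extChartAt_source_mem_nhds' hc'))
  have hvec : ∀ᶠ s in 𝓝[Icc 0 1] t, vectorInChart c' (X s)
      = fderiv ℝ (chartTransition I c c') (extChartAt I c (γ s)) (vectorInChart c (X s)) := by
    filter_upwards [hsource, self_mem_nhdsWithin] with s hs hs'
    rw [← hX s hs'] at hs ⊢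
    rw [vectorInChart_eq _ hs.1, vectorInChart_eq _ hs.2, fderiv_chartTransition hs.1 hs.2]
  have hpos : ∀ᶠ s in 𝓝[Icc 0 1] t, extChartAt I c' (γ s)
      = chartTransition I c c' (extChartAt I c (γ s)) := by
    filter_upwards [hsource] with s hs using (chartTransition_apply hs.1).symm
  have hmem : chartTransition I c c' (extChartAt I c (γ t)) ∈ (extChartAt I c').target := by
    rw [chartTransition_apply hc]
    exact (extChartAt I c').map_source hc'
  have key := IsLocalMetric.hasDerivWithinAt_of_pullback (hG c') (hG c)
    (γ := fun s => extChartAt I c (γ s)) (w := fun s => vectorInChart c (X s))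
    (contDiffAt_chartTransition hc hc')
    ((extChartAt I c).map_source hc) hmem
    (eventually_metricInChart_eq G hc hc') (surjective_fderiv_chartTransition hc hc') hγc h
  have h1 := key.1
  have h2 := key.2
  have h3 := (h1.congr_of_eventuallyEq hpos (hpos.self_of_nhdsWithin ht)).derivWithin
    (uniqueDiffOn_Icc_zero_one t ht)
  have h4 := h2.congr_of_eventuallyEq hvec (hvec.self_of_nhdsWithin ht)
  rw [chartTransition_apply hc, ← hvec.self_of_nhdsWithin ht, ← h3] at h4
  exact h4

/-- Parallelism is required in every chart; chart independence reduces it to one chart for each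
time. -/
theorem isParallelAlong_of_forall_exists {G : FormField I N} (hG : IsSmoothMetric G) {γ : ℝ → N}
    {X : ℝ → TangentBundle I N} (hγ : ContMDiffOn 𝓘(ℝ, ℝ) I 1 γ (Icc 0 1))
    (hX : ∀ t ∈ Icc (0 : ℝ) 1, (X t).proj = γ t)
    (h : ∀ t ∈ Icc (0 : ℝ) 1, ∃ c, γ t ∈ (extChartAt I c).source ∧ IsParallelInChartAt G γ X c t) :
    IsParallelAlong G γ X := by
  refine ⟨hX, fun c' t ht hc' => ?_⟩
  obtain ⟨c, hc, hXc⟩ := h t ht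
  exact hXc.change_chart hG hγ hX ht hc hc'

end Charts

/-! ### Parallel transport: uniqueness, isometry, existence. -/

section Transport

open Filter Topology Metric

variable {E : Type*} [NormedAddCommGroup E] [NormedSpace ℝ E]
  {H : Type*} [TopologicalSpace H] {I : ModelWithCorners ℝ E H} [I.Boundaryless]
  {N : Type*} [TopologicalSpace N] [ChartedSpace H N] [IsManifold I ∞ N]
  {G : FormField I N}

/-- Affine reparametrization of the interval between `t₁` and `t₂`, in either order, to [0, 1]. Both
directions of time are needed for the connectedness argument that follows. -/
theorem HasDerivWithinAt.eq_zero_of_linear_on {F : Type*} [NormedAddCommGroup F] [NormedSpace ℝ F]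
    {d : ℝ → F} {L : ℝ → F →L[ℝ] F} {C : ℝ} {S : Set ℝ} {t₁ t₂ : ℝ} (hS : uIcc t₁ t₂ ⊆ S)
    (hC : ∀ t ∈ uIcc t₁ t₂, ‖L t‖ ≤ C) (h₁ : d t₁ = 0)
    (hd : ∀ t ∈ uIcc t₁ t₂, HasDerivWithinAt d (L t (d t)) S t) : d t₂ = 0 := by
  have hmem : ∀ s ∈ Icc (0 : ℝ) 1, t₁ + s * (t₂ - t₁) ∈ uIcc t₁ t₂ := fun s hs => by
    rw [← segment_eq_uIcc]
    have h1 : t₂ = t₁ + (t₂ - t₁) := by ring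
    exact ⟨1 - s, s, by linarith [hs.2], hs.1, by ring, by simp only [smul_eq_mul]; ring⟩
  have h := HasDerivWithinAt.eq_zero_of_linear (f := fun s => d (t₁ + s * (t₂ - t₁)))
    (L := fun s => (t₂ - t₁) • L (t₁ + s * (t₂ - t₁))) (C := ‖t₂ - t₁‖ * C) (fun s hs => ?_)
    (by simpa using h₁) (fun s hs => ?_) 1 (by simp)
  · simpa using h
  · rw [norm_smul]
    gcongr
    exact hC _ (hmem s hs)
  · have h1 : HasDerivWithinAt (fun s : ℝ => t₁ + s * (t₂ - t₁)) (t₂ - t₁) (Icc 0 1) s := by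
      simpa using (((hasDerivAt_id s).mul_const (t₂ - t₁)).const_add t₁).hasDerivWithinAt
    exact (hd _ (hmem s hs)).scomp s h1 (fun s hs => hS (hmem s hs))

theorem TangentBundle.eq_iff_vectorInChart_eq {c : N} {X Y : TangentBundle I N}
    (h : X.proj = Y.proj) (hX : X.proj ∈ (extChartAt I c).source) :
    X = Y ↔ vectorInChart c X = vectorInChart c Y := by
  refine ⟨fun h => by rw [h], fun hv => ?_⟩
  obtain ⟨x, u⟩ := X
  obtain ⟨y, v⟩ := Y
  obtain rfl : x = y := h
  rw [vectorInChart_mk hX, vectorInChart_mk hX] at hv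
  rw [(tangentCoord I c x).injective hv]

/-- Parallel vector fields along a curve which agree at one time agree throughout. -/
theorem IsParallelAlong.eq_of_eq [CompleteSpace E] (hG : IsSmoothMetric G) {γ : ℝ → N}
    {X Y : ℝ → TangentBundle I N}
    (hγ : ContMDiffOn 𝓘(ℝ, ℝ) I 1 γ (Icc 0 1)) (hX : IsParallelAlong G γ X)
    (hY : IsParallelAlong G γ Y) {t₀ t : ℝ} (ht₀ : t₀ ∈ Icc (0 : ℝ) 1) (ht : t ∈ Icc (0 : ℝ) 1)
    (h₀ : X t₀ = Y t₀) : X t = Y t := by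
  -- Agreement propagates by connectedness of [0, 1]: it is enough that near each time t₁ agreement
  -- at t₁ and agreement at a nearby time imply each other. Locally this is uniqueness for a linear
  -- equation in one chart.
  refine isPreconnected_Icc.induction₂' (fun s t => X s = Y s → X t = Y t) (fun t₁ ht₁ => ?_)
    (fun _ _ _ _ _ _ h1 h2 h3 => h2 (h1 h3)) ht₀ ht h₀
  set c := γ t₁
  have hc : γ t₁ ∈ (extChartAt I c).source := mem_extChartAt_source c
  have hcont := (hγ t₁ ht₁).continuousWithinAt
  have hsource : ∀ᶠ s in 𝓝[Icc 0 1] t₁, γ s ∈ (extChartAt I c).source :=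
    hcont.eventually_mem (extChartAt_source_mem_nhds' hc)
  set y : ℝ → E := fun s => extChartAt I c (γ s)
  have hy : ContDiffWithinAt ℝ 1 y (Icc 0 1) t₁ := by
    rw [← contMDiffWithinAt_iff_contDiffWithinAt]
    have h1 : ContMDiffAt I 𝓘(ℝ, E) 1 (extChartAt I c) (γ t₁) := contMDiffAt_extChartAt
    exact h1.comp_contMDiffWithinAt t₁ (hγ t₁ ht₁)
  have hdy : ContinuousWithinAt (derivWithin y (Icc 0 1)) (Icc 0 1) t₁ :=
    (hy.fderivWithin_right (m := 0) uniqueDiffOn_Icc_zero_one (by simp) ht₁).continuousWithinAt.clm_apply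
      continuousWithinAt_const
  set L : ℝ → E →L[ℝ] E := fun s =>
    -christoffelMap (metricInChart G c) (y s) (derivWithin y (Icc 0 1) s)
  have hL : ContinuousWithinAt L (Icc 0 1) t₁ := by
    have h1 : ContinuousAt (christoffelMap (metricInChart G c)) (y t₁) :=
      ((hG c).hasFDerivAt_christoffelMap ((extChartAt I c).map_source hc)).continuousAt
    exact ((h1.comp_continuousWithinAt hy.continuousWithinAt).clm_apply hdy).neg
  have hLb : ∀ᶠ s in 𝓝[Icc 0 1] t₁, ‖L s‖ < ‖L t₁‖ + 1 :=
    hL.norm.eventually_lt continuousWithinAt_const (by simp)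
  obtain ⟨δ, hδ, hδ'⟩ := Metric.mem_nhdsWithin_iff.1 (hsource.and hLb)
  have hev : ∀ᶠ s in 𝓝[Icc 0 1] t₁, s ∈ ball t₁ δ ∩ Icc 0 1 :=
    inter_mem (mem_nhdsWithin_of_mem_nhds (ball_mem_nhds t₁ hδ)) self_mem_nhdsWithin
  have hvec : ∀ s ∈ ball t₁ δ ∩ Icc 0 1,
      (X s = Y s ↔ vectorInChart c (X s) - vectorInChart c (Y s) = 0) := fun s hs => by
    rw [sub_eq_zero]
    refine TangentBundle.eq_iff_vectorInChart_eq ?_ ?_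
    · rw [hX.1 s hs.2, hY.1 s hs.2]
    · rw [hX.1 s hs.2]
      exact (hδ' hs).1
  have hder : ∀ s ∈ ball t₁ δ ∩ Icc 0 1, HasDerivWithinAt
      (fun s => vectorInChart c (X s) - vectorInChart c (Y s))
      (L s (vectorInChart c (X s) - vectorInChart c (Y s))) (Icc 0 1) s := fun s hs => by
    have h1 := (hX.2 c s hs.2 (hδ' hs).1).sub (hY.2 c s hs.2 (hδ' hs).1)
    refine h1.congr_deriv ?_
    rw [map_sub]
    rfl
  have hzero : ∀ s ∈ ball t₁ δ ∩ Icc 0 1, ∀ s' ∈ ball t₁ δ ∩ Icc 0 1, X s = Y s → X s' = Y s' := by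
    intro s hs s' hs' h
    have hsub : uIcc s s' ⊆ ball t₁ δ ∩ Icc 0 1 := by
      rw [← segment_eq_uIcc]
      exact ((convex_ball t₁ δ).inter (convex_Icc 0 1)).segment_subset hs hs'
    rw [hvec s' hs']
    exact HasDerivWithinAt.eq_zero_of_linear_on (hsub.trans inter_subset_right)
      (fun t ht => (hδ' (hsub ht)).2.le) ((hvec s hs).1 h) fun t ht => hder t (hsub ht)
  have h1 : t₁ ∈ ball t₁ δ ∩ Icc 0 1 := ⟨mem_ball_self hδ, ht₁⟩
  filter_upwards [hev] with s hs
  exact ⟨hzero _ h1 _ hs, hzero _ hs _ h1⟩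

/-- The pairing of two tangent vectors, meaningful if they have the same base point. -/
def formPairing (G : FormField I N) (X Y : TangentBundle I N) : ℝ :=
  G X.proj X.2 (id Y.2 : E)

theorem formPairing_eq {c : N} {X Y : TangentBundle I N}
    (h : X.proj = Y.proj) (hX : X.proj ∈ (extChartAt I c).source) :
    formPairing G X Y = metricInChart G c (extChartAt I c X.proj) (vectorInChart c X)
      (vectorInChart c Y) := by
  obtain ⟨x, u⟩ := X
  obtain ⟨y, v⟩ := Y
  obtain rfl : x = y := h
  rw [vectorInChart_mk hX, vectorInChart_mk hX, metricInChart_tangentCoord G hX]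
  rfl

/-- The pairing has derivative zero: the derivative of the metric, by `IsLocalMetric.fderiv_eq`,
cancels the two Christoffel terms. -/
theorem IsParallelAlong.formPairing_eq (hG : IsSmoothMetric G) {γ : ℝ → N}
    {X Y : ℝ → TangentBundle I N}
    (hγ : ContMDiffOn 𝓘(ℝ, ℝ) I 1 γ (Icc 0 1)) (hX : IsParallelAlong G γ X)
    (hY : IsParallelAlong G γ Y) : formPairing G (X 1) (Y 1) = formPairing G (X 0) (Y 0) := by
  have hder : ∀ t ∈ Icc (0 : ℝ) 1,
      HasDerivWithinAt (fun s => formPairing G (X s) (Y s)) 0 (Icc 0 1) t := by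
    intro t ht
    set c := γ t with hcdef
    have hc : γ t ∈ (extChartAt I c).source := mem_extChartAt_source c
    have hT := (extChartAt I c).map_source hc
    have hsource : ∀ᶠ s in 𝓝[Icc 0 1] t, γ s ∈ (extChartAt I c).source :=
      (hγ t ht).continuousWithinAt.eventually_mem (extChartAt_source_mem_nhds' hc)
    have hev : ∀ᶠ s in 𝓝[Icc 0 1] t, formPairing G (X s) (Y s)
        = metricInChart G c (extChartAt I c (γ s)) (vectorInChart c (X s))
          (vectorInChart c (Y s)) := by
      filter_upwards [hsource, self_mem_nhdsWithin] with s hs hs'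
      rw [← hX.1 s hs'] at hs ⊢
      exact _root_.formPairing_eq (by rw [hX.1 s hs', hY.1 s hs']) hs
    have hy := (differentiableWithinAt_extChartAt_comp hγ ht hc).hasDerivWithinAt
    have hm := ((hG c).differentiableAt hT).hasFDerivAt.comp_hasDerivWithinAt t hy
    have h1 := ((hm.clm_apply (hX.2 c t ht hc)).clm_apply
      (hY.2 c t ht hc)).congr_of_eventuallyEq hev (hev.self_of_nhdsWithin ht)
    refine h1.congr_deriv ?_
    simp only [Function.comp, add_apply, map_neg, neg_apply, (hG c).fderiv_eq hT]
    ring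
  exact constant_of_derivWithin_zero (fun t ht => (hder t ht).differentiableWithinAt)
    (fun t ht => (hder t (Ico_subset_Icc_self ht)).derivWithin
      (uniqueDiffOn_Icc_zero_one t (Ico_subset_Icc_self ht))) 1 (by simp)

/-- Parallel transport is isometric. -/
theorem IsParallelTransport.form_eq (hG : IsSmoothMetric G) {p q : N}
    {P : TangentSpace I p ≃ₗ[ℝ] TangentSpace I q} (hP : IsParallelTransport G p q P)
    (u v : TangentSpace I p) : G q (P u) (P v) = G p u v := by
  induction hP with
  | segment p q P γ hγ h0 h1 hP =>
    obtain ⟨X, hX, hX0, hX1⟩ := hP u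
    obtain ⟨Y, hY, hY0, hY1⟩ := hP v
    have h := hX.formPairing_eq hG hγ hY
    rw [hX0, hX1, hY0, hY1] at h
    exact h
  | concat p q r P Q _ _ hP hQ =>
    rw [LinearEquiv.trans_apply, LinearEquiv.trans_apply, hQ, hP]

/-! ### Transport along short segments in a chart -/

/-- Two points of the ball differ by at most 2ρ, so the bound 1/2 puts the transport equation along
any segment within reach of `exists_hasDerivWithinAt_linear`; hence the radius 1/(4C). The Lipschitz
constant `K` serves `hasFDerivAt_radial`. -/
theorem IsLocalMetric.exists_ball [FiniteDimensional ℝ E] {b : E → E →L[ℝ] E →L[ℝ] ℝ} {T : Set E}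
    (hb : IsLocalMetric b T) {y₀ : E} (hy₀ : y₀ ∈ T) :
    ∃ ρ > 0, ball y₀ ρ ⊆ T ∧ ∃ C K : ℝ, (∀ y ∈ ball y₀ ρ, ‖christoffelMap b y‖ ≤ C) ∧
      C * (2 * ρ) ≤ 1 / 2 ∧ (∀ y ∈ ball y₀ ρ, ‖fderiv ℝ (christoffelMap b) y‖ ≤ C) ∧
      ∀ y ∈ ball y₀ ρ, ∀ z ∈ ball y₀ ρ,
        ‖fderiv ℝ (christoffelMap b) y - fderiv ℝ (christoffelMap b) z‖ ≤ K * ‖y - z‖ := by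
  have := FiniteDimensional.complete ℝ E
  have hD : ContDiffAt ℝ 1 (fderiv ℝ (christoffelMap b)) y₀ :=
    (hb.contDiffOn_christoffelMap.contDiffAt (hb.isOpen.mem_nhds hy₀)).fderiv_right (m := 1)
      (by norm_cast)
  obtain ⟨K, S, hS, hK⟩ := hD.exists_lipschitzOnWith
  set C := ‖christoffelMap b y₀‖ + ‖fderiv ℝ (christoffelMap b) y₀‖ + 1
  have hC : 0 < C := by positivity
  have h1 : ∀ᶠ y in 𝓝 y₀, y ∈ T ∧ ‖christoffelMap b y‖ < C ∧
      ‖fderiv ℝ (christoffelMap b) y‖ < C ∧ y ∈ S :=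
    (hb.isOpen.eventually_mem hy₀).and
      (((hb.hasFDerivAt_christoffelMap hy₀).continuousAt.norm.eventually_lt continuousAt_const
        (by linarith [norm_nonneg (fderiv ℝ (christoffelMap b) y₀)])).and
      ((hD.continuousAt.norm.eventually_lt continuousAt_const
        (by linarith [norm_nonneg (christoffelMap b y₀)])).and hS))
  obtain ⟨δ, hδ, hδ'⟩ := Metric.eventually_nhds_iff_ball.1 h1
  have hδ'' : ∀ y ∈ ball y₀ (min δ (1 / (4 * C))), _ := fun y hy =>
    hδ' y (ball_subset_ball (min_le_left _ _) hy)
  refine ⟨min δ (1 / (4 * C)), by positivity, fun y hy => (hδ'' y hy).1, C, K,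
    fun y hy => (hδ'' y hy).2.1.le, ?_, fun y hy => (hδ'' y hy).2.2.1.le, fun y hy z hz => ?_⟩
  · have : min δ (1 / (4 * C)) ≤ 1 / (4 * C) := min_le_right _ _
    calc C * (2 * min δ (1 / (4 * C))) ≤ C * (2 * (1 / (4 * C))) := by gcongr
      _ = 1 / 2 := by field_simp; norm_num
  · exact hK.norm_sub_le (hδ'' y hy).2.2.2 (hδ'' z hz).2.2.2

/-- The solution of the equation of parallel transport along a short segment, with its inverse. -/
theorem IsLocalMetric.exists_fundamentalSolution [FiniteDimensional ℝ E]
    {b : E → E →L[ℝ] E →L[ℝ] ℝ} {T : Set E}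
    (hb : IsLocalMetric b T) {y₀ : E} {ρ C : ℝ} (hρ : ball y₀ ρ ⊆ T)
    (hC : ∀ y ∈ ball y₀ ρ, ‖christoffelMap b y‖ ≤ C) (hCρ : C * (2 * ρ) ≤ 1 / 2)
    {y h : E} (hy : y ∈ ball y₀ ρ) (hyh : y + h ∈ ball y₀ ρ) :
    ∃ U V : ℝ → E →L[ℝ] E, U 0 = .id ℝ E ∧ V 0 = .id ℝ E ∧
      (∀ t ∈ Icc (0 : ℝ) 1, HasDerivWithinAt U (-(christoffelMap b (y + t • h) h ∘L U t))
        (Icc 0 1) t) ∧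
      (∀ t ∈ Icc (0 : ℝ) 1, HasDerivWithinAt V (V t ∘L christoffelMap b (y + t • h) h)
        (Icc 0 1) t) ∧
      (∀ t ∈ Icc (0 : ℝ) 1, V t ∘L U t = .id ℝ E) ∧
      (∀ t ∈ Icc (0 : ℝ) 1, U t ∘L V t = .id ℝ E) := by
  have := FiniteDimensional.complete ℝ E
  have hC0 : 0 ≤ C := (norm_nonneg (christoffelMap b y)).trans (hC y hy)
  have hh : ‖h‖ ≤ 2 * ρ := by
    have h1 : dist (y + h) y ≤ dist (y + h) y₀ + dist y y₀ := dist_triangle_right _ _ _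
    rw [dist_eq_norm, add_sub_cancel_left] at h1
    rw [mem_ball] at hy hyh
    linarith
  set Γ : ℝ → E →L[ℝ] E := fun t => christoffelMap b (y + t • h) h with hΓ
  have hmem : ∀ t ∈ Icc (0 : ℝ) 1, y + t • h ∈ ball y₀ ρ := fun t ht => segment_mem_ball hy hyh ht
  have hΓc : ContinuousOn Γ (Icc 0 1) := by
    refine ContinuousOn.clm_apply (ContinuousOn.comp (t := T) hb.contDiffOn_christoffelMap.continuousOn
      (by fun_prop) fun t ht => hρ (hmem t ht)) continuousOn_const
  have hΓb : ∀ t ∈ Icc (0 : ℝ) 1, ‖Γ t‖ ≤ 1 / 2 := fun t ht =>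
    ((christoffelMap b (y + t • h)).le_of_opNorm_le_of_le (hC _ (hmem t ht)) hh).trans hCρ
  obtain ⟨U, hU0, hU⟩ := exists_hasDerivWithinAt_linear
    (L := fun t => -(ContinuousLinearMap.compL ℝ E E E (Γ t)))
    ((ContinuousLinearMap.compL ℝ E E E).continuous.comp_continuousOn hΓc).neg
    (fun t ht => by
      rw [norm_neg]
      refine ContinuousLinearMap.opNorm_le_bound _ (by norm_num) fun A => ?_
      exact (ContinuousLinearMap.opNorm_comp_le _ _).trans (by gcongr; exact hΓb t ht))
    (.id ℝ E)
  obtain ⟨V, hV0, hV⟩ := exists_hasDerivWithinAt_linear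
    (L := fun t => (ContinuousLinearMap.compL ℝ E E E).flip (Γ t))
    ((ContinuousLinearMap.compL ℝ E E E).flip.continuous.comp_continuousOn hΓc)
    (fun t ht => by
      refine ContinuousLinearMap.opNorm_le_bound _ (by norm_num) fun A => ?_
      refine (ContinuousLinearMap.opNorm_comp_le _ _).trans ?_
      rw [mul_comm]
      gcongr
      exact hΓb t ht)
    (.id ℝ E)
  -- The equations for `U` and `V` are adjoint, so the product VU is constant. The other order
  -- follows in finite dimension.
  have hVU : ∀ t ∈ Icc (0 : ℝ) 1, V t ∘L U t = .id ℝ E := by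
    have hder : ∀ t ∈ Icc (0 : ℝ) 1, HasDerivWithinAt (fun t => V t ∘L U t) 0 (Icc 0 1) t := by
      intro t ht
      refine ((hV t ht).clm_comp (hU t ht)).congr_deriv ?_
      ext x
      simp
    intro t ht
    have h1 := constant_of_derivWithin_zero (fun t ht => (hder t ht).differentiableWithinAt)
      (fun t ht => (hder t (Ico_subset_Icc_self ht)).derivWithin
        (uniqueDiffOn_Icc_zero_one t (Ico_subset_Icc_self ht))) t ht
    rw [h1, hU0, hV0]
    rfl
  refine ⟨U, V, hU0, hV0, hU, hV, hVU, fun t ht => ?_⟩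
  have h1 : (V t : E →ₗ[ℝ] E) * (U t : E →ₗ[ℝ] E) = 1 := by
    ext x
    exact congrArg (fun A : E →L[ℝ] E => A x) (hVU t ht)
  have h2 := mul_eq_one_comm.1 h1
  ext x
  exact congrArg (fun A : E →ₗ[ℝ] E => A x) h2

/-- The tangent vector with the given coordinates in the chart around `c`. -/
def chartVector (I : ModelWithCorners ℝ E H) {N : Type*} [TopologicalSpace N] [ChartedSpace H N]
    [IsManifold I ∞ N] (c : N) (y w : E) : TangentBundle I N :=
  ⟨(extChartAt I c).symm y, (tangentCoord I c _).symm w⟩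

theorem vectorInChart_chartVector {c : N} {y : E} (hy : y ∈ (extChartAt I c).target) (w : E) :
    vectorInChart c (chartVector I c y w) = w := by
  rw [chartVector, vectorInChart_mk ((extChartAt I c).map_target hy),
    ContinuousLinearEquiv.apply_symm_apply]

theorem chartVector_tangentCoord {c : N} {y : E} (v : TangentSpace I ((extChartAt I c).symm y)) :
    chartVector I c y (tangentCoord I c _ v) = ⟨(extChartAt I c).symm y, v⟩ := by
  rw [chartVector, ContinuousLinearEquiv.symm_apply_apply]

theorem isParallelInChartAt_of_coord {c : N} {γ : ℝ → N} {X : ℝ → TangentBundle I N} {y w : ℝ → E}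
    {y' : E} {t : ℝ} (ht : t ∈ Icc (0 : ℝ) 1)
    (hγ : ∀ s ∈ Icc (0 : ℝ) 1, extChartAt I c (γ s) = y s)
    (hX : ∀ s ∈ Icc (0 : ℝ) 1, vectorInChart c (X s) = w s)
    (hy : HasDerivWithinAt y y' (Icc 0 1) t)
    (hw : HasDerivWithinAt w (-christoffel (metricInChart G c) (y t) y' (w t)) (Icc 0 1) t) :
    IsParallelInChartAt G γ X c t := by
  have h1 := (hy.congr hγ (hγ t ht)).derivWithin (uniqueDiffOn_Icc_zero_one t ht)
  rw [IsParallelInChartAt, h1, hγ t ht, hX t ht]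
  exact hw.congr hX (hX t ht)

theorem contMDiffOn_extChartAt_symm_comp {c : N} {y : ℝ → E} (hyc : ContDiffOn ℝ 1 y (Icc 0 1))
    (hy : ∀ s ∈ Icc (0 : ℝ) 1, y s ∈ (extChartAt I c).target) :
    ContMDiffOn 𝓘(ℝ, ℝ) I 1 (fun s => (extChartAt I c).symm (y s)) (Icc 0 1) := by
  refine (contMDiffOn_extChartAt_symm c).comp (t := (extChartAt I c).target) ?_ hy
  rwa [contMDiffOn_iff_contDiffOn]

theorem isParallelAlong_chartVector (hG : IsSmoothMetric G) {c : N} {y y' w : ℝ → E}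
    (hyc : ContDiffOn ℝ 1 y (Icc 0 1))
    (hy : ∀ s ∈ Icc (0 : ℝ) 1, y s ∈ (extChartAt I c).target)
    (hy' : ∀ s ∈ Icc (0 : ℝ) 1, HasDerivWithinAt y (y' s) (Icc 0 1) s)
    (hw : ∀ s ∈ Icc (0 : ℝ) 1, HasDerivWithinAt w
      (-christoffel (metricInChart G c) (y s) (y' s) (w s)) (Icc 0 1) s) :
    IsParallelAlong G (fun s => (extChartAt I c).symm (y s))
      (fun s => chartVector I c (y s) (w s)) := by
  refine isParallelAlong_of_forall_exists hG (contMDiffOn_extChartAt_symm_comp hyc hy)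
    (fun s hs => rfl) fun s hs => ⟨c, (extChartAt I c).map_target (hy s hs), ?_⟩
  exact isParallelInChartAt_of_coord (y := y) (w := w) hs
    (fun s hs => (extChartAt I c).right_inv (hy s hs))
    (fun s hs => vectorInChart_chartVector (hy s hs) _) (hy' s hs) (hw s hs)

theorem exists_isParallelTransport_segment (hG : IsSmoothMetric G) {c : N} {y h : E}
    (hmem : ∀ t ∈ Icc (0 : ℝ) 1, y + t • h ∈ (extChartAt I c).target) {U V : ℝ → E →L[ℝ] E}
    (hU0 : U 0 = .id ℝ E)
    (hU : ∀ t ∈ Icc (0 : ℝ) 1, HasDerivWithinAt U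
      (-(christoffelMap (metricInChart G c) (y + t • h) h ∘L U t)) (Icc 0 1) t)
    (hVU : ∀ t ∈ Icc (0 : ℝ) 1, V t ∘L U t = .id ℝ E)
    (hUV : ∀ t ∈ Icc (0 : ℝ) 1, U t ∘L V t = .id ℝ E) {t : ℝ} (ht : t ∈ Icc (0 : ℝ) 1) :
    ∃ P, IsParallelTransport G ((extChartAt I c).symm y) ((extChartAt I c).symm (y + t • h)) P ∧
      ∀ v, tangentCoord I c _ (P v) = U t (tangentCoord I c _ v) := by
  let A : E ≃ₗ[ℝ] E := LinearEquiv.ofLinearMap (U t) (V t)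
    (by ext x; exact congrArg (fun A : E →L[ℝ] E => A x) (hUV t ht))
    (by ext x; exact congrArg (fun A : E →L[ℝ] E => A x) (hVU t ht))
  refine ⟨(tangentCoord I c ((extChartAt I c).symm y)).toLinearEquiv.trans (A.trans
    (tangentCoord I c ((extChartAt I c).symm (y + t • h))).symm.toLinearEquiv), ?_, fun v => ?_⟩
  · have hst : ∀ s ∈ Icc (0 : ℝ) 1, s * t ∈ Icc (0 : ℝ) 1 := fun s hs =>
      ⟨mul_nonneg hs.1 ht.1, mul_le_one₀ hs.2 ht.1 ht.2⟩
    have hyc : ContDiffOn ℝ 1 (fun s : ℝ => y + (s * t) • h) (Icc 0 1) := by fun_prop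
    have hmem' : ∀ s ∈ Icc (0 : ℝ) 1, y + (s * t) • h ∈ (extChartAt I c).target :=
      fun s hs => hmem _ (hst s hs)
    -- The segment from y to y + th is run through in unit time, so U(t) at every t, not only at the
    -- endpoint, is a parallel transport.
    refine .segment _ _ _ (fun s => (extChartAt I c).symm (y + (s * t) • h))
      (contMDiffOn_extChartAt_symm_comp hyc hmem') (by simp) (by simp) fun v => ?_
    set w := tangentCoord I c ((extChartAt I c).symm y) v with hw
    have hmul : ∀ s ∈ Icc (0 : ℝ) 1, HasDerivWithinAt (fun s : ℝ => s * t) t (Icc 0 1) s :=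
      fun s _ => by simpa using ((hasDerivAt_id s).mul_const t).hasDerivWithinAt
    have hy' : ∀ s ∈ Icc (0 : ℝ) 1,
        HasDerivWithinAt (fun s : ℝ => y + (s * t) • h) (t • h) (Icc 0 1) s :=
      fun s hs => ((hmul s hs).smul_const h).const_add y
    have hw' : ∀ s ∈ Icc (0 : ℝ) 1, HasDerivWithinAt (fun s => U (s * t) w)
        (-christoffel (metricInChart G c) (y + (s * t) • h) (t • h) (U (s * t) w)) (Icc 0 1) s := by
      intro s hs
      have h1 := HasDerivWithinAt.scomp (h := fun s : ℝ => s * t) s (hU (s * t) (hst s hs))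
        (hmul s hs) hst
      refine (h1.clm_apply (hasDerivWithinAt_const s (Icc 0 1) w)).congr_deriv ?_
      rw [← christoffelMap_apply]
      simp
    have hpar := isParallelAlong_chartVector hG (y := fun s => y + (s * t) • h)
      (y' := fun _ => t • h) (w := fun s => U (s * t) w) hyc hmem' hy' hw'
    refine ⟨_, hpar, ?_, ?_⟩
    · rw [zero_mul, hU0, zero_smul, add_zero, hw]
      exact chartVector_tangentCoord v
    · rw [one_mul]
      rfl
  · exact ContinuousLinearEquiv.apply_symm_apply _ _

/-- Being joined by a transport is transitive and holds in both directions between nearby points, so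
it holds throughout a connected manifold. -/
theorem exists_isParallelTransport [FiniteDimensional ℝ E] [PreconnectedSpace N]
    (hG : IsSmoothMetric G) (p q : N) : ∃ P, IsParallelTransport G p q P := by
  refine PreconnectedSpace.induction₂' (fun p q => ∃ P, IsParallelTransport G p q P) (fun x => ?_)
    ⟨fun _ _ _ ⟨P, hP⟩ ⟨Q, hQ⟩ => ⟨_, hP.concat _ _ _ _ _ hQ⟩⟩ p q
  have hx := mem_extChartAt_source (I := I) x
  obtain ⟨ρ, hρ, hsub, C, -, hC, hCρ, -⟩ := (hG x).exists_ball ((extChartAt I x).map_source hx)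
  filter_upwards [extChartAt_source_mem_nhds (I := I) x,
    (continuousAt_extChartAt (I := I) x).preimage_mem_nhds (ball_mem_nhds _ hρ)] with z hz hz'
  have hz'' : extChartAt I x x + (extChartAt I x z - extChartAt I x x) ∈ ball (extChartAt I x x) ρ := by
    simpa using hz'
  obtain ⟨U, V, hU0, -, hU, -, hVU, hUV⟩ := (hG x).exists_fundamentalSolution hsub hC hCρ
    (mem_ball_self hρ) hz''
  obtain ⟨P, hP, -⟩ := exists_isParallelTransport_segment hG
    (fun t ht => hsub (segment_mem_ball (mem_ball_self hρ) hz'' ht)) hU0 hU hVU hUV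
    (right_mem_Icc.2 zero_le_one)
  have h1 : ∃ P, IsParallelTransport G x z P := by
    rw [one_smul, add_sub_cancel, (extChartAt I x).left_inv hx, (extChartAt I x).left_inv hz] at hP
    exact ⟨P, hP⟩
  exact ⟨h1, h1.imp' _ fun _ h => h.symm⟩

end Transport

/-! ### Fields invariant under parallel transport and fields with vanishing covariant derivative. -/

section ParallelFields

open Filter Topology Metric

variable {E : Type*} [NormedAddCommGroup E] [NormedSpace ℝ E] [FiniteDimensional ℝ E]
  {H : Type*} [TopologicalSpace H] {I : ModelWithCorners ℝ E H} [I.Boundaryless]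
  {N : Type*} [TopologicalSpace N] [ChartedSpace H N] [IsManifold I ∞ N]
  {G : FormField I N}

/-- The expression of a vector field in the chart around `c`. -/
def vecCoord (c : N) (s : ∀ x : N, TangentSpace I x) (y : E) : E :=
  tangentCoord I c _ (s ((extChartAt I c).symm y))

/-- The expression of a field of endomorphisms in the chart around `c`. -/
def endCoord (c : N) (A : ∀ x : N, TangentSpace I x →ₗ[ℝ] TangentSpace I x) (y : E) : E →L[ℝ] E :=
  LinearMap.toContinuousLinearMap
    ((tangentCoord I c ((extChartAt I c).symm y)).toLinearMap ∘ₗ A ((extChartAt I c).symm y)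
      ∘ₗ (tangentCoord I c ((extChartAt I c).symm y)).symm.toLinearMap)

theorem endCoord_tangentCoord (c : N) (A : ∀ x : N, TangentSpace I x →ₗ[ℝ] TangentSpace I x) (y : E)
    (v : TangentSpace I ((extChartAt I c).symm y)) :
    endCoord c A y (tangentCoord I c _ v) = tangentCoord I c _ (A _ v) := by
  change tangentCoord I c _ (A _ ((tangentCoord I c _).symm (tangentCoord I c _ v))) = _
  rw [ContinuousLinearEquiv.symm_apply_apply]

/-- The vector field `s` is preserved by parallel transport. -/
def IsInvariantField (G : FormField I N) (s : ∀ x : N, TangentSpace I x) : Prop :=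
  ∀ p q P, IsParallelTransport G p q P → P (s p) = s q

/-- The field of endomorphisms `A` is preserved by parallel transport. -/
def IsInvariantEndField (G : FormField I N)
    (A : ∀ x : N, TangentSpace I x →ₗ[ℝ] TangentSpace I x) : Prop :=
  ∀ p q P, IsParallelTransport G p q P → ∀ v, P (A p v) = A q (P v)

/-- Around every point of a chart, short segments carry a parallel transport which is given by the
solutions `U` of a linear differential equation, with inverses `V`. -/
theorem exists_ball_transport (hG : IsSmoothMetric G) (c : N) {y₀ : E}
    (hy₀ : y₀ ∈ (extChartAt I c).target) :
    ∃ ρ > 0, ball y₀ ρ ⊆ (extChartAt I c).target ∧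
      ∃ C, (∀ y ∈ ball y₀ ρ, ‖christoffelMap (metricInChart G c) y‖ ≤ C) ∧
      ∀ y h, y ∈ ball y₀ ρ → y + h ∈ ball y₀ ρ → ∃ U V : ℝ → E →L[ℝ] E,
        U 0 = .id ℝ E ∧ V 0 = .id ℝ E ∧
        (∀ t ∈ Icc (0 : ℝ) 1, HasDerivWithinAt U
          (-(christoffelMap (metricInChart G c) (y + t • h) h ∘L U t)) (Icc 0 1) t) ∧
        (∀ t ∈ Icc (0 : ℝ) 1, HasDerivWithinAt V
          (V t ∘L christoffelMap (metricInChart G c) (y + t • h) h) (Icc 0 1) t) ∧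
        (∀ t ∈ Icc (0 : ℝ) 1, V t ∘L U t = .id ℝ E) ∧
        (∀ t ∈ Icc (0 : ℝ) 1, U t ∘L V t = .id ℝ E) ∧
        ∀ t ∈ Icc (0 : ℝ) 1, ∃ P,
          IsParallelTransport G ((extChartAt I c).symm y) ((extChartAt I c).symm (y + t • h)) P ∧
          ∀ v, tangentCoord I c _ (P v) = U t (tangentCoord I c _ v) := by
  obtain ⟨ρ, hρ, hsub, C, -, hC, hCρ, -⟩ := (hG c).exists_ball hy₀
  refine ⟨ρ, hρ, hsub, C, hC, fun y h hy hyh => ?_⟩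
  obtain ⟨U, V, hU0, hV0, hU, hV, hVU, hUV⟩ := (hG c).exists_fundamentalSolution hsub hC hCρ hy hyh
  exact ⟨U, V, hU0, hV0, hU, hV, hVU, hUV, fun t ht => exists_isParallelTransport_segment hG
    (fun t ht => hsub (segment_mem_ball hy hyh ht)) hU0 hU hVU hUV ht⟩

theorem vecCoord_eq_of_transport {s : ∀ x : N, TangentSpace I x} (hs : IsInvariantField G s) {c : N}
    {y z : E} {A : E →L[ℝ] E}
    (hP : ∃ P, IsParallelTransport G ((extChartAt I c).symm y) ((extChartAt I c).symm z) P ∧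
      ∀ v, tangentCoord I c _ (P v) = A (tangentCoord I c _ v)) :
    vecCoord c s z = A (vecCoord c s y) := by
  obtain ⟨P, hP, hPA⟩ := hP
  rw [vecCoord, vecCoord, ← hPA, hs _ _ _ hP]

theorem endCoord_comp_of_transport {A : ∀ x : N, TangentSpace I x →ₗ[ℝ] TangentSpace I x}
    (hA : IsInvariantEndField G A) {c : N} {y z : E} {U : E →L[ℝ] E}
    (hP : ∃ P, IsParallelTransport G ((extChartAt I c).symm y) ((extChartAt I c).symm z) P ∧
      ∀ v, tangentCoord I c _ (P v) = U (tangentCoord I c _ v)) (w : E) :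
    endCoord c A z (U w) = U (endCoord c A y w) := by
  obtain ⟨P, hP, hPU⟩ := hP
  obtain ⟨v, rfl⟩ := (tangentCoord I c ((extChartAt I c).symm y)).surjective w
  rw [← hPU, endCoord_tangentCoord, endCoord_tangentCoord, ← hPU, hA _ _ _ hP]

/-- No regularity of `s` is assumed. Along each short segment its coordinates are U(t) applied to a
constant, hence solve the transport equation, and `hasFDerivAt_of_forall_segment` yields
differentiability. -/
theorem IsInvariantField.isParallelVectorAt (hG : IsSmoothMetric G)
    {s : ∀ x : N, TangentSpace I x} (hs : IsInvariantField G s) (c : N) {y : E}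
    (hy : y ∈ (extChartAt I c).target) :
    IsParallelVectorAt (metricInChart G c) (vecCoord c s) y := by
  have := FiniteDimensional.complete ℝ E
  obtain ⟨ρ, hρ, hsub, C, hC, hseg⟩ := exists_ball_transport hG c hy
  refine hasFDerivAt_of_forall_segment (y₀ := y) (ρ := ρ) (C := C)
    (a := fun y => -christoffelMap (metricInChart G c) y)
    ((hG c).contDiffOn_christoffelMap.continuousOn.mono hsub).neg
    (fun z hz => by rw [norm_neg]; exact hC z hz) (fun z h hz hzh t ht => ?_) (mem_ball_self hρ)
  obtain ⟨U, V, hU0, hV0, hU, hV, hVU, hUV, hP⟩ := hseg z h hz hzh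
  have h1 : ∀ t ∈ Icc (0 : ℝ) 1, vecCoord c s (z + t • h) = U t (vecCoord c s z) := fun t ht =>
    vecCoord_eq_of_transport hs (hP t ht)
  have h2 := ((hU t ht).clm_apply (hasDerivWithinAt_const t (Icc 0 1) (vecCoord c s z))).congr
    h1 (h1 t ht)
  refine h2.congr_deriv ?_
  rw [h1 t ht]
  simp

/-- Along a short segment the coordinates of the field are U(t) A V(t) with A constant, and
differentiating this product gives the commutator with the Christoffel symbols. -/
theorem IsInvariantEndField.isParallelEndAt (hG : IsSmoothMetric G)
    {A : ∀ x : N, TangentSpace I x →ₗ[ℝ] TangentSpace I x} (hA : IsInvariantEndField G A) (c : N)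
    {y : E} (hy : y ∈ (extChartAt I c).target) :
    IsParallelEndAt (metricInChart G c) (endCoord c A) y := by
  have := FiniteDimensional.complete ℝ E
  obtain ⟨ρ, hρ, hsub, C, hC, hseg⟩ := exists_ball_transport hG c hy
  refine hasFDerivAt_of_forall_segment (y₀ := y) (ρ := ρ) (C := ‖commutatorAction E‖ * C)
    (a := fun y => -(commutatorAction E ∘L christoffelMap (metricInChart G c) y))
    (continuousOn_const.clm_comp ((hG c).contDiffOn_christoffelMap.continuousOn.mono hsub)).neg
    (fun z hz => ?_) (fun z h hz hzh t ht => ?_) (mem_ball_self hρ)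
  · rw [norm_neg]
    exact (ContinuousLinearMap.opNorm_comp_le _ _).trans (by gcongr; exact hC z hz)
  obtain ⟨U, V, hU0, hV0, hU, hV, hVU, hUV, hP⟩ := hseg z h hz hzh
  have h1 : ∀ t ∈ Icc (0 : ℝ) 1, endCoord c A (z + t • h) = U t ∘L endCoord c A z ∘L V t := by
    intro t ht
    ext w
    have h3 : w = U t (V t w) := (congrArg (fun B : E →L[ℝ] E => B w) (hUV t ht)).symm
    rw [ContinuousLinearMap.comp_apply, ContinuousLinearMap.comp_apply,
      ← endCoord_comp_of_transport hA (hP t ht), ← h3]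
  have h2 := ((hU t ht).clm_comp ((hasDerivWithinAt_const t (Icc 0 1) (endCoord c A z)).clm_comp
    (hV t ht))).congr h1 (h1 t ht)
  refine h2.congr_deriv ?_
  rw [h1 t ht]
  ext w
  simp [commutatorAction_apply]
  abel

/-! ### Parallel sections -/

/-- The vector field `s` is parallel at `x`. -/
def IsParallelSectionAt (G : FormField I N) (s : ∀ x : N, TangentSpace I x) (x : N) : Prop :=
  ∃ c, x ∈ (extChartAt I c).source ∧
    IsParallelVectorAt (metricInChart G c) (vecCoord c s) (extChartAt I c x)

theorem IsParallelSectionAt.congr {s s' : ∀ x : N, TangentSpace I x} {x : N}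
    (h : IsParallelSectionAt G s x) (hs : ∀ᶠ z in 𝓝 x, s' z = s z) :
    IsParallelSectionAt G s' x := by
  obtain ⟨c, hc, h⟩ := h
  have h1 : vecCoord c s' =ᶠ[𝓝 (extChartAt I c x)] vecCoord c s := by
    have h2 := (continuousAt_extChartAt_symm' (I := I) hc)
    rw [ContinuousAt, (extChartAt I c).left_inv hc] at h2
    filter_upwards [h2.eventually hs] with y hy
    rw [vecCoord, vecCoord, hy]
  refine ⟨c, hc, ?_⟩
  rw [IsParallelVectorAt, h1.self_of_nhds]
  exact HasFDerivAt.congr_of_eventuallyEq h h1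

theorem IsParallelSectionAt.exists_isParallelInChartAt {s : ∀ x : N, TangentSpace I x} {γ : ℝ → N}
    (hγ : ContMDiffOn 𝓘(ℝ, ℝ) I 1 γ (Icc 0 1)) {t : ℝ} (ht : t ∈ Icc (0 : ℝ) 1)
    (h : IsParallelSectionAt G s (γ t)) : ∃ c, γ t ∈ (extChartAt I c).source ∧
      IsParallelInChartAt G γ (fun t => ⟨γ t, s (γ t)⟩) c t := by
  obtain ⟨c, hc, h⟩ := h
  refine ⟨c, hc, ?_⟩
  have h1 : ∀ᶠ t in 𝓝[Icc 0 1] t, vectorInChart c (⟨γ t, s (γ t)⟩ : TangentBundle I N)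
      = vecCoord c s (extChartAt I c (γ t)) := by
    filter_upwards [(hγ t ht).continuousWithinAt.eventually_mem (extChartAt_source_mem_nhds' hc)]
      with r hr
    rw [vectorInChart_mk hr, vecCoord, (extChartAt I c).left_inv hr]
  have hd := (differentiableWithinAt_extChartAt_comp hγ ht hc).hasDerivWithinAt
  have h2 := (HasFDerivAt.comp_hasDerivWithinAt (f := fun t => extChartAt I c (γ t)) t h hd).congr_of_eventuallyEq h1
    (h1.self_of_nhdsWithin ht)
  refine HasDerivWithinAt.congr_deriv h2 ?_
  rw [h1.self_of_nhdsWithin ht]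
  rfl

theorem isParallelAlong_section (hG : IsSmoothMetric G) {s : ∀ x : N, TangentSpace I x} {γ : ℝ → N}
    (hγ : ContMDiffOn 𝓘(ℝ, ℝ) I 1 γ (Icc 0 1))
    (h : ∀ t ∈ Icc (0 : ℝ) 1, IsParallelSectionAt G s (γ t)) :
    IsParallelAlong G γ (fun t => ⟨γ t, s (γ t)⟩) :=
  isParallelAlong_of_forall_exists hG hγ (fun _ _ => rfl)
    fun t ht => (h t ht).exists_isParallelInChartAt hγ ht

/-- Restricted to a curve, a parallel field solves the transport equation, so by uniqueness it
coincides with the transport of its initial value. -/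
theorem isInvariantField_of_isParallelSectionAt (hG : IsSmoothMetric G)
    {s : ∀ x : N, TangentSpace I x} (hs : ∀ x, IsParallelSectionAt G s x) :
    IsInvariantField G s := by
  have := FiniteDimensional.complete ℝ E
  intro p q P hP
  induction hP with
  | segment p q P γ hγ h0 h1 hP =>
    obtain ⟨X, hX, hX0, hX1⟩ := hP (s p)
    subst h0 h1
    have h2 := hX.eq_of_eq hG hγ (isParallelAlong_section hG hγ fun t _ => hs (γ t))
      (left_mem_Icc.2 zero_le_one) (right_mem_Icc.2 zero_le_one) hX0
    rw [hX1] at h2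
    simpa using h2
  | concat p q r P Q _ _ hP hQ => rw [LinearEquiv.trans_apply, hP, hQ]

/-- The neighbourhood does not depend on the two fields. This uniformity is what makes transition
maps locally constant for all fibre values at once. -/
theorem IsParallelSectionAt.eventually_eq (hG : IsSmoothMetric G)
    {x : N} {S : Set N} (hS : S ∈ 𝓝 x) :
    ∀ᶠ z in 𝓝 x, ∀ s s' : ∀ x : N, TangentSpace I x, (∀ z ∈ S, IsParallelSectionAt G s z) →
      (∀ z ∈ S, IsParallelSectionAt G s' z) → s x = s' x → s z = s' z := by
  have := FiniteDimensional.complete ℝ E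
  have hxs := mem_extChartAt_source (I := I) x
  have h1 : ∀ᶠ y in 𝓝 (extChartAt I x x), y ∈ (extChartAt I x).target ∧
      (extChartAt I x).symm y ∈ S := by
    have h2 := (continuousAt_extChartAt_symm' (I := I) hxs)
    rw [ContinuousAt, (extChartAt I x).left_inv hxs] at h2
    exact ((isOpen_extChartAt_target x).eventually_mem ((extChartAt I x).map_source hxs)).and
      (h2.eventually_mem hS)
  obtain ⟨ρ, hρ, hball⟩ := Metric.eventually_nhds_iff_ball.1 h1
  filter_upwards [extChartAt_source_mem_nhds (I := I) x,
    (continuousAt_extChartAt (I := I) x).preimage_mem_nhds (ball_mem_nhds _ hρ)] with z hz hz' s s' hs hs' hx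
  set y₀ := extChartAt I x x
  set h := extChartAt I x z - y₀ with hh
  have hz'' : y₀ + h ∈ ball y₀ ρ := by simpa [hh] using hz'
  have hmem : ∀ t ∈ Icc (0 : ℝ) 1, y₀ + t • h ∈ ball y₀ ρ := fun t ht =>
    segment_mem_ball (mem_ball_self hρ) hz'' ht
  have hγ : ContMDiffOn 𝓘(ℝ, ℝ) I 1 (fun t : ℝ => (extChartAt I x).symm (y₀ + t • h)) (Icc 0 1) :=
    contMDiffOn_extChartAt_symm_comp (by fun_prop) fun t ht => (hball _ (hmem t ht)).1
  have h3 := (isParallelAlong_section hG hγ fun t ht => hs _ (hball _ (hmem t ht)).2).eq_of_eq hG hγ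
    (isParallelAlong_section hG hγ fun t ht => hs' _ (hball _ (hmem t ht)).2)
    (left_mem_Icc.2 zero_le_one) (right_mem_Icc.2 zero_le_one) (by
      have h0 : (extChartAt I x).symm (y₀ + (0 : ℝ) • h) = x := by
        rw [zero_smul, add_zero, (extChartAt I x).left_inv hxs]
      rw [h0, hx])
  have h4 : (extChartAt I x).symm (y₀ + (1 : ℝ) • h) = z := by
    rw [one_smul, hh, add_sub_cancel, (extChartAt I x).left_inv hz]
  rw [h4] at h3
  simpa using h3

end ParallelFields

/-! ### From vanishing curvature on a parallel subbundle to global parallel fields. -/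

section Flat

open Filter Topology Metric

variable {E : Type*} [NormedAddCommGroup E] [NormedSpace ℝ E] [FiniteDimensional ℝ E]
  {H : Type*} [TopologicalSpace H] {I : ModelWithCorners ℝ E H} [I.Boundaryless]
  {N : Type*} [TopologicalSpace N] [ChartedSpace H N] [IsManifold I ∞ N]
  {G : FormField I N}

/-- The curvature of `G` vanishes on the range of the field of endomorphisms `A`. -/
def IsFlatOnRange (G : FormField I N) (A : ∀ x : N, TangentSpace I x →ₗ[ℝ] TangentSpace I x) :
    Prop :=
  ∀ c : N, ∀ y ∈ (extChartAt I c).target, ∀ u v w : E,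
    localCurvature (metricInChart G c) y u v (endCoord c A y w) = 0

/-- If the curvature vanishes on the range of an invariant field `A` of endomorphisms, then the
vectors in this range extend locally to parallel vector fields, by radial parallel transport. -/
theorem exists_local_parallel_extension (hG : IsSmoothMetric G)
    {A : ∀ x : N, TangentSpace I x →ₗ[ℝ] TangentSpace I x} (hA : IsInvariantEndField G A)
    (hflat : IsFlatOnRange G A) (b : N) :
    ∃ O : Set N, IsOpen O ∧ b ∈ O ∧ ∃ P : ∀ x : N, TangentSpace I b ≃ₗ[ℝ] TangentSpace I x,
      (∀ x ∈ O, IsParallelTransport G b x (P x)) ∧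
      ∀ v, ∀ x ∈ O, IsParallelSectionAt G (fun x => P x (A b v)) x := by
  classical
  have := FiniteDimensional.complete ℝ E
  have hb := mem_extChartAt_source (I := I) b
  set y₀ := extChartAt I b b with hy₀
  obtain ⟨ρ, hρ, hsub, C, K, hC, hCρ, hC', hK⟩ := (hG b).exists_ball ((extChartAt I b).map_source hb)
  have hball₀ : y₀ ∈ ball y₀ ρ := mem_ball_self hρ
  have hex : ∀ y ∈ ball y₀ ρ, ∃ U : ℝ → E →L[ℝ] E, U 0 = .id ℝ E ∧
      (∀ t ∈ Icc (0 : ℝ) 1, HasDerivWithinAt U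
        (-(christoffelMap (metricInChart G b) (y₀ + t • (y - y₀)) (y - y₀) ∘L U t)) (Icc 0 1) t) ∧
      ∀ t ∈ Icc (0 : ℝ) 1, ∃ P, IsParallelTransport G ((extChartAt I b).symm y₀)
        ((extChartAt I b).symm (y₀ + t • (y - y₀))) P ∧
        ∀ v, tangentCoord I b _ (P v) = U t (tangentCoord I b _ v) := by
    intro y hy
    have hy' : y₀ + (y - y₀) ∈ ball y₀ ρ := by simpa using hy
    obtain ⟨U, V, hU0, hV0, hU, hV, hVU, hUV⟩ :=
      (hG b).exists_fundamentalSolution hsub hC hCρ hball₀ hy'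
    exact ⟨U, hU0, hU, fun t ht => exists_isParallelTransport_segment hG
      (fun t ht => hsub (segment_mem_ball hball₀ hy' ht)) hU0 hU hVU hUV ht⟩
  choose! U hU0 hU hUP using hex
  set O : Set N := (extChartAt I b).source ∩ extChartAt I b ⁻¹' ball y₀ ρ with hO
  have hOb : ∀ x ∈ O, ∃ P : TangentSpace I b ≃ₗ[ℝ] TangentSpace I x, IsParallelTransport G b x P ∧
      ∀ v, tangentCoord I b x (P v) = U (extChartAt I b x) 1 (tangentCoord I b b v) := by
    intro x hx
    have h1 := hUP _ hx.2 1 (by simp)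
    -- The endpoints are generalized because the tangent spaces depend on them: the chart identities
    -- can then be substituted.
    have key : ∀ b' x', (extChartAt I b).symm y₀ = b' →
        (extChartAt I b).symm (y₀ + (1 : ℝ) • (extChartAt I b x - y₀)) = x' →
        ∃ P : TangentSpace I b' ≃ₗ[ℝ] TangentSpace I x', IsParallelTransport G b' x' P ∧
          ∀ v, tangentCoord I b x' (P v) = U (extChartAt I b x) 1 (tangentCoord I b b' v) := by
      rintro _ _ rfl rfl
      exact h1
    exact key b x ((extChartAt I b).left_inv hb)
      (by rw [one_smul, add_sub_cancel, (extChartAt I b).left_inv hx.1])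
  have hne : ∀ x : N, Nonempty (TangentSpace I b ≃ₗ[ℝ] TangentSpace I x) := fun x =>
    ⟨((tangentCoord I b b).trans (tangentCoord I b x).symm).toLinearEquiv⟩
  choose! P hP hPU using hOb
  refine ⟨O, (continuousOn_extChartAt b).isOpen_inter_preimage (isOpen_extChartAt_source b)
    isOpen_ball, ⟨hb, hball₀⟩, P, hP, fun v x hx => ⟨b, hx.1, ?_⟩⟩
  set w := tangentCoord I b b (A b v) with hw
  have hvec : ∀ y ∈ ball y₀ ρ, vecCoord b (fun x => P x (A b v)) y = U y 1 w := by
    intro y hy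
    have hyT := hsub hy
    have hyO : (extChartAt I b).symm y ∈ O := ⟨(extChartAt I b).map_target hyT, by
      rw [mem_preimage, (extChartAt I b).right_inv hyT]; exact hy⟩
    rw [vecCoord, hPU _ hyO, (extChartAt I b).right_inv hyT]
  obtain ⟨w', hw'⟩ : ∃ w', w = endCoord b A y₀ w' := by
    refine ⟨tangentCoord I b b v, ?_⟩
    have key : ∀ b' (_ : (extChartAt I b).symm y₀ = b') (v : TangentSpace I b'),
        tangentCoord I b b' (A b' v) = endCoord b A y₀ (tangentCoord I b b' v) := by
      rintro _ rfl v
      rw [endCoord_tangentCoord]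
    exact key b ((extChartAt I b).left_inv hb) v
  have hF := hasFDerivAt_radial (a := fun y => -christoffelMap (metricInChart G b) y)
    (a' := fun y => -fderiv ℝ (christoffelMap (metricInChart G b)) y) (X := fun y t => U y t w)
    (x₀ := w) (y₀ := y₀) (ρ := ρ) (C := C) (K := K)
    (fun y hy => ((hG b).hasFDerivAt_christoffelMap (hsub hy)).neg)
    (fun y hy => by rw [norm_neg]; exact hC y hy) (fun y hy => by rw [norm_neg]; exact hC' y hy)
    (fun y hy z hz => by rw [neg_sub_neg, norm_sub_rev]; exact hK y hy z hz)
    (fun y hy => by simp [hU0 y hy])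
    (fun y hy t ht => by
      refine ((hU y hy t ht).clm_apply (hasDerivWithinAt_const t (Icc 0 1) w)).congr_deriv ?_
      simp)
    (fun y hy t ht p q => by
      have hz : y₀ + t • (y - y₀) ∈ (extChartAt I b).target :=
        hsub (segment_mem_ball hball₀ (by simpa using hy) ht)
      -- Transport commutes with `A`, so the radial solution stays in the range of `A`, where the
      -- curvature is assumed to vanish. This is the flatness condition of `hasFDerivAt_radial`.
      have h1 : U y t w = endCoord b A (y₀ + t • (y - y₀)) (U y t w') := by
        rw [endCoord_comp_of_transport hA (hUP y hy t ht), ← hw']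
      have h2 := hflat b _ hz p q (U y t w')
      rw [← h1, (hG b).localCurvature_eq hz] at h2
      simp only [neg_apply, map_neg, neg_neg]
      rw [← sub_eq_zero] at h2 ⊢
      rw [← neg_eq_zero, ← h2]
      abel) hx.2
  rw [IsParallelVectorAt, hvec _ hx.2]
  refine HasFDerivAt.congr_of_eventuallyEq hF ?_
  filter_upwards [isOpen_ball.mem_nhds hx.2] with y hy using hvec y hy

theorem IsInvariantEndField.mem_range_iff
    {A : ∀ x : N, TangentSpace I x →ₗ[ℝ] TangentSpace I x} (hA : IsInvariantEndField G A) {p q : N}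
    {P : TangentSpace I p ≃ₗ[ℝ] TangentSpace I q} (hP : IsParallelTransport G p q P)
    (v : TangentSpace I p) : v ∈ LinearMap.range (A p) ↔ P v ∈ LinearMap.range (A q) := by
  constructor
  · rintro ⟨u, rfl⟩
    exact ⟨P u, (hA _ _ _ hP u).symm⟩
  · rintro ⟨u, hu⟩
    refine ⟨P.symm u, P.injective ?_⟩
    rw [hA _ _ _ hP, LinearEquiv.apply_symm_apply, hu]

/-- On a simply connected manifold, vectors in the range of an invariant field of endomorphisms on
which the curvature vanishes extend to invariant vector fields. -/
theorem exists_isInvariantField_of_isFlatOnRange [SimplyConnectedSpace N]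
    [LocallyPathConnectedSpace N] (hG : IsSmoothMetric G)
    {A : ∀ x : N, TangentSpace I x →ₗ[ℝ] TangentSpace I x} (hA : IsInvariantEndField G A)
    (hflat : IsFlatOnRange G A) (p : N) (v : TangentSpace I p) :
    ∃ s, IsInvariantField G s ∧ s p = A p v := by
  classical
  have hconn : PreconnectedSpace N := inferInstance
  choose O hO hbO P hP hPs using exists_local_parallel_extension hG hA hflat
  choose Q hQ using exists_isParallelTransport (I := I) (N := N) hG
  -- Outside `O b` the radial transport is replaced by an arbitrary one, since the monodromy lemma
  -- asks for a bijection at every point.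
  let P' : ∀ b x : N, TangentSpace I b ≃ₗ[ℝ] TangentSpace I x := fun b x =>
    if x ∈ O b then P b x else Q b x
  have hP' : ∀ b x, IsParallelTransport G b x (P' b x) := by
    intro b x
    by_cases hx : x ∈ O b
    · simpa [P', hx] using hP b x hx
    · simpa [P', hx] using hQ b x
  have hP's : ∀ b v, ∀ x ∈ O b, IsParallelSectionAt G (fun x => P' b x (A b v)) x := by
    intro b v x hx
    refine (hPs b v x hx).congr ?_
    filter_upwards [(hO b).mem_nhds hx] with z hz
    simp [P', hz]
  -- The common fibre is the range of `A p`, carried to `b` by a fixed transport and from there to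
  -- `x` by `P'`. Each image of a fixed vector is a parallel field on `O b`.
  let e : ∀ b x : N, LinearMap.range (A p) ≃ LinearMap.range (A x) := fun b x =>
    ((Q p b).toEquiv.subtypeEquiv fun v => hA.mem_range_iff (hQ p b) v).trans
      ((P' b x).toEquiv.subtypeEquiv fun v => hA.mem_range_iff (hP' b x) v)
  have he : ∀ b x v, ((e b x v : LinearMap.range (A x)) : TangentSpace I x)
      = P' b x (Q p b v) := fun b x v => rfl
  have hes : ∀ b v, ∀ x ∈ O b,
      IsParallelSectionAt G (fun x => (e b x v : TangentSpace I x)) x := by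
    intro b v x hx
    obtain ⟨u, hu⟩ := (hA.mem_range_iff (hQ p b) v).1 v.2
    have := hP's b u x hx
    rw [hu] at this
    exact this
  have hloc : ∀ b c x, x ∈ O b → x ∈ O c →
      ∀ᶠ y in 𝓝 x, ∀ v, (e c y).symm (e b y v) = (e c x).symm (e b x v) := by
    intro b c x hxb hxc
    filter_upwards [IsParallelSectionAt.eventually_eq hG
      (((hO b).inter (hO c)).mem_nhds ⟨hxb, hxc⟩)] with y hy v
    rw [Equiv.symm_apply_eq]
    exact Subtype.ext (hy (fun y => (e b y v : TangentSpace I y))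
      (fun y => (e c y ((e c x).symm (e b x v)) : TangentSpace I y))
      (fun z hz => hes b v z hz.1) (fun z hz => hes c _ z hz.2) (by simp))
  obtain ⟨σ, hσp, hσ⟩ := exists_locallyConstant_section hO hbO e hloc p ⟨A p v, v, rfl⟩
  refine ⟨fun x => σ x, isInvariantField_of_isParallelSectionAt hG fun x => ?_,
    congrArg Subtype.val hσp⟩
  refine (hes x ((e x x).symm (σ x)) x (hbO x)).congr ?_
  filter_upwards [hσ x x (hbO x)] with z hz
  rw [hz]

end Flat

/-! ### Two tools: skew endomorphisms, and derivatives of curves in a subspace. -/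

section Algebra

variable {E : Type*} [AddCommGroup E] [Module ℝ E] [FiniteDimensional ℝ E]

/-- A skew endomorphism of a nondegenerate space which vanishes on a hyperplane is zero. -/
theorem eq_zero_of_skew_of_finrank_le {b : E → E → ℝ} (hadd : ∀ x y z, b x (y + z) = b x y + b x z)
    (hsmul : ∀ x (c : ℝ) y, b x (c • y) = c * b x y) (hsymm : ∀ x y, b x y = b y x)
    {R : E →ₗ[ℝ] E} (hR : ∀ x y, b (R x) y + b x (R y) = 0) {D K : Submodule ℝ E}
    (hD : ∀ x ∈ D, (∀ y ∈ D, b x y = 0) → x = 0) (hRD : ∀ x ∈ D, R x ∈ D) (hKD : K ≤ D)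
    (hfin : Module.finrank ℝ D ≤ Module.finrank ℝ K + 1) (hRK : ∀ x ∈ K, R x = 0) :
    ∀ x ∈ D, R x = 0 := by
  intro e he
  by_cases heK : e ∈ K
  · exact hRK e heK
  have hlt : K < K ⊔ ℝ ∙ e := by
    refine lt_of_le_of_ne le_sup_left fun h => heK ?_
    rw [h]
    exact Submodule.mem_sup_right (Submodule.mem_span_singleton_self e)
  have hle : K ⊔ ℝ ∙ e ≤ D := sup_le hKD ((Submodule.span_singleton_le_iff_mem _ _).2 he)
  have heq : K ⊔ ℝ ∙ e = D := by
    apply Submodule.eq_of_le_of_finrank_le hle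
    have := Submodule.finrank_lt_finrank_of_lt hlt
    omega
  -- Skewness makes R e orthogonal to `K`, as R kills `K`, and to `e` itself, as b(Re, e) = 0. These
  -- span `D`, which is nondegenerate.
  refine hD _ (hRD e he) fun y hy => ?_
  rw [← heq] at hy
  obtain ⟨k, hk, z, hz, rfl⟩ := Submodule.mem_sup.1 hy
  obtain ⟨c, rfl⟩ := Submodule.mem_span_singleton.1 hz
  have h1 : b (R e) k = 0 := by
    have h2 := hR e k
    have h3 : b e (R k) = 0 := by
      rw [hRK k hk]
      have := hsmul e 0 0
      simpa using this
    linarith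
  have h4 : b (R e) e = 0 := by
    have h2 := hR e e
    rw [hsymm e] at h2
    linarith
  rw [hadd, hsmul, h1, h4]
  simp

end Algebra

section HasDeriv

theorem HasDerivWithinAt.mem_submodule {E : Type*} [NormedAddCommGroup E] [NormedSpace ℝ E]
    [FiniteDimensional ℝ E] {f : ℝ → E} {f' : E} {S : Submodule ℝ E}
    (hf : HasDerivWithinAt f f' (Icc 0 1) 0) (hS : ∀ t ∈ Icc (0 : ℝ) 1, f t ∈ S) : f' ∈ S := by
  have h1 := (hasDerivWithinAt_iff_tendsto_slope' (by simp)).1 (hf.mono Ioc_subset_Icc_self)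
  have := left_nhdsWithin_Ioc_neBot (zero_lt_one' ℝ)
  refine S.closed_of_finiteDimensional.mem_of_tendsto h1 ?_
  filter_upwards [self_mem_nhdsWithin] with t ht
  rw [slope_def_module]
  exact S.smul_mem _ (S.sub_mem (hS t (Ioc_subset_Icc_self ht)) (hS 0 (by simp)))

end HasDeriv

/-! ### Fields spread from p by parallel transport, and the curvature of a block. -/

section Blocks

open Filter Topology Metric

variable {E : Type*} [NormedAddCommGroup E] [NormedSpace ℝ E] [FiniteDimensional ℝ E]
  {H : Type*} [TopologicalSpace H] {I : ModelWithCorners ℝ E H} [I.Boundaryless]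
  {N : Type*} [TopologicalSpace N] [ChartedSpace H N] [IsManifold I ∞ N]
  {G : FormField I N}

section TransportFrom

variable [PreconnectedSpace N]

/-- A parallel transport from `p` to `q`. -/
def transportFrom (hG : IsSmoothMetric G) (p q : N) : TangentSpace I p ≃ₗ[ℝ] TangentSpace I q :=
  (exists_isParallelTransport hG p q).choose

theorem isParallelTransport_transportFrom (hG : IsSmoothMetric G) (p q : N) :
    IsParallelTransport G p q (transportFrom hG p q) :=
  (exists_isParallelTransport hG p q).choose_spec

theorem mem_holonomyGroup_of_transport (hG : IsSmoothMetric G) {p q q' : N}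
    {P : TangentSpace I q ≃ₗ[ℝ] TangentSpace I q'} (hP : IsParallelTransport G q q' P) :
    ((transportFrom hG p q).trans P).trans (transportFrom hG p q').symm ∈ holonomyGroup G p :=
  ((isParallelTransport_transportFrom hG p q).concat _ _ _ _ _ hP).concat _ _ _ _ _
    (isParallelTransport_transportFrom hG p q').symm

/-- Two ways of reaching a point differ by a loop at `p`, and its holonomy fixes `v`; the arbitrary
choice in `transportFrom` is harmless. -/
theorem isInvariantField_transportFrom (hG : IsSmoothMetric G) {p : N} {v : TangentSpace I p}
    (hv : v ∈ invariantVectors G p) : IsInvariantField G (fun q => transportFrom hG p q v) := by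
  intro q q' P hP
  have h := hv _ (mem_holonomyGroup_of_transport hG hP)
  rw [LinearEquiv.trans_apply, LinearEquiv.trans_apply, LinearEquiv.symm_apply_eq] at h
  exact h

/-- The field of endomorphisms obtained from `A` by parallel transport. -/
def endField (hG : IsSmoothMetric G) (p : N) (A : TangentSpace I p →ₗ[ℝ] TangentSpace I p) :
    ∀ x : N, TangentSpace I x →ₗ[ℝ] TangentSpace I x := fun q =>
  (transportFrom hG p q).toLinearMap ∘ₗ A ∘ₗ (transportFrom hG p q).symm.toLinearMap

theorem endField_transportFrom (hG : IsSmoothMetric G) (p : N)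
    (A : TangentSpace I p →ₗ[ℝ] TangentSpace I p) (q : N) (v : TangentSpace I p) :
    endField hG p A q (transportFrom hG p q v) = transportFrom hG p q (A v) := by
  simp [endField]

theorem isInvariantEndField_endField (hG : IsSmoothMetric G) {p : N}
    {A : TangentSpace I p →ₗ[ℝ] TangentSpace I p}
    (hA : ∀ g ∈ holonomyGroup G p, ∀ v, g (A v) = A (g v)) :
    IsInvariantEndField G (endField hG p A) := by
  intro q q' P hP w
  obtain ⟨v, rfl⟩ := (transportFrom hG p q).surjective w
  obtain ⟨v', hv'⟩ := (transportFrom hG p q').surjective (P (transportFrom hG p q v))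
  have h := hA _ (mem_holonomyGroup_of_transport hG hP) v
  simp only [LinearEquiv.trans_apply] at h
  rw [← hv', LinearEquiv.symm_apply_apply, LinearEquiv.symm_apply_eq] at h
  rw [endField_transportFrom, ← hv', endField_transportFrom, h]

/-- The transport chosen from `p` to `p` is some element of the holonomy group, not necessarily the
identity; it drops out because it commutes with `A`. -/
theorem endField_self (hG : IsSmoothMetric G) {p : N}
    {A : TangentSpace I p →ₗ[ℝ] TangentSpace I p}
    (hA : ∀ g ∈ holonomyGroup G p, ∀ v, g (A v) = A (g v)) (v : TangentSpace I p) :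
    endField hG p A p v = A v := by
  obtain ⟨u, rfl⟩ := (transportFrom hG p p).surjective v
  rw [endField_transportFrom]
  exact hA _ (isParallelTransport_transportFrom hG p p) u

end TransportFrom

/-- If the holonomy group acts trivially then the metric is flat. -/
theorem isFlat_of_forall_mem_invariantVectors [PreconnectedSpace N] (hG : IsSmoothMetric G) (p : N)
    (hp : ∀ v, v ∈ invariantVectors G p) : IsFlat G := by
  have := FiniteDimensional.complete ℝ E
  intro c y hy u v w
  obtain ⟨x, rfl⟩ := (tangentCoord I c ((extChartAt I c).symm y)).surjective w
  obtain ⟨f, rfl⟩ := (transportFrom hG p ((extChartAt I c).symm y)).surjective x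
  refine (hG c).curvature_eq_zero_of_isParallelVectorAt hy
    (X := vecCoord c fun q => transportFrom hG p q f) ?_ u v
  filter_upwards [(isOpen_extChartAt_target c).mem_nhds hy] with z hz
  exact (isInvariantField_transportFrom hG (hp f)).isParallelVectorAt hG c hz

/-- The vector field `ξ` satisfies `∇ ξ = id`. -/
def IsEulerField (G : FormField I N) (ξ : ∀ x : N, TangentSpace I x) : Prop :=
  ∀ c : N, ∀ y ∈ (extChartAt I c).target,
    HasCovariantDerivAt (metricInChart G c) (vecCoord c ξ) (.id ℝ E) y

theorem IsLocalMetric.continuousOn_curvature {b : E → E →L[ℝ] E →L[ℝ] ℝ} {T : Set E}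
    (hb : IsLocalMetric b T) {f : E → E} (hf : ContinuousOn f T) (u v : E) :
    ContinuousOn (fun y => localCurvature b y u v (f y)) T := by
  have := FiniteDimensional.complete ℝ E
  have h1 : ContinuousOn (fderiv ℝ (christoffelMap b)) T :=
    hb.contDiffOn_christoffelMap.continuousOn_fderiv_of_isOpen hb.isOpen (by simp)
  have h2 := hb.contDiffOn_christoffelMap.continuousOn
  have h3 : ∀ u : E, ContinuousOn (fun y => christoffelMap b y u) T := fun u =>
    h2.clm_apply continuousOn_const
  have h4 : ∀ u v : E, ContinuousOn (fun y => fderiv ℝ (christoffelMap b) y u v (f y)) T :=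
    fun u v => ((h1.clm_apply continuousOn_const).clm_apply continuousOn_const).clm_apply hf
  have h5 : ∀ u v : E, ContinuousOn (fun y => christoffelMap b y u (christoffelMap b y v (f y))) T :=
    fun u v => (h3 u).clm_apply ((h3 v).clm_apply hf)
  refine ((((h4 u v).sub (h4 v u)).add (h5 u v)).sub (h5 v u)).congr fun y hy => ?_
  exact hb.localCurvature_eq hy u v (f y)

theorem endField_isSelfAdjoint [PreconnectedSpace N] (hG : IsSmoothMetric G) {p : N}
    {A : TangentSpace I p →ₗ[ℝ] TangentSpace I p} (hA : ∀ u v, G p (A u) v = G p u (A v)) (q : N)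
    (u v : TangentSpace I q) : G q (endField hG p A q u) v = G q u (endField hG p A q v) := by
  obtain ⟨u, rfl⟩ := (transportFrom hG p q).surjective u
  obtain ⟨v, rfl⟩ := (transportFrom hG p q).surjective v
  have h := isParallelTransport_transportFrom hG p q
  rw [endField_transportFrom, endField_transportFrom, h.form_eq hG, h.form_eq hG, hA]

/-- The curvature vanishes on the range of an invariant selfadjoint projection `A` whose rank
exceeds the number of linearly independent fixed vectors in the range by at most `2`, if there is
an Euler field. -/
theorem isFlatOnRange_endField [PreconnectedSpace N] (hG : IsSmoothMetric G)
    {ξ : ∀ x : N, TangentSpace I x} (hξ : IsEulerField G ξ) {p : N}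
    {A : TangentSpace I p →ₗ[ℝ] TangentSpace I p}
    (hA : ∀ g ∈ holonomyGroup G p, ∀ v, g (A v) = A (g v)) (hAA : ∀ v, A (A v) = A v)
    (hAsa : ∀ u v, G p (A u) v = G p u (A v))
    (hfin : Module.finrank ℝ (LinearMap.range A) ≤ Module.finrank ℝ
      (invariantVectors G p ⊓ LinearMap.range A : Submodule ℝ (TangentSpace I p)) + 2) :
    IsFlatOnRange G (endField hG p A) := by
  have hcomplete := FiniteDimensional.complete ℝ E
  have hfd : FiniteDimensional ℝ (TangentSpace I p) := inferInstanceAs (FiniteDimensional ℝ E)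
  intro c y₁ hy₁ u v w
  by_contra hne
  have hinv := isInvariantEndField_endField hG hA
  set B := endCoord c (endField hG p A) with hB
  have hBpar : ∀ y ∈ (extChartAt I c).target, IsParallelEndAt (metricInChart G c) B y :=
    fun y hy => hinv.isParallelEndAt hG c hy
  -- the coordinates of the fixed vectors in the range of `A`
  let Φ : ∀ y : E, TangentSpace I p ≃ₗ[ℝ] E := fun y =>
    (transportFrom hG p ((extChartAt I c).symm y)).trans (tangentCoord I c _).toLinearEquiv
  have hBΦ : ∀ y f, B y (Φ y f) = Φ y (A f) := fun y f => by
    change endCoord c _ y (tangentCoord I c _ _) = tangentCoord I c _ _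
    rw [endCoord_tangentCoord]
    exact congrArg (tangentCoord I c _) (endField_transportFrom hG p A _ f)
  set F := (invariantVectors G p ⊓ LinearMap.range A : Submodule ℝ (TangentSpace I p)) with hF
  set S : E → Submodule ℝ E := fun y => F.map (Φ y).toLinearMap with hS
  set D : E → Submodule ℝ E := fun y => (LinearMap.range A).map (Φ y).toLinearMap with hD
  have hfinS : ∀ y, Module.finrank ℝ (S y) = Module.finrank ℝ F := fun y =>
    (Φ y).finrank_map_eq F
  have hfinD : ∀ y, Module.finrank ℝ (D y) = Module.finrank ℝ (LinearMap.range A) := fun y =>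
    (Φ y).finrank_map_eq _
  have hSD : ∀ y, S y ≤ D y := fun y => Submodule.map_mono inf_le_right
  have hBD : ∀ y x, B y x ∈ D y := fun y x => by
    obtain ⟨f, rfl⟩ := (Φ y).surjective x
    rw [hBΦ]
    exact ⟨A f, ⟨f, rfl⟩, rfl⟩
  have hDB : ∀ y, ∀ x ∈ D y, B y x = x := by
    rintro y _ ⟨_, ⟨f, rfl⟩, rfl⟩
    change B y (Φ y (A f)) = Φ y (A f)
    rw [hBΦ, hAA]
  have hSinv : ∀ f ∈ F, IsInvariantField G (fun q => transportFrom hG p q f) := fun f hf =>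
    isInvariantField_transportFrom hG hf.1
  have hSR : ∀ y ∈ (extChartAt I c).target, ∀ x ∈ S y,
      localCurvature (metricInChart G c) y u v x = 0 := by
    rintro y hy _ ⟨f, hf, rfl⟩
    refine (hG c).curvature_eq_zero_of_isParallelVectorAt hy
      (X := vecCoord c fun q => transportFrom hG p q f) ?_ u v
    filter_upwards [(isOpen_extChartAt_target c).mem_nhds hy] with z hz
    exact (hSinv f hf).isParallelVectorAt hG c hz
  -- the projection of the Euler field
  set η : E → E := fun y => B y (vecCoord c ξ y) with hη
  have hηcov : ∀ y ∈ (extChartAt I c).target,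
      HasCovariantDerivAt (metricInChart G c) η (B y) y := fun y hy => by
    have := IsLocalMetric.hasCovariantDerivAt_apply (hBpar y hy) (hξ c y hy)
    rwa [ContinuousLinearMap.comp_id] at this
  have hηR : ∀ y ∈ (extChartAt I c).target,
      localCurvature (metricInChart G c) y u v (η y) = 0 := fun y hy => by
    refine (hG c).curvature_eq_zero_of_hasCovariantDerivAt hy (hBpar y hy) ?_ u v
    filter_upwards [(isOpen_extChartAt_target c).mem_nhds hy] with z hz using hηcov z hz
  have hcont : ContinuousOn (fun y => localCurvature (metricInChart G c) y u v (B y w))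
      (extChartAt I c).target := by
    refine (hG c).continuousOn_curvature (fun y hy => ?_) u v
    exact ((HasFDerivAt.continuousAt (hBpar y hy)).clm_apply continuousAt_const).continuousWithinAt
  -- Non-vanishing is an open condition, so a contradiction at any point sufficiently near `y₁` is
  -- enough.
  have hev : ∀ᶠ y in 𝓝 y₁, y ∈ (extChartAt I c).target ∧
      localCurvature (metricInChart G c) y u v (B y w) ≠ 0 :=
    ((isOpen_extChartAt_target c).eventually_mem hy₁).and
      ((hcont.continuousAt ((isOpen_extChartAt_target c).mem_nhds hy₁)).eventually_ne hne)
  by_cases hcase : ∀ᶠ y in 𝓝 y₁, η y ∈ S y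
  · -- the projection of the Euler field is a combination of the fixed fields
    obtain ⟨ρ, hρ, hsub, C, hC, hseg⟩ := exists_ball_transport hG c hy₁
    obtain ⟨δ, hδ, hδ'⟩ := Metric.eventually_nhds_iff_ball.1 hcase
    -- Transported back to `y₁`, the curve V(t)η(y₁ + th) stays in S y₁. Its derivative at 0 is B y₁
    -- h: the Christoffel term from V' cancels the one in the derivative of η. Thus B y₁ h lies in S
    -- y₁.
    have hsmall : ∀ h : E, y₁ + h ∈ ball y₁ (min ρ δ) → B y₁ h ∈ S y₁ := by
      intro h hh
      have hhρ := ball_subset_ball (min_le_left ρ δ) hh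
      have hhδ := ball_subset_ball (min_le_right ρ δ) hh
      obtain ⟨U, V, hU0, hV0, hU, hV, hVU, hUV, hP⟩ := hseg y₁ h (mem_ball_self hρ) hhρ
      have h0 : (0 : ℝ) ∈ Icc (0 : ℝ) 1 := left_mem_Icc.2 zero_le_one
      have hline : HasDerivWithinAt (fun t : ℝ => y₁ + t • h) h (Icc 0 1) 0 := by
        simpa using (((hasDerivAt_id (0 : ℝ)).smul_const h).const_add y₁).hasDerivWithinAt
      have hy₁' : y₁ = y₁ + (0 : ℝ) • h := by simp
      have hη0 : HasFDerivAt η (B y₁ - (christoffelMap (metricInChart G c) y₁).flip (η y₁))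
          (y₁ + (0 : ℝ) • h) := by
        rw [← hy₁']
        exact hηcov y₁ hy₁
      have hη1 : HasDerivWithinAt (fun t : ℝ => η (y₁ + t • h)) _ (Icc 0 1) 0 :=
        HasFDerivAt.comp_hasDerivWithinAt (f := fun t : ℝ => y₁ + t • h) (0 : ℝ) hη0 hline
      have h1 := (hV 0 h0).clm_apply hη1
      have h2 := h1.mem_submodule (S := S y₁) fun t ht => ?_
      · rw [hV0, ← hy₁'] at h2
        simpa using h2
      · obtain ⟨f, hf, hfη⟩ := hδ' _ (segment_mem_ball (mem_ball_self hδ) hhδ ht)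
        have h3 := vecCoord_eq_of_transport (hSinv f hf) (hP t ht)
        change Φ (y₁ + t • h) f = U t (Φ y₁ f) at h3
        change Φ (y₁ + t • h) f = _ at hfη
        rw [← hfη, h3]
        have h4 : V t (U t (Φ y₁ f)) = Φ y₁ f :=
          congrArg (fun A : E →L[ℝ] E => A (Φ y₁ f)) (hVU t ht)
        rw [h4]
        exact ⟨f, hf, rfl⟩
    have hmem : B y₁ w ∈ S y₁ := by
      -- Only small vectors have been treated; rescaling reaches `w` by linearity.
      obtain ⟨ε, hε, hε'⟩ : ∃ ε : ℝ, 0 < ε ∧ y₁ + ε • w ∈ ball y₁ (min ρ δ) := by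
        have hc : ContinuousAt (fun ε : ℝ => y₁ + ε • w) 0 := by fun_prop
        have h1 : ∀ᶠ ε in 𝓝[>] (0 : ℝ), y₁ + ε • w ∈ ball y₁ (min ρ δ) :=
          (hc.eventually_mem (by simpa using ball_mem_nhds y₁ (lt_min hρ hδ))).filter_mono
            nhdsWithin_le_nhds
        obtain ⟨ε, h2, h3⟩ := (h1.and self_mem_nhdsWithin).exists
        exact ⟨ε, h3, h2⟩
      have h1 := (S y₁).smul_mem ε⁻¹ (hsmall _ hε')
      rwa [map_smul, inv_smul_smul₀ hε.ne'] at h1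
    exact hne (hSR y₁ hy₁ _ hmem)
  · -- the curvature vanishes on a hyperplane of the range
    obtain ⟨y, hηS, hy, hne'⟩ := (Filter.not_eventually.1 hcase |>.and_eventually hev).exists
    have hK : S y ⊔ ℝ ∙ η y ≤ D y :=
      sup_le (hSD y) ((Submodule.span_singleton_le_iff_mem _ _).2 (hBD y _))
    have hlt : S y < S y ⊔ ℝ ∙ η y := by
      refine lt_of_le_of_ne le_sup_left fun h => hηS ?_
      rw [h]
      exact Submodule.mem_sup_right (Submodule.mem_span_singleton_self _)
    have hfinK := Submodule.finrank_lt_finrank_of_lt hlt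
    obtain ⟨R, hRlin⟩ : ∃ R : E →L[ℝ] E, ∀ x, localCurvature (metricInChart G c) y u v x = R x :=
      ⟨fderiv ℝ (christoffelMap (metricInChart G c)) y u v
          - fderiv ℝ (christoffelMap (metricInChart G c)) y v u
          + christoffelMap (metricInChart G c) y u ∘L christoffelMap (metricInChart G c) y v
          - christoffelMap (metricInChart G c) y v ∘L christoffelMap (metricInChart G c) y u,
        fun x => (hG c).localCurvature_eq hy u v x⟩
    have hxsource := (extChartAt I c).map_target hy
    have hBsa : ∀ x z, metricInChart G c y (B y x) z = metricInChart G c y x (B y z) := by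
      intro x z
      obtain ⟨x, rfl⟩ := (tangentCoord I c ((extChartAt I c).symm y)).surjective x
      obtain ⟨z, rfl⟩ := (tangentCoord I c ((extChartAt I c).symm y)).surjective z
      have h1 := fun a b => metricInChart_tangentCoord G hxsource a b
      rw [(extChartAt I c).right_inv hy] at h1
      rw [hB, endCoord_tangentCoord, endCoord_tangentCoord, h1, h1,
        endField_isSelfAdjoint hG hAsa]
    refine hne' ?_
    rw [hRlin]
    -- Here dim D ≤ dim S + 2 ≤ dim (S + ℝη) + 1. The curvature is skew, preserves `D` because it
    -- commutes with the parallel projection, and kills both S and η.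
    refine eq_zero_of_skew_of_finrank_le (b := fun x z => metricInChart G c y x z)
      (R := R.toLinearMap) (D := D y) (K := S y ⊔ ℝ ∙ η y)
      (fun x z z' => map_add _ _ _) (fun x a z => by simp) ((hG c).symm y hy) (fun x z => ?_)
      (fun x hx hx0 => ?_) (fun x hx => ?_) hK ?_ (fun x hx => ?_) _ (hBD y w)
    · have := (hG c).curvature_skew hy u v x z
      rwa [hRlin, hRlin] at this
    · apply (hG c).ext hy
      intro z
      rw [← hDB y x hx, hBsa, hx0 _ (hBD y z)]
      simp
    · have h1 := (hG c).curvature_comm_of_isParallelEndAt hy (A := B)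
        (by filter_upwards [(isOpen_extChartAt_target c).mem_nhds hy] with z hz using hBpar z hz)
        u v x
      rw [hDB y x hx, hRlin] at h1
      change R x ∈ D y
      rw [h1]
      exact hBD y _
    · rw [hfinD]
      rw [hfinS] at hfinK
      omega
    · obtain ⟨s, hs, z, hz, rfl⟩ := Submodule.mem_sup.1 hx
      obtain ⟨a, rfl⟩ := Submodule.mem_span_singleton.1 hz
      change R (s + a • η y) = 0
      have h1 := hSR y hy s hs
      have h2 := hηR y hy
      rw [hRlin] at h1 h2
      rw [map_add, map_smul, h1, h2]
      simp

end Blocks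

/-! ### The blocks of a maximal decomposition and the dimension count. -/

section Decomposition

open Module

variable {E : Type*} [NormedAddCommGroup E] [NormedSpace ℝ E] [FiniteDimensional ℝ E]
  {H : Type*} [TopologicalSpace H] {I : ModelWithCorners ℝ E H} [I.Boundaryless]
  {N : Type*} [TopologicalSpace N] [ChartedSpace H N] [IsManifold I ∞ N]
  {G : FormField I N}

theorem IsSmoothMetric.form_symm (hG : IsSmoothMetric G) (x : N) (u v : TangentSpace I x) :
    G x u v = G x v u := by
  have hx := mem_extChartAt_source (I := I) x
  rw [← metricInChart_tangentCoord G hx, ← metricInChart_tangentCoord G hx]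
  exact (hG x).symm _ ((extChartAt I x).map_source hx) _ _

theorem IsSmoothMetric.form_nondegenerate (hG : IsSmoothMetric G) (x : N) (u : TangentSpace I x)
    (hu : ∀ v, G x u v = 0) : u = 0 := by
  have hx := mem_extChartAt_source (I := I) x
  have h : tangentCoord I x x u = 0 := by
    refine (hG x).ext ((extChartAt I x).map_source hx) fun z => ?_
    obtain ⟨z, rfl⟩ := (tangentCoord I x x).surjective z
    rw [metricInChart_tangentCoord G hx, hu]
    simp
  exact (tangentCoord I x x).map_eq_zero_iff.1 h

/-- The metric identifies vectors with forms, and since holonomy is isometric, an invariant form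
comes from a fixed vector. -/
theorem finrank_invariantForms_le (hG : IsSmoothMetric G) (p : N) :
    finrank ℝ (invariantForms G p) ≤ finrank ℝ (invariantVectors G p) := by
  have hfd : FiniteDimensional ℝ (TangentSpace I p) := inferInstanceAs (FiniteDimensional ℝ E)
  let Φ : TangentSpace I p →ₗ[ℝ] Dual ℝ (TangentSpace I p) := (G p).toLinearMap₁₂
  have hΦ : ∀ u v, Φ u v = G p u v := fun u v => rfl
  have hinj : Function.Injective Φ := by
    rw [← LinearMap.ker_eq_bot, LinearMap.ker_eq_bot']
    exact fun u hu => hG.form_nondegenerate p u fun v => by rw [← hΦ, hu]; rfl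
  have hsurj : Function.Surjective Φ :=
    (LinearMap.injective_iff_surjective_of_finrank_eq_finrank
      Subspace.dual_finrank_eq.symm).1 hinj
  refine (Submodule.finrank_mono (t := (invariantVectors G p).map Φ) ?_).trans
    (Submodule.finrank_map_le Φ _)
  intro τ hτ
  obtain ⟨w, rfl⟩ := hsurj τ
  refine ⟨w, fun g hg => ?_, rfl⟩
  rw [← sub_eq_zero]
  refine hG.form_nondegenerate p _ fun v => ?_
  obtain ⟨v, rfl⟩ := g.surjective v
  have h1 := IsParallelTransport.form_eq hG hg w v
  have h2 := hτ g hg v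
  rw [hΦ, hΦ] at h2
  rw [map_sub, sub_apply, h1, h2, sub_self]

section Blocks

variable {p : N} {ℓ : ℕ} {V : Fin (ℓ + 1) → Submodule ℝ (TangentSpace I p)}

namespace IsMaximalDecomposition

theorem isCompl (hV : IsMaximalDecomposition G p ℓ V) (i : Fin (ℓ + 1)) :
    IsCompl (V i) (⨆ j ≠ i, V j) := by
  refine ⟨hV.isInternal.submodule_iSupIndep i, ?_⟩
  rw [codisjoint_iff_le_sup, ← hV.isInternal.submodule_iSup_eq_top]
  refine iSup_le fun j => ?_
  by_cases hj : j = i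
  · exact hj ▸ le_sup_left
  · exact (le_iSup₂ (f := fun j (_ : j ≠ i) => V j) j hj).trans le_sup_right

/-- The projection to a block. -/
def proj (hV : IsMaximalDecomposition G p ℓ V) (i : Fin (ℓ + 1)) :
    TangentSpace I p →ₗ[ℝ] TangentSpace I p :=
  (V i).projection _ (hV.isCompl i)

theorem proj_add (hV : IsMaximalDecomposition G p ℓ V) {i : Fin (ℓ + 1)} {a b : TangentSpace I p}
    (ha : a ∈ V i) (hb : b ∈ ⨆ j ≠ i, V j) : hV.proj i (a + b) = a := by
  rw [map_add, proj, Submodule.projection_apply_of_mem_left _ ha,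
    (Submodule.projection_apply_eq_zero_iff _).2 hb, add_zero]

theorem proj_of_mem (hV : IsMaximalDecomposition G p ℓ V) {i : Fin (ℓ + 1)} {a : TangentSpace I p}
    (ha : a ∈ V i) : hV.proj i a = a :=
  Submodule.projection_apply_of_mem_left _ ha

theorem proj_mem (hV : IsMaximalDecomposition G p ℓ V) (i : Fin (ℓ + 1)) (v : TangentSpace I p) :
    hV.proj i v ∈ V i :=
  Submodule.projection_apply_mem _ v

theorem exists_add (hV : IsMaximalDecomposition G p ℓ V) (i : Fin (ℓ + 1)) (v : TangentSpace I p) :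
    ∃ a ∈ V i, ∃ b ∈ ⨆ j ≠ i, V j, a + b = v :=
  Submodule.mem_sup.1 ((hV.isCompl i).sup_eq_top ▸ Submodule.mem_top)

theorem range_proj (hV : IsMaximalDecomposition G p ℓ V) (i : Fin (ℓ + 1)) :
    LinearMap.range (hV.proj i) = V i :=
  Submodule.range_projection _

theorem orthogonal_compl (hV : IsMaximalDecomposition G p ℓ V) {i : Fin (ℓ + 1)}
    {a b : TangentSpace I p} (ha : a ∈ V i) (hb : b ∈ ⨆ j ≠ i, V j) : G p a b = 0 := by
  have h : (⨆ j ≠ i, V j) ≤ LinearMap.ker (G p a).toLinearMap :=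
    iSup₂_le fun j hj b hb => hV.orthogonal i j hj.symm a ha b hb
  exact h hb

theorem invariant_compl (hV : IsMaximalDecomposition G p ℓ V) (i : Fin (ℓ + 1)) :
    IsHolonomyInvariant G p (⨆ j ≠ i, V j) := by
  intro g hg
  have h : (⨆ j ≠ i, V j) ≤ (⨆ j ≠ i, V j).comap g.toLinearMap :=
    iSup₂_le fun j hj b hb =>
      (le_iSup₂ (f := fun j (_ : j ≠ i) => V j) j hj) (hV.invariant j g hg b hb)
  exact fun v hv => h hv

theorem proj_comm (hV : IsMaximalDecomposition G p ℓ V) (i : Fin (ℓ + 1)) :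
    ∀ g ∈ holonomyGroup G p, ∀ v, g (hV.proj i v) = hV.proj i (g v) := by
  intro g hg v
  obtain ⟨a, ha, b, hb, rfl⟩ := hV.exists_add i v
  rw [hV.proj_add ha hb, map_add g, hV.proj_add (hV.invariant i g hg a ha)
    (hV.invariant_compl i g hg b hb)]

theorem proj_selfAdjoint (hV : IsMaximalDecomposition G p ℓ V) (hG : IsSmoothMetric G)
    (i : Fin (ℓ + 1)) (u v : TangentSpace I p) : G p (hV.proj i u) v = G p u (hV.proj i v) := by
  obtain ⟨a, ha, b, hb, rfl⟩ := hV.exists_add i u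
  obtain ⟨a', ha', b', hb', rfl⟩ := hV.exists_add i v
  rw [hV.proj_add ha hb, hV.proj_add ha' hb', map_add, map_add, add_apply,
    hV.orthogonal_compl ha hb', hG.form_symm p b a', hV.orthogonal_compl ha' hb]

theorem eq_of_forall_proj_eq_zero (hV : IsMaximalDecomposition G p ℓ V) (hG : IsSmoothMetric G)
    {w : TangentSpace I p} (hw : ∀ i, hV.proj i w = 0) : w = 0 := by
  refine hG.form_nondegenerate p w fun v => ?_
  have h : (⊤ : Submodule ℝ (TangentSpace I p)) ≤ LinearMap.ker (G p w).toLinearMap := by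
    rw [← hV.isInternal.submodule_iSup_eq_top]
    refine iSup_le fun i v hv => ?_
    change G p w v = 0
    rw [← hV.proj_of_mem hv, ← hV.proj_selfAdjoint hG, hw]
    simp
  exact h Submodule.mem_top

/-- The projections commute with holonomy, so the components of a fixed vector are fixed; together
they determine it. -/
theorem finrank_invariantVectors_le (hV : IsMaximalDecomposition G p ℓ V) (hG : IsSmoothMetric G) :
    finrank ℝ (invariantVectors G p)
      ≤ ∑ i, finrank ℝ (invariantVectors G p ⊓ V i : Submodule ℝ (TangentSpace I p)) := by
  have hfd : FiniteDimensional ℝ (TangentSpace I p) := inferInstanceAs (FiniteDimensional ℝ E)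
  rw [← finrank_pi_fintype ℝ]
  let f : invariantVectors G p →ₗ[ℝ]
      ∀ i, (invariantVectors G p ⊓ V i : Submodule ℝ (TangentSpace I p)) :=
    LinearMap.pi fun i => (hV.proj i).restrict fun v hv =>
      ⟨fun g hg => by rw [hV.proj_comm i g hg, hv g hg], hV.proj_mem i v⟩
  refine LinearMap.finrank_le_finrank_of_injective (f := f) ?_
  rw [← LinearMap.ker_eq_bot, LinearMap.ker_eq_bot']
  rintro ⟨w, hw⟩ h
  refine Subtype.ext (hV.eq_of_forall_proj_eq_zero hG fun i => ?_)
  exact congrArg Subtype.val (congrFun h i)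

theorem sum_finrank (hV : IsMaximalDecomposition G p ℓ V) :
    ∑ i, finrank ℝ (V i) = finrank ℝ E := by
  have hfd : FiniteDimensional ℝ (TangentSpace I p) := inferInstanceAs (FiniteDimensional ℝ E)
  rw [← finrank_directSum ℝ]
  exact (LinearEquiv.ofBijective (DirectSum.coeLinearMap V) hV.isInternal).finrank_eq

/-- By polarization, a block of null vectors would carry the zero form, against nondegeneracy. -/
theorem exists_form_self_ne_zero (hV : IsMaximalDecomposition G p ℓ V) (hG : IsSmoothMetric G)
    {i : Fin (ℓ + 1)} (hi : i ≠ 0) : ∃ v ∈ V i, G p v v ≠ 0 := by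
  by_contra! h
  have h2 := hV.two_le_finrank i hi
  have h3 : V i = ⊥ := by
    rw [Submodule.eq_bot_iff]
    refine fun u hu => hV.nondegenerate i u hu fun v hv => ?_
    have h4 := h (u + v) ((V i).add_mem hu hv)
    rw [map_add (G p), add_apply, map_add, map_add, h u hu, h v hv, hG.form_symm p v u] at h4
    change G p u v = (0 : ℝ)
    linarith
  rw [h3, finrank_bot] at h2
  omega

/-- If there is an Euler field, the codimension of the space of fixed vectors in an
indecomposable block is at least `3`. -/
theorem finrank_inf_add_three_le [SimplyConnectedSpace N] [LocallyPathConnectedSpace N]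
    (hV : IsMaximalDecomposition G p ℓ V) (hG : IsSmoothMetric G) {ξ : ∀ x : N, TangentSpace I x}
    (hξ : IsEulerField G ξ) {i : Fin (ℓ + 1)} (hi : i ≠ 0) :
    finrank ℝ (invariantVectors G p ⊓ V i : Submodule ℝ (TangentSpace I p)) + 3
      ≤ finrank ℝ (V i) := by
  by_contra! hlt
  -- The negated bound gives dim V_i ≤ r_i + 2, so the curvature vanishes on the block and its
  -- vectors extend to parallel fields, which every loop preserves.
  have hfixed : ∀ v ∈ V i, v ∈ invariantVectors G p := by
    intro v hv g hg
    have hA := hV.proj_comm i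
    obtain ⟨s, hs, hsp⟩ := exists_isInvariantField_of_isFlatOnRange hG
      (isInvariantEndField_endField hG hA)
      (isFlatOnRange_endField hG hξ hA (fun v => hV.proj_of_mem (hV.proj_mem i v))
        (hV.proj_selfAdjoint hG i) (by rw [hV.range_proj]; omega)) p v
    have h := hs p p g hg
    rwa [hsp, endField_self hG hA, hV.proj_of_mem hv] at h
  -- A non-null fixed vector spans a nondegenerate invariant line, which is proper because the block
  -- has dimension at least 2.
  obtain ⟨v, hv, hvv⟩ := hV.exists_form_self_ne_zero hG hi
  have hle : ℝ ∙ v ≤ V i := (Submodule.span_singleton_le_iff_mem _ _).2 hv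
  have hv0 : v ≠ 0 := by
    rintro rfl
    simp at hvv
  have h2 := hV.two_le_finrank i hi
  have hnd : IsNondegenerateOn G p (ℝ ∙ v) := by
    intro u hu hu0
    obtain ⟨a, rfl⟩ := Submodule.mem_span_singleton.1 hu
    have h := hu0 v (Submodule.mem_span_singleton_self v)
    rw [map_smul, smul_apply, smul_eq_mul, mul_eq_zero] at h
    rw [h.resolve_right hvv, zero_smul]
  have hinv : IsHolonomyInvariant G p (ℝ ∙ v) := fun g hg u hu => by
    rwa [hfixed u (hle hu) g hg]
  rcases hV.indecomposable i hi (ℝ ∙ v) hle hnd hinv with h | h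
  · exact hv0 (Submodule.span_singleton_eq_bot.1 h)
  · rw [← h, finrank_span_singleton hv0] at h2
    omega

end IsMaximalDecomposition

/-- The dimension estimates for a maximal decomposition of a nonflat metric with an Euler field. -/
theorem IsMaximalDecomposition.estimates [SimplyConnectedSpace N] [LocallyPathConnectedSpace N]
    (hV : IsMaximalDecomposition G p ℓ V) (hG : IsSmoothMetric G) (hflat : ¬ IsFlat G)
    {ξ : ∀ x : N, TangentSpace I x} (hξ : IsEulerField G ξ) :
    1 ≤ ℓ ∧ finrank ℝ (invariantForms G p) + 3 * ℓ ≤ finrank ℝ E := by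
  have hfd : FiniteDimensional ℝ (TangentSpace I p) := inferInstanceAs (FiniteDimensional ℝ E)
  constructor
  · by_contra! h
    obtain rfl : ℓ = 0 := by omega
    refine hflat (isFlat_of_forall_mem_invariantVectors hG p fun v g hg => ?_)
    refine hV.trivial_zero g hg v ?_
    have h1 := hV.isInternal.submodule_iSup_eq_top
    have h2 : (⨆ i, V i) = V 0 := iSup_unique (ι := Fin 1) V
    rw [← h2, h1]
    exact Submodule.mem_top
  · have h1 := (finrank_invariantForms_le hG p).trans (hV.finrank_invariantVectors_le hG)
    have h2 := hV.sum_finrank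
    rw [Fin.sum_univ_succ] at h1 h2
    have h3 : finrank ℝ (invariantVectors G p ⊓ V 0 : Submodule ℝ (TangentSpace I p))
        ≤ finrank ℝ (V 0) := Submodule.finrank_mono inf_le_right
    have h4 := Finset.sum_le_sum fun (i : Fin ℓ) (_ : i ∈ Finset.univ) =>
      hV.finrank_inf_add_three_le hG hξ i.succ_ne_zero
    rw [Finset.sum_add_distrib, Finset.sum_const, Finset.card_univ, Fintype.card_fin,
      smul_eq_mul] at h4
    omega

end Blocks

end Decomposition

/-! ### Smooth pseudo-Riemannian metrics give local metrics in charts. -/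

section LocalMetric

variable {E : Type*} [NormedAddCommGroup E] [NormedSpace ℝ E] [FiniteDimensional ℝ E]

theorem isInvertible_of_nondegenerate {b : E →L[ℝ] E →L[ℝ] ℝ}
    (hb : ∀ u, (∀ v, b u v = 0) → u = 0) : b.IsInvertible := by
  have h : Function.Injective b.toLinearMap := by
    rw [← LinearMap.ker_eq_bot, LinearMap.ker_eq_bot']
    exact fun u hu => hb u fun v => congrArg (fun a : E →L[ℝ] ℝ => a v) hu
  have hfin : Module.finrank ℝ E = Module.finrank ℝ (E →L[ℝ] ℝ) := by
    rw [← LinearMap.toContinuousLinearMap.finrank_eq (R := ℝ) (M := E →ₗ[ℝ] ℝ)]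
    exact Subspace.dual_finrank_eq.symm
  exact ⟨(LinearEquiv.ofInjectiveOfFinrankEq b.toLinearMap h hfin).toContinuousLinearEquiv, rfl⟩

theorem IsLocalMetric.of_nondegenerate {b : E → E →L[ℝ] E →L[ℝ] ℝ} {T : Set E} (hT : IsOpen T)
    (hsmooth : ∀ u v, ContDiffOn ℝ ∞ (fun y => b y u v) T)
    (hsymm : ∀ y ∈ T, ∀ u v, b y u v = b y v u)
    (hnd : ∀ y ∈ T, ∀ u, (∀ v, b y u v = 0) → u = 0) : IsLocalMetric b T where
  isOpen := hT
  contDiffOn := contDiffOn_clm_apply.2 fun u => contDiffOn_clm_apply.2 fun v => hsmooth u v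
  symm := hsymm
  isInvertible y hy := isInvertible_of_nondegenerate (hnd y hy)

end LocalMetric

section SmoothMetric

variable {E : Type*} [NormedAddCommGroup E] [NormedSpace ℝ E] [FiniteDimensional ℝ E]
  {H : Type*} [TopologicalSpace H] {I : ModelWithCorners ℝ E H} [I.Boundaryless]
  {N : Type*} [TopologicalSpace N] [ChartedSpace H N] [IsManifold I ∞ N]

/-- Coordinate vector fields are smooth sections of the tangent bundle, so the smooth bundle section
`g` evaluates on them to smooth functions. -/
theorem PseudoRiemannianMetric.contDiffOn_metricInChart (g : PseudoRiemannianMetric I N) (c : N)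
    (u v : E) : ContDiffOn ℝ ∞ (fun y => metricInChart g.form c y u v)
      (extChartAt I c).target := by
  have hT := isOpen_extChartAt_target (I := I) c
  have hφ : ContMDiffOn 𝓘(ℝ, E) I ∞ (extChartAt I c).symm (extChartAt I c).target :=
    contMDiffOn_extChartAt_symm c
  have hvec : ∀ u : E, ContMDiffOn 𝓘(ℝ, E) I.tangent ∞
      (fun y => (⟨(extChartAt I c).symm y, mfderiv 𝓘(ℝ, E) I (extChartAt I c).symm y u⟩ :
        TangentBundle I N)) (extChartAt I c).target := by
    intro u
    have h1 := hφ.contMDiffOn_tangentMapWithin (m := ∞) (by simp) hT.uniqueMDiffOn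
    have h2 : ContMDiff 𝓘(ℝ, E) 𝓘(ℝ, E).tangent ∞
        (fun y : E => (⟨y, u⟩ : TangentBundle 𝓘(ℝ, E) E)) :=
      contMDiff_vectorSpace_iff_contDiff.2 contDiff_const
    refine (h1.comp h2.contMDiffOn fun y hy => hy).congr fun y hy => ?_
    simp only [Function.comp, tangentMapWithin, mfderivWithin_of_isOpen hT hy]
  have hform := g.smooth.comp_contMDiffOn hφ
  intro y hy
  have h := (ContMDiffWithinAt.clm_bundle_apply₂ (F₁ := E) (F₂ := E) (F₃ := ℝ)
    (E₁ := fun x : N => TangentSpace I x) (E₂ := fun x : N => TangentSpace I x)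
    (E₃ := Bundle.Trivial N ℝ) (b := (extChartAt I c).symm)
    (hform y hy) (hvec u y hy) (hvec v y hy))
  rw [Bundle.contMDiffWithinAt_totalSpace] at h
  exact h.2.contDiffWithinAt

theorem PseudoRiemannianMetric.isSmoothMetric (g : PseudoRiemannianMetric I N) :
    IsSmoothMetric g.form := by
  intro c
  refine .of_nondegenerate (isOpen_extChartAt_target c) (g.contDiffOn_metricInChart c)
    (fun y hy u v => g.symm _ _ _) fun y hy u hu => ?_
  rw [← tangentCoord_mfderiv_symm hy u]
  suffices mfderiv 𝓘(ℝ, E) I (extChartAt I c).symm y u = 0 by rw [this, map_zero]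
  refine g.nondegenerate _ _ fun v => ?_
  have h := hu (tangentCoord I c ((extChartAt I c).symm y) v)
  rw [← h, ← tangentCoord_symm_apply hy]
  conv_lhs => rw [← (tangentCoord I c ((extChartAt I c).symm y)).symm_apply_apply v,
    tangentCoord_symm_apply hy, tangentCoord_symm_apply hy]
  rfl

end SmoothMetric

/-! ### The cone metric and its Euler field. -/

section Cone

open Filter Topology

variable {n : ℕ} {M : Type*} [TopologicalSpace M]
  [ChartedSpace (EuclideanSpace ℝ (Fin n)) M]

theorem locallyPathConnectedSpace_cone (n : ℕ) (M : Type*) [TopologicalSpace M]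
    [ChartedSpace (EuclideanSpace ℝ (Fin n)) M] : LocallyPathConnectedSpace (Cone M) := by
  have h1 : LocallyPathConnectedSpace positiveReals :=
    ChartedSpace.locallyPathConnectedSpace ℝ positiveReals
  have h2 : LocallyPathConnectedSpace M :=
    ChartedSpace.locallyPathConnectedSpace (EuclideanSpace ℝ (Fin n)) M
  infer_instance

/-- The radial coordinate on the cone. -/
def coneRadius (q : Cone M) : ℝ := q.1

/-- The differential of the radial coordinate. -/
def radialDifferential (q : Cone M) : TangentSpace (coneModel n) q →L[ℝ] ℝ :=
  mfderiv (coneModel n) 𝓘(ℝ, ℝ) coneRadius q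

theorem coneMetric_apply (g : FormField (𝓡 n) M) (q : Cone M)
    (u v : TangentSpace (coneModel n) q) : coneMetric g q u v
      = radialDifferential q u * radialDifferential q v
        + coneRadius q ^ 2 * g q.2 (mfderiv (coneModel n) (𝓡 n) Prod.snd q u)
            (mfderiv (coneModel n) (𝓡 n) Prod.snd q v) := rfl

theorem contMDiff_coneRadius [IsManifold (𝓡 n) ∞ M] :
    ContMDiff (coneModel n) 𝓘(ℝ, ℝ) ∞ (coneRadius (M := M)) :=
  contMDiff_subtype_val.comp contMDiff_fst

theorem extChartAt_cone_apply (c q : Cone M) :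
    extChartAt (coneModel n) c q = (coneRadius q, extChartAt (𝓡 n) c.2 q.2) := by
  rw [extChartAt_prod]
  rfl

theorem extChartAt_cone_symm_snd (c : Cone M) (y : ℝ × EuclideanSpace ℝ (Fin n)) :
    ((extChartAt (coneModel n) c).symm y).2 = (extChartAt (𝓡 n) c.2).symm y.2 := by
  rw [extChartAt_prod]
  rfl

theorem snd_mem_target_of_mem_cone {c : Cone M} {y : ℝ × EuclideanSpace ℝ (Fin n)}
    (hy : y ∈ (extChartAt (coneModel n) c).target) : y.2 ∈ (extChartAt (𝓡 n) c.2).target := by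
  rw [extChartAt_prod] at hy
  exact hy.2

theorem coneRadius_extChartAt_symm {c : Cone M} {y : ℝ × EuclideanSpace ℝ (Fin n)}
    (hy : y ∈ (extChartAt (coneModel n) c).target) :
    coneRadius ((extChartAt (coneModel n) c).symm y) = y.1 := by
  have h := (extChartAt (coneModel n) c).right_inv hy
  rw [extChartAt_cone_apply] at h
  exact congrArg Prod.fst h

theorem fst_pos_of_mem_cone {c : Cone M} {y : ℝ × EuclideanSpace ℝ (Fin n)}
    (hy : y ∈ (extChartAt (coneModel n) c).target) : 0 < y.1 := by
  rw [← coneRadius_extChartAt_symm hy]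
  exact ((extChartAt (coneModel n) c).symm y).1.2

variable [IsManifold (𝓡 n) ∞ M]

theorem radialDifferential_symm {c : Cone M} {y : ℝ × EuclideanSpace ℝ (Fin n)}
    (hy : y ∈ (extChartAt (coneModel n) c).target) (u : ℝ × EuclideanSpace ℝ (Fin n)) :
    radialDifferential ((extChartAt (coneModel n) c).symm y)
      (mfderiv 𝓘(ℝ, ℝ × EuclideanSpace ℝ (Fin n)) (coneModel n) (extChartAt (coneModel n) c).symm y u)
      = u.1 := by
  have hT := (isOpen_extChartAt_target c).mem_nhds hy
  have h1 := mfderiv_comp y (contMDiff_coneRadius (M := M).mdifferentiableAt (by simp))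
    (((contMDiffOn_extChartAt_symm (n := ∞) c).contMDiffAt hT).mdifferentiableAt (by simp))
  have h2 : (coneRadius ∘ (extChartAt (coneModel n) c).symm) =ᶠ[𝓝 y] Prod.fst := by
    filter_upwards [hT] with z hz using coneRadius_extChartAt_symm hz
  rw [h2.mfderiv_eq, mfderiv_eq_fderiv, fderiv_fst] at h1
  exact (congrArg (fun A : ℝ × EuclideanSpace ℝ (Fin n) →L[ℝ] ℝ => A u) h1).symm

theorem mfderiv_snd_symm {c : Cone M} {y : ℝ × EuclideanSpace ℝ (Fin n)}
    (hy : y ∈ (extChartAt (coneModel n) c).target) (u : ℝ × EuclideanSpace ℝ (Fin n)) :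
    mfderiv (coneModel n) (𝓡 n) Prod.snd ((extChartAt (coneModel n) c).symm y)
      (mfderiv 𝓘(ℝ, ℝ × EuclideanSpace ℝ (Fin n)) (coneModel n) (extChartAt (coneModel n) c).symm y u)
      = mfderiv (𝓡 n) (𝓡 n) (extChartAt (𝓡 n) c.2).symm y.2 u.2 := by
  have hT := (isOpen_extChartAt_target c).mem_nhds hy
  have h1 := mfderiv_comp y (g := (Prod.snd : Cone M → M))
    (mdifferentiableAt_snd (I := 𝓘(ℝ, ℝ)) (I' := 𝓡 n))
    (((contMDiffOn_extChartAt_symm (I := coneModel n) (n := ∞) c).contMDiffAt hT).mdifferentiableAt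
      (by simp))
  have h2 : (Prod.snd ∘ (extChartAt (coneModel n) c).symm)
      = (extChartAt (𝓡 n) c.2).symm ∘ Prod.snd := funext fun z => extChartAt_cone_symm_snd c z
  have hT' := (isOpen_extChartAt_target (I := 𝓡 n) c.2).mem_nhds (snd_mem_target_of_mem_cone hy)
  have h3 : MDifferentiableAt 𝓘(ℝ, ℝ × EuclideanSpace ℝ (Fin n)) (𝓡 n)
      (Prod.snd : ℝ × EuclideanSpace ℝ (Fin n) → _) y :=
    differentiableAt_snd.mdifferentiableAt
  have h4 := mfderiv_comp y
    (((contMDiffOn_extChartAt_symm (I := 𝓡 n) (n := ∞) c.2).contMDiffAt hT').mdifferentiableAt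
      (by simp)) h3
  rw [h2, h4, mfderiv_eq_fderiv, fderiv_snd] at h1
  exact (congrArg (fun A : ℝ × EuclideanSpace ℝ (Fin n) →L[ℝ] EuclideanSpace ℝ (Fin n) => A u) h1).symm

theorem metricInChart_coneMetric (g : FormField (𝓡 n) M) {c : Cone M}
    {y : ℝ × EuclideanSpace ℝ (Fin n)} (hy : y ∈ (extChartAt (coneModel n) c).target)
    (u v : ℝ × EuclideanSpace ℝ (Fin n)) :
    metricInChart (coneMetric g) c y u v
      = u.1 * v.1 + y.1 ^ 2 * metricInChart g c.2 y.2 u.2 v.2 := by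
  have h : ∀ x x' : M, x = x' → ∀ a b : EuclideanSpace ℝ (Fin n), g x a b = g x' a b := by
    rintro x _ rfl a b
    rfl
  have h1 := coneMetric_apply g ((extChartAt (coneModel n) c).symm y)
    (mfderiv 𝓘(ℝ, ℝ × EuclideanSpace ℝ (Fin n)) (coneModel n) (extChartAt (coneModel n) c).symm y u)
    (mfderiv 𝓘(ℝ, ℝ × EuclideanSpace ℝ (Fin n)) (coneModel n) (extChartAt (coneModel n) c).symm y v)
  rw [radialDifferential_symm hy, radialDifferential_symm hy, coneRadius_extChartAt_symm hy,
    mfderiv_snd_symm hy, mfderiv_snd_symm hy] at h1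
  refine h1.trans (congrArg (fun t : ℝ => u.1 * v.1 + y.1 ^ 2 * t) ?_)
  exact h _ _ (extChartAt_cone_symm_snd c y)
    (mfderiv 𝓘(ℝ, EuclideanSpace ℝ (Fin n)) (𝓡 n) (extChartAt (𝓡 n) c.2).symm y.2 u.2)
    (mfderiv 𝓘(ℝ, EuclideanSpace ℝ (Fin n)) (𝓡 n) (extChartAt (𝓡 n) c.2).symm y.2 v.2)

theorem isSmoothMetric_coneMetric {g : FormField (𝓡 n) M} (hg : IsSmoothMetric g) :
    IsSmoothMetric (coneMetric g) := by
  intro c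
  refine .of_nondegenerate (isOpen_extChartAt_target c) (fun u v => ?_) (fun y hy u v => ?_)
    fun y hy u hu => ?_
  · refine ContDiffOn.congr ?_ fun y hy => metricInChart_coneMetric g hy u v
    have h1 : ContDiffOn ℝ ∞ (fun y : ℝ × EuclideanSpace ℝ (Fin n) => metricInChart g c.2 y.2)
        (extChartAt (coneModel n) c).target :=
      (hg c.2).contDiffOn.comp contDiff_snd.contDiffOn fun y hy => snd_mem_target_of_mem_cone hy
    exact contDiffOn_const.add ((contDiff_fst.pow 2).contDiffOn.mul
      ((h1.clm_apply contDiffOn_const).clm_apply contDiffOn_const))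
  · rw [metricInChart_coneMetric g hy, metricInChart_coneMetric g hy,
      (hg c.2).symm _ (snd_mem_target_of_mem_cone hy) u.2, mul_comm u.1]
  · have h1 := hu (1, 0)
    rw [metricInChart_coneMetric g hy, map_zero] at h1
    refine Prod.ext (by simpa using h1) ?_
    refine (hg c.2).ext (snd_mem_target_of_mem_cone hy) fun z => ?_
    have h2 := hu (0, z)
    rw [metricInChart_coneMetric g hy] at h2
    have h3 := (fst_pos_of_mem_cone hy).ne'
    simpa [h3] using h2

/-- The Euler field `r ∂/∂r` of the cone. -/
def coneEulerField (q : Cone M) : TangentSpace (coneModel n) q :=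
  (tangentCoord (coneModel n) q q).symm (coneRadius q, 0)

/-- The field is defined through a different chart at each point. This value and the vanishing of
its projection to `M` determine it intrinsically, which yields its expression (r, 0) in every chart.
-/
theorem radialDifferential_coneEulerField (q : Cone M) :
    radialDifferential (n := n) q (coneEulerField q) = coneRadius q := by
  have hq := mem_extChartAt_source (I := coneModel n) q
  have h := radialDifferential_symm ((extChartAt (coneModel n) q).map_source hq) (coneRadius q, 0)
  rw [← tangentCoord_symm_apply ((extChartAt (coneModel n) q).map_source hq),
    (extChartAt (coneModel n) q).left_inv hq] at h
  exact h

theorem mfderiv_snd_coneEulerField (q : Cone M) :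
    mfderiv (coneModel n) (𝓡 n) Prod.snd q (coneEulerField q) = 0 := by
  have hq := mem_extChartAt_source (I := coneModel n) q
  have h := mfderiv_snd_symm ((extChartAt (coneModel n) q).map_source hq) (coneRadius q, 0)
  rw [← tangentCoord_symm_apply ((extChartAt (coneModel n) q).map_source hq),
    (extChartAt (coneModel n) q).left_inv hq] at h
  exact h.trans (map_zero _)

theorem vecCoord_coneEulerField {c : Cone M} {y : ℝ × EuclideanSpace ℝ (Fin n)}
    (hy : y ∈ (extChartAt (coneModel n) c).target) :
    vecCoord c (coneEulerField (M := M)) y = (y.1, 0) := by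
  have h1 : mfderiv 𝓘(ℝ, ℝ × EuclideanSpace ℝ (Fin n)) (coneModel n)
      (extChartAt (coneModel n) c).symm y
        (vecCoord c (coneEulerField (M := M)) y : ℝ × EuclideanSpace ℝ (Fin n))
        = coneEulerField ((extChartAt (coneModel n) c).symm y) := by
    rw [← tangentCoord_symm_apply hy, vecCoord, ContinuousLinearEquiv.symm_apply_apply]
  refine Prod.ext ?_ ?_
  · rw [← radialDifferential_symm hy, h1, radialDifferential_coneEulerField,
      coneRadius_extChartAt_symm hy]
  · have h2 := mfderiv_snd_symm hy (vecCoord c (coneEulerField (M := M)) y)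
    rw [h1, mfderiv_snd_coneEulerField] at h2
    rw [← tangentCoord_mfderiv_symm (snd_mem_target_of_mem_cone hy) (vecCoord c _ y).2, ← h2]
    exact map_zero _

theorem fderiv_metricInChart_coneMetric {g : FormField (𝓡 n) M} (hg : IsSmoothMetric g)
    {c : Cone M} {y : ℝ × EuclideanSpace ℝ (Fin n)}
    (hy : y ∈ (extChartAt (coneModel n) c).target) (w u v : ℝ × EuclideanSpace ℝ (Fin n)) :
    fderiv ℝ (metricInChart (coneMetric g) c) y w u v
      = y.1 ^ 2 * fderiv ℝ (metricInChart g c.2) y.2 w.2 u.2 v.2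
        + 2 * y.1 * w.1 * metricInChart g c.2 y.2 u.2 v.2 := by
  have h1 := (isSmoothMetric_coneMetric hg c).hasFDerivAt_apply hy u v
  have h2 := (hg c.2).hasFDerivAt_apply (snd_mem_target_of_mem_cone hy) u.2 v.2
  have h3 := h2.comp y hasFDerivAt_snd
  have h4 := ((hasFDerivAt_fst (𝕜 := ℝ) (p := y)).pow 2).mul h3
  have h5 := (h4.const_add (u.1 * v.1)).congr_of_eventuallyEq
    (f₁ := fun z => metricInChart (coneMetric g) c z u v) (by
      filter_upwards [(isOpen_extChartAt_target c).mem_nhds hy] with z hz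
      exact metricInChart_coneMetric g hz u v)
  have h6 := congrArg (fun A : ℝ × EuclideanSpace ℝ (Fin n) →L[ℝ] ℝ => A w) (h1.unique h5)
  refine h6.trans ?_
  simp
  ring

/-- The vector (r, 0) has no component along `M`, so in the Koszul formula only its own derivative
of the factor r² survives: half of 2r · r g, that is, r² g. -/
theorem christoffel_coneMetric {g : FormField (𝓡 n) M} (hg : IsSmoothMetric g)
    {c : Cone M} {y : ℝ × EuclideanSpace ℝ (Fin n)}
    (hy : y ∈ (extChartAt (coneModel n) c).target) (u : ℝ × EuclideanSpace ℝ (Fin n)) :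
    christoffel (metricInChart (coneMetric g) c) y u (y.1, 0) = (0, u.2) := by
  refine (isSmoothMetric_coneMetric hg c).ext hy fun z => ?_
  rw [(isSmoothMetric_coneMetric hg c).apply_christoffel hy, fderiv_metricInChart_coneMetric hg hy,
    fderiv_metricInChart_coneMetric hg hy, fderiv_metricInChart_coneMetric hg hy,
    metricInChart_coneMetric g hy]
  simp
  ring

/-- In coordinates ξ = (r, 0), whose differential keeps the radial part of a vector; the Christoffel
term restores the part along `M`. -/
theorem isEulerField_coneEulerField {g : FormField (𝓡 n) M} (hg : IsSmoothMetric g) :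
    IsEulerField (coneMetric g) (coneEulerField (M := M)) := by
  intro c y hy
  have h1 : HasFDerivAt (fun z : ℝ × EuclideanSpace ℝ (Fin n) =>
      ((z.1, 0) : ℝ × EuclideanSpace ℝ (Fin n)))
      ((ContinuousLinearMap.fst ℝ ℝ (EuclideanSpace ℝ (Fin n))).prod 0) y :=
    hasFDerivAt_fst.prodMk (hasFDerivAt_const _ _)
  refine (h1.congr_of_eventuallyEq ?_).congr_fderiv ?_
  · filter_upwards [(isOpen_extChartAt_target c).mem_nhds hy] with z hz
    exact vecCoord_coneEulerField hz
  · rw [vecCoord_coneEulerField hy]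
    refine ContinuousLinearMap.ext fun u => ?_
    have h2 := christoffel_coneMetric hg hy u
    change (u.1, (0 : EuclideanSpace ℝ (Fin n)))
      = u - christoffel (metricInChart (coneMetric g) c) y u (y.1, 0)
    rw [h2]
    ext <;> simp

end Cone

end

theorem theorem6 (n : ℕ) (M : Type*) [TopologicalSpace M] [T2Space M] [SecondCountableTopology M]
    [ChartedSpace (EuclideanSpace ℝ (Fin n)) M] [IsManifold (𝓡 n) ∞ M]
    [SimplyConnectedSpace (Cone M)]
    (g : PseudoRiemannianMetric (𝓡 n) M)
    (hsig : HasSignature (coneMetric g.form) 0 (n + 1) ∨ HasSignature (coneMetric g.form) 1 n ∨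
      HasSignature (coneMetric g.form) (n - 1) 2)
    (hflat : ¬ IsFlat (coneMetric g.form))
    (p : Cone M) (ℓ : ℕ) (V : Fin (ℓ + 1) → Submodule ℝ (TangentSpace (coneModel n) p))
    (hV : IsMaximalDecomposition (coneMetric g.form) p ℓ V)
    (k : ℕ) (hk : Module.finrank ℝ (invariantForms (coneMetric g.form) p) = k) :
    k + 2 ≤ n ∧ 1 ≤ ℓ ∧ ℓ ≤ (n - k + 1) / 3 ∧
      ∀ i, i ≠ 0 →
        Module.finrank ℝ (invariantVectors (coneMetric g.form) p ⊓ V i : Submodule ℝ _) + 3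
          ≤ Module.finrank ℝ (V i) := by
  have := locallyPathConnectedSpace_cone n M
  have hG := isSmoothMetric_coneMetric g.isSmoothMetric
  have hξ := isEulerField_coneEulerField g.isSmoothMetric
  obtain ⟨h1, h2⟩ := hV.estimates hG hflat hξ
  have h3 : Module.finrank ℝ (ℝ × EuclideanSpace ℝ (Fin n)) = 1 + n := by
    rw [Module.finrank_prod, Module.finrank_self, finrank_euclideanSpace_fin]
  rw [hk, h3] at h2
  -- From k + 3ℓ ≤ n + 1 and ℓ ≥ 1 follows k ≤ n - 2, so the truncated subtraction n - k is a true
  -- one.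
  exact ⟨by omega, h1, by omega, fun i hi => hV.finrank_inf_add_three_le hG hξ hi⟩
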